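/- **Setting.** For a bounded completely monotone function $g:(0,\infty)\to[0,\infty)$ write $g^{(k)}(0):=\lim_{z\to0+}g^{(k)}(z)$, and let $\nu$ be the finite positive Borel measure on $[0,\infty)$ with $g(z)=\int_{[0,\infty)}e^{-zs}\,\nu(ds)$. Let $\mathcal B_4$ be the set of bounded completely monotone $g$ with $g(0)=1$, $g'(0)=-1$, $g''(0)<\infty$ and $g''''(0)<\infty$. For $g\in\mathcal B_4$ put $G(s)=\int_{[0,s]}(s-\tau)\,\nu(d\tau)$ for $0\le s\le 1$, $G(s)=\int_{[s,\infty)}(\tau-s)\,\nu(d\tau)$ for $s>1$, and $$a[g]=\int_0^\infty G(s)\,ds=\frac{g''(0)-1}{2},\qquad b[g]=\int_0^\infty(1-s)\,G(s)\,ds=\frac{3g''(0)+g'''(0)-2}{6}.$$ If $-A$ generates a bounded $C_0$-semigroup $(e^{-sA})_{s\ge0}$, operators $F(A)$ are understood in the Hille–Phillips calculus, $F(A)x=\int_{[0,\infty)} e^{-sA}x\,\mu(ds)$ for $F(z)=\int_{[0,\infty)} e^{-sz}\mu(ds)$ with $\mu$ a bounded complex Borel measure, and $A^{-\alpha}$ in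 its extension by regularization, applied to $z^{-\alpha}$; $g^n(tA/n)$ is $g^n$ applied to the operator $\frac tnA$. **Proposition.** Let $-A$ be the generator of a sectorially bounded holomorphic $C_0$-semigroup $(e^{-tA})_{t\ge0}$ on a complex Banach space $X$ (that is, for some $\theta\in(0,\pi/2]$ it extends holomorphically to $\{|\arg\lambda|<\theta\}$, the extension being bounded and strongly continuous on $\{0\}\cup\{|\arg\lambda|\le\xi\}$ for every $0<\xi<\theta$). Assume that the range of $A$ is dense in $X$ and that $[0,\infty)\subset\sigma(A)$. Let $g\in\mathcal B_4$ with $g(z)\not\equiv e^{-z}$. Then there is $c>0$ such that for all $\alpha\in[0,1]$, $t>0$ and $n\in\mathbb N$, $n\ge1$, the operator $A^{-\alpha}\bigl(g^n(tA/n)-e^{-tA}\bigr)$ is everywhere defined and bounded, and $$\bigl\|A^{-\alpha}\bigl(g^n(tA/n)-e^{-tA}\bigr)\bigr\|\ge c\,\frac{t^\alpha}{n}.$$ If in addition $b[g]\ne0$, then there is $c>0$ such that for all $\alpha\in[0,1]$, $t>0$ and $n\in\mathbb N$, $n\ge1$, the operators $A^2e^{-tA}$ and $A^{-\alpha}\bigl(g^n(tA/n)-e^{-tA}-a[g]\,n^{-1}t^2A^2e^{-tA}\bigr)$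 are everywhere defined and bounded, and $$\bigl\|A^{-\alpha}\bigl(g^n(tA/n)-e^{-tA}-a[g]\,n^{-1}t^2A^2e^{-tA}\bigr)\bigr\|\ge c\,\frac{t^\alpha}{n^2}.$$ -/

import Mathlib

open Set Filter Topology MeasureTheory
open scoped NNReal ContDiff

/-! ### Completely monotone functions and the class `B₄` -/

/-- `g` is completely monotone on `(0,∞)`: it is smooth there and `(-1)ⁿ g⁽ⁿ⁾ ≥ 0` for all
`n ≥ 0`. Only the values of `g` on `(0,∞)` matter. -/
def CompletelyMonotone (g : ℝ → ℝ) : Prop :=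
  ContDiffOn ℝ ∞ g (Ioi 0) ∧ ∀ n : ℕ, ∀ t : ℝ, 0 < t → 0 ≤ (-1 : ℝ) ^ n * iteratedDeriv n g t

/-- `g⁽ᵏ⁾(0) = L`, where `g⁽ᵏ⁾(0)` denotes the (finite) limit of `g⁽ᵏ⁾(z)` as `z → 0+`. -/
def HasDerivLimitAtZero (g : ℝ → ℝ) (k : ℕ) (L : ℝ) : Prop :=
  Tendsto (iteratedDeriv k g) (𝓝[>] 0) (𝓝 L)

/-- The class `B₄`: bounded completely monotone functions with `g(0) = 1`, `g'(0) = -1`,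
`g''(0) < ∞` and `g''''(0) < ∞`. -/
structure ClassB4 (g : ℝ → ℝ) : Prop where
  completelyMonotone : CompletelyMonotone g
  bounded : ∃ C : ℝ, ∀ t : ℝ, 0 < t → g t ≤ C
  map_zero : HasDerivLimitAtZero g 0 1
  deriv_zero : HasDerivLimitAtZero g 1 (-1)
  deriv2_zero : ∃ L : ℝ, HasDerivLimitAtZero g 2 L
  deriv4_zero : ∃ L : ℝ, HasDerivLimitAtZero g 4 L

/-- `g ∼ ν`: the positive Borel measure `ν` on `[0,∞)` is Laplace transformable and `g` is its
Laplace transform on `(0,∞)`. -/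
def IsLaplaceTransformOf (g : ℝ → ℝ) (ν : Measure ℝ≥0) : Prop :=
  ∀ t : ℝ, 0 < t →
    Integrable (fun s : ℝ≥0 => Real.exp (-(t * (s : ℝ)))) ν ∧
      g t = ∫ s : ℝ≥0, Real.exp (-(t * (s : ℝ))) ∂ν

open Classical in
/-- The measure `ν` with `g ∼ ν`; it exists and is unique for every completely monotone `g`.
(The value is `0` if there is no such measure.) -/
noncomputable def bernsteinMeasure (g : ℝ → ℝ) : Measure ℝ≥0 :=
  if h : ∃ ν : Measure ℝ≥0, IsLaplaceTransformOf g ν then h.choose else 0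

/-- The extension of `g ∼ ν` to the right half-plane, `z ↦ ∫ e^{-sz} ν(ds)`. -/
noncomputable def laplaceExt (g : ℝ → ℝ) (z : ℂ) : ℂ :=
  ∫ s : ℝ≥0, Complex.exp (-(((s : ℝ) : ℂ) * z)) ∂(bernsteinMeasure g)

/-- For `g ∼ ν`: `G(s) = ∫_{[0,s]} (s - τ) ν(dτ)` for `s ≤ 1` and
`G(s) = ∫_{[s,∞)} (τ - s) ν(dτ)` for `s > 1`. -/
noncomputable def densityG (g : ℝ → ℝ) (s : ℝ) : ℝ :=
  if s ≤ 1 then ∫ τ : ℝ≥0 in {τ : ℝ≥0 | (τ : ℝ) ≤ s}, (s - (τ : ℝ)) ∂(bernsteinMeasure g)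
  else ∫ τ : ℝ≥0 in {τ : ℝ≥0 | s ≤ (τ : ℝ)}, ((τ : ℝ) - s) ∂(bernsteinMeasure g)

/-- `a[g] = ∫₀^∞ G(s) ds`. -/
noncomputable def functionalA (g : ℝ → ℝ) : ℝ := ∫ s in Ioi (0 : ℝ), densityG g s

/-- `b[g] = ∫₀^∞ (1 - s) G(s) ds`. -/
noncomputable def functionalB (g : ℝ → ℝ) : ℝ := ∫ s in Ioi (0 : ℝ), (1 - s) * densityG g s

/-! ### Semigroups, generators, spectra -/

/-- A `C₀`-semigroup of bounded operators on `X`, indexed by `[0,∞)`. -/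
structure C0Semigroup (X : Type*) [NormedAddCommGroup X] [NormedSpace ℂ X] where
  op : ℝ≥0 → X →L[ℂ] X
  op_zero : op 0 = ContinuousLinearMap.id ℂ X
  op_add : ∀ s t : ℝ≥0, op (s + t) = (op s).comp (op t)
  continuous_op : ∀ x : X, Continuous fun t : ℝ≥0 => op t x

namespace C0Semigroup

variable {X : Type*} [NormedAddCommGroup X] [NormedSpace ℂ X]

/-- The rescaled semigroup `s ↦ e^{-csA}`; if `-A` generates `S`, then `-cA` generates
`S.scale c`. -/
def scale (S : C0Semigroup X) (c : ℝ≥0) : C0Semigroup X where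
  op s := S.op (c * s)
  op_zero := by rw [mul_zero]; exact S.op_zero
  op_add s t := by rw [mul_add]; exact S.op_add _ _
  continuous_op x := (S.continuous_op x).comp (continuous_const.mul continuous_id)

/-- `-A` is the generator of `S`, so that `S t = e^{-tA}`: for all `x` and `y`, one has
`x ∈ dom A` and `A x = y` exactly when `(x - S h x) / h → y` as `h → 0+`. -/
def IsGeneratedByNeg (S : C0Semigroup X) (A : X →ₗ.[ℂ] X) : Prop :=
  ∀ x y : X, (x, y) ∈ A.graph ↔
    Tendsto (fun h : ℝ≥0 => (((h : ℝ) : ℂ))⁻¹ • (x - S.op h x)) (𝓝[>] 0) (𝓝 y)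

/-- `S` is a sectorially bounded holomorphic semigroup: for some `θ ∈ (0, π/2]` it extends
holomorphically to the sector `|arg z| < θ`, and the extension is bounded and strongly continuous
on each closed sector `|arg z| ≤ ξ` (with `0` included; note `arg 0 = 0`), `0 < ξ < θ`. -/
def IsSectoriallyBoundedHolomorphic (S : C0Semigroup X) : Prop :=
  ∃ θ : ℝ, 0 < θ ∧ θ ≤ Real.pi / 2 ∧ ∃ T : ℂ → X →L[ℂ] X,
    (∀ t : ℝ≥0, T ((t : ℝ) : ℂ) = S.op t) ∧
    DifferentiableOn ℂ T {z : ℂ | z ≠ 0 ∧ |z.arg| < θ} ∧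
    ∀ ξ : ℝ, 0 < ξ → ξ < θ →
      (∃ C : ℝ, ∀ z : ℂ, |z.arg| ≤ ξ → ‖T z‖ ≤ C) ∧
      ∀ x : X, ContinuousOn (fun z => T z x) {z : ℂ | |z.arg| ≤ ξ}

end C0Semigroup

/-- The spectrum of an unbounded operator: the set of `z` for which `z - A : dom A → X` has no
bounded two-sided inverse. -/
def unboundedSpectrum {X : Type*} [NormedAddCommGroup X] [NormedSpace ℂ X]
    (A : X →ₗ.[ℂ] X) : Set ℂ :=
  {z : ℂ | ¬ ∃ R : X →L[ℂ] X,
    (∀ x : X, (R x, z • R x - x) ∈ A.graph) ∧ ∀ x : A.domain, R (z • (x : X) - A x) = x}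

/-! ### The Hille–Phillips calculus -/

/-- `F` is, on the open right half-plane, the Laplace transform of the bounded complex Borel
measure `h dμ` on `[0,∞)`. (Every bounded complex Borel measure has the form `h dμ` with `μ`
finite and positive and `h` integrable.) -/
def IsComplexLaplace (F : ℂ → ℂ) (μ : Measure ℝ≥0) (h : ℝ≥0 → ℂ) : Prop :=
  IsFiniteMeasure μ ∧ Integrable h μ ∧
    ∀ z : ℂ, 0 < z.re → F z = ∫ s : ℝ≥0, h s * Complex.exp (-(((s : ℝ) : ℂ) * z)) ∂μ

/-- `F` belongs to the algebra of Laplace transforms of bounded complex Borel measures on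
`[0,∞)`. -/
def MemLaplaceAlgebra (F : ℂ → ℂ) : Prop :=
  ∃ (μ : Measure ℝ≥0) (h : ℝ≥0 → ℂ), IsComplexLaplace F μ h

namespace C0Semigroup

variable {X : Type*} [NormedAddCommGroup X] [NormedSpace ℂ X]

/-- `T = F(A)` in the Hille–Phillips calculus of a bounded semigroup `S t = e^{-tA}`:
`F = L(h dμ)` and `T x = ∫ h(s) e^{-sA} x μ(ds)` for all `x`. -/
def IsHPValue (S : C0Semigroup X) (F : ℂ → ℂ) (T : X →L[ℂ] X) : Prop :=
  ∃ (μ : Measure ℝ≥0) (h : ℝ≥0 → ℂ), IsComplexLaplace F μ h ∧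
    ∀ x : X, T x = ∫ s : ℝ≥0, h s • S.op s x ∂μ

open Classical in
/-- The operator `F(A)` of the Hille–Phillips calculus of `S t = e^{-tA}` (and `0` if it is not
defined; it is defined and unique for bounded `S` and `F` in the Laplace algebra). -/
noncomputable def hp (S : C0Semigroup X) (F : ℂ → ℂ) : X →L[ℂ] X :=
  if h : ∃ T : X →L[ℂ] X, S.IsHPValue F T then h.choose else 0

/-- The graph of `f(A)` in the extended Hille–Phillips calculus: `x ∈ dom f(A)` and `f(A) x = y`,
that is `(e f)(A) x = e(A) y`, for a regularizer `e` of the holomorphic function `f`. -/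
def ExtendedHPGraph (S : C0Semigroup X) (f : ℂ → ℂ) (x y : X) : Prop :=
  DifferentiableOn ℂ f {z : ℂ | 0 < z.re} ∧
    ∃ e : ℂ → ℂ, MemLaplaceAlgebra e ∧ MemLaplaceAlgebra (fun z => e z * f z) ∧
      Function.Injective (S.hp e) ∧ S.hp (fun z => e z * f z) x = S.hp e y

/-- The graph of the fractional power `A^β`, `β` real: `x ∈ dom(A^β)` and `A^β x = y`. -/
def FracPowGraph (S : C0Semigroup X) (β : ℝ) (x y : X) : Prop :=
  S.ExtendedHPGraph (fun z => z ^ (β : ℂ)) x y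

/-- The operator `A^β T` is everywhere defined, single-valued, and equal to `B`. -/
def FracPowCompEq (S : C0Semigroup X) (β : ℝ) (T B : X →L[ℂ] X) : Prop :=
  ∀ x y : X, S.FracPowGraph β (T x) y ↔ y = B x

/-- The approximant `gⁿ(tA/n)`: the function `gⁿ` evaluated at the operator `tA/n`, whose negative
generates `s ↦ e^{-s(tA/n)}`. -/
noncomputable def approximant (S : C0Semigroup X) (g : ℝ → ℝ) (t : ℝ≥0) (n : ℕ) : X →L[ℂ] X :=
  (S.scale (t / (n : ℝ≥0))).hp fun z => laplaceExt g z ^ n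

end C0Semigroup

/-- The operator `A² T` is everywhere defined and equal to the bounded operator `D`. -/
def SquareCompEq {X : Type*} [NormedAddCommGroup X] [NormedSpace ℂ X]
    (A : X →ₗ.[ℂ] X) (T D : X →L[ℂ] X) : Prop :=
  ∀ x : X, ∃ y : X, (T x, y) ∈ A.graph ∧ (y, D x) ∈ A.graph

set_option linter.unusedSectionVars false

/-! ### Bernstein's theorem for completely monotone functions with a finite limit at zero -/

namespace CompletelyMonotone

/-! The lower bounds come from spectral inclusion: if `r > 0` lies in the spectrum of `A`, then
`‖F(A)‖ ≥ |F(r)|`. For `F(z) = z^(-α) (gⁿ(tz/n) - e^(-tz))`, with or without the second-order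
correction, and `r = s/t`, the dependence on `t` splits off as `t^α s^(-α)`. What remains is a
scalar bound at a fixed `s`, uniform in `n`.

Scalar part. The representing measure `ν` has mass and mean one, so `e^z g(z) = ∫ e^(z(1-τ)) ν(dτ) =
1 + a z² + b z³ + O(z⁴)`, where Fubini identifies `a` and `b` with the centred moments `∫ (1-τ)²/2
dν` and `∫ (1-τ)³/6 dν`. At `z = s/n` the n-th power exceeds `1` by `a s²/n + b s³/n² + O(s⁴/n²)`.
The first bound takes `s = 1` and uses convexity (`exists_first_order_lower_bound`); the second
takes `s` so small that the cubic term wins (`exists_second_order_lower_bound`). Since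
`bernsteinMeasure` is a choice with default `0`, Bernstein's theorem has to be proved to give it
content.

Operator part. Among the operators commuting with the semigroup, those of the form `(r - A)H` stay
at distance at least one from the identity when `r` is spectral, since otherwise a Neumann series
would produce a resolvent. Hence `V - v` in the closure of this ideal forces `|v| ≤ ‖V‖`
(`norm_le_of_sub_mem_closure_resolventIdeal`). The ideal contains `e^(-sA) - e^(-rs)` explicitly,
and the closure is stable under Bochner integrals in operator norm. These integrals exist because a
holomorphic semigroup is norm continuous on `(0,∞)`. So `F(A) - F(r)` lies in the closure for every
function built this way.

Fractional powers. `A^(-α)` is handled through the regularizer `1 - e^(-z)`, whose operator is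
injective because the range of `A` is dense. The operators `W s = (1 - e^(-sA)) A^(-α)` are
absolutely convergent integrals of the semigroup when `0 < α ≤ 1`. They give the bounded value of
`A^(-α)(∫ e^(-sA) ρ(ds) - e^(-tA))` as `W t - ∫ W dρ`, where `gⁿ(tA/n) = ∫ e^(-sA) ρ(ds)`. -/

lemma contDiffAt {f : ℝ → ℝ} (hf : CompletelyMonotone f) {x : ℝ} (hx : 0 < x) :
    ContDiffAt ℝ ∞ f x :=
  hf.1.contDiffAt (Ioi_mem_nhds hx)

lemma congr {f g : ℝ → ℝ} (hf : CompletelyMonotone f) (h : EqOn g f (Ioi 0)) :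
    CompletelyMonotone g := by
  refine ⟨hf.1.congr h, fun n t ht => ?_⟩
  rw [h.iteratedDeriv_of_isOpen isOpen_Ioi n ht]
  exact hf.2 n t ht

lemma differentiableAt_iteratedDeriv {f : ℝ → ℝ} (hf : CompletelyMonotone f) (n : ℕ) {x : ℝ}
    (hx : 0 < x) : DifferentiableAt ℝ (iteratedDeriv n f) x := by
  have h := hf.1.differentiableOn_iteratedDerivWithin (m := n) (mod_cast ENat.natCast_lt_top n)
    isOpen_Ioi.uniqueDiffOn
  exact ((h.congr fun y hy => (iteratedDerivWithin_of_isOpen isOpen_Ioi hy).symm) x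
    hx).differentiableAt (Ioi_mem_nhds hx)

lemma antitoneOn_iteratedDeriv {f : ℝ → ℝ} (hf : CompletelyMonotone f) (n : ℕ) :
    AntitoneOn (fun x => (-1 : ℝ) ^ n * iteratedDeriv n f x) (Ioi 0) := by
  have hd : ∀ x ∈ Ioi (0 : ℝ), DifferentiableAt ℝ (fun x => (-1 : ℝ) ^ n * iteratedDeriv n f x) x :=
    fun x hx => (hf.differentiableAt_iteratedDeriv n hx).const_mul _
  refine antitoneOn_of_deriv_nonpos (convex_Ioi 0)
    (fun x hx => (hd x hx).continuousAt.continuousWithinAt)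
    (fun x hx => (hd x (interior_subset hx)).differentiableWithinAt) fun x hx => ?_
  have hx' : 0 < x := interior_subset hx
  have h := hf.2 (n + 1) x hx'
  rw [iteratedDeriv_succ] at h
  rw [deriv_const_mul _ (hf.differentiableAt_iteratedDeriv n hx')]
  rw [pow_succ] at h
  linarith

/-- Each signed derivative `(-1)ⁿ f⁽ⁿ⁾` is antitone, because its own derivative is minus the next
signed derivative. This makes finite differences iterable inside the class. -/
lemma sub_shift {f : ℝ → ℝ} (hf : CompletelyMonotone f) {h : ℝ} (hh : 0 ≤ h) :
    CompletelyMonotone (fun x => f x - f (x + h)) := by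
  have hs : ∀ x : ℝ, 0 < x → ContDiffAt ℝ ∞ (fun x => f (x + h)) x := fun x hx =>
    ContDiffAt.comp x (hf.contDiffAt (by linarith)) (contDiffAt_id.add contDiffAt_const)
  refine ⟨fun x hx => ((hf.contDiffAt hx).sub (hs x hx)).contDiffWithinAt, fun n t ht => ?_⟩
  have e : iteratedDeriv n (fun x => f x - f (x + h)) t
      = iteratedDeriv n f t - iteratedDeriv n f (t + h) := by
    have := iteratedDeriv_sub (n := n) (x := t) ((hf.contDiffAt ht).of_le (mod_cast le_top))
      ((hs t ht).of_le (mod_cast le_top))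
    rw [iteratedDeriv_comp_add_const] at this
    exact this
  rw [e, mul_sub, sub_nonneg]
  exact hf.antitoneOn_iteratedDeriv n (mem_Ioi.2 ht) (mem_Ioi.2 (by linarith)) (by linarith)

/-- Alternating finite differences of a completely monotone function, continuous at zero, are
nonnegative. -/
lemma fwdDiff_neg_iter_nonneg {f : ℝ → ℝ} (hf : CompletelyMonotone f) (hc : Continuous f)
    {h : ℝ} (hh : 0 ≤ h) (k : ℕ) {y : ℝ} (hy : k * h ≤ y) : 0 ≤ (fwdDiff (-h))^[k] f y := by
  set D : (ℝ → ℝ) → ℝ → ℝ := fun f x => f x - f (x + h) with hD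
  have key : ∀ k : ℕ, ∀ y : ℝ, (fwdDiff (-h))^[k] f y = D^[k] f (y - k * h) := by
    intro k
    induction k with
    | zero => intro y; simp
    | succ k ih =>
      intro y
      rw [Function.iterate_succ_apply', Function.iterate_succ_apply']
      simp only [fwdDiff, hD, ih]
      push_cast
      congr 2 <;> ring_nf
  have hcm : ∀ k : ℕ, CompletelyMonotone (D^[k] f) ∧ Continuous (D^[k] f) := by
    intro k
    induction k with
    | zero => exact ⟨hf, hc⟩
    | succ k ih =>
      rw [Function.iterate_succ_apply']
      exact ⟨ih.1.sub_shift hh, ih.2.sub (ih.2.comp (continuous_id.add continuous_const))⟩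
  rw [key]
  have hpos : ∀ x ∈ Ioi (0 : ℝ), 0 ≤ D^[k] f x := fun x hx => by
    simpa using (hcm k).1.2 0 x hx
  -- The endpoint `y = k * h` evaluates the difference at `0`, outside the domain of complete
  -- monotonicity; continuity covers it.
  have hcl : closure (Ioi (0 : ℝ)) ⊆ {x | 0 ≤ D^[k] f x} :=
    (isClosed_le continuous_const (hcm k).2).closure_subset_iff.2 hpos
  rw [closure_Ioi] at hcl
  exact hcl (by simpa using hy)

end CompletelyMonotone

/-- The Gregory–Newton formula written backwards from `N h`. -/
lemma eq_sum_choose_mul_fwdDiff_neg (f : ℝ → ℝ) (h : ℝ) {j N : ℕ} (hj : j ≤ N) :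
    f (j * h) = ∑ k ∈ Finset.range (N + 1),
      ((N - j).choose k : ℝ) * (fwdDiff (-h))^[k] f (N * h) := by
  have := shift_eq_sum_fwdDiff_iter (-h) f (N - j) (N * h)
  have e : (N * h + (N - j) • (-h) : ℝ) = j * h := by
    rw [nsmul_eq_mul, Nat.cast_sub hj]; ring
  rw [e] at this
  rw [this]
  simp only [nsmul_eq_mul]
  refine Finset.sum_subset (fun k hk => ?_) (fun k _ hk => ?_)
  · simp only [Finset.mem_range] at hk ⊢; omega
  · rw [Nat.choose_eq_zero_of_lt (by simpa using hk)]; simp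

/-- The ratio is the product over `i < j` of `(N - i - k)/(N - i)`, the chance of avoiding a `k`-set
in `j` draws without replacement; `(1 - k/N)^j` is the same with replacement. Each factor differs
from `1 - k/N` by at most `i/(N - i)`, and the errors add up. -/
lemma abs_choose_div_choose_sub_pow_le {k N : ℕ} (hk : k ≤ N) : ∀ {j : ℕ}, j < N →
    |((N - j).choose k : ℝ) / (N.choose k : ℝ) - (1 - (k : ℝ) / N) ^ j|
      ≤ (j : ℝ) ^ 2 / ((N : ℝ) - j) := by
  have hCpos : (0 : ℝ) < N.choose k := by exact_mod_cast Nat.choose_pos hk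
  intro j
  induction j with
  | zero => intro _; simp [hCpos.ne']
  | succ j ih =>
    intro hj
    have hN : (0 : ℝ) < N := by exact_mod_cast (by omega : 0 < N)
    have hNj : (0 : ℝ) < (N : ℝ) - (j + 1) := by
      have : ((j + 1 : ℕ) : ℝ) < N := by exact_mod_cast hj
      push_cast at this; linarith
    have ih := ih (by omega)
    set r : ℝ := ((N - j).choose k : ℝ) / (N.choose k : ℝ) with hr
    set q : ℝ := 1 - (k : ℝ) / N with hq
    have hkN : (k : ℝ) ≤ N := by exact_mod_cast hk
    have hq0 : 0 ≤ q := by rw [hq, sub_nonneg, div_le_one hN]; exact hkN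
    have hq1 : q ≤ 1 := by rw [hq]; linarith [div_nonneg (Nat.cast_nonneg (α := ℝ) k) hN.le]
    set c : ℝ := ((N - j - k : ℕ) : ℝ) / ((N : ℝ) - j) with hc
    have hstep : ((N - (j + 1)).choose k : ℝ) / (N.choose k : ℝ) = r * c := by
      have := Nat.choose_mul_succ_eq (N - (j + 1)) k
      have e : N - (j + 1) + 1 = N - j := by omega
      have e2 : ((N - (j + 1) : ℕ) : ℝ) + 1 = (N : ℝ) - j := by
        rw [Nat.cast_sub (by omega)]; push_cast; ring
      simp only [e] at this
      have t : ((N - (j + 1)).choose k : ℝ) * ((N : ℝ) - j)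
          = ((N - j).choose k : ℝ) * ((N - j - k : ℕ) : ℝ) := by
        rw [← e2, ← Nat.cast_succ, Nat.succ_eq_add_one, e]; exact_mod_cast this
      rw [hr, hc, div_mul_div_comm, div_eq_div_iff hCpos.ne' (by nlinarith), ← mul_assoc,
        mul_comm (_ * _) ((N : ℝ) - j)] 
      linear_combination (N.choose k : ℝ) * t
    have hr0 : 0 ≤ r := by positivity
    have hr1 : r ≤ 1 := by
      rw [hr, div_le_one hCpos]
      exact_mod_cast Nat.choose_le_choose k (by omega)
    have hcq : |c - q| ≤ j / ((N : ℝ) - (j + 1)) := by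
      have hNj' : (0 : ℝ) < (N : ℝ) - j := by linarith
      have hj0 : (0 : ℝ) ≤ j := Nat.cast_nonneg j
      have hk0 : (0 : ℝ) ≤ k := Nat.cast_nonneg k
      have hle : c ≤ q := by
        rw [hc, hq, div_le_iff₀ hNj']
        rcases le_total k (N - j) with h | h
        · rw [Nat.cast_sub h, Nat.cast_sub (by omega)]
          have : (k : ℝ) / N * j ≤ k / N * N := by gcongr; linarith
          rw [div_mul_cancel₀ _ hN.ne'] at this
          have : 0 ≤ (k : ℝ) / N * j := by positivity
          have e : (1 - (k : ℝ) / N) * (N - j) = N - j - k + (k : ℝ) / N * j := by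
            field_simp; ring
          rw [e]; linarith
        · rw [Nat.sub_eq_zero_of_le h]; simp only [Nat.cast_zero]; positivity
      rw [abs_sub_comm, abs_of_nonneg (sub_nonneg.2 hle)]
      have hge : ((N : ℝ) - j - k) / (N - j) ≤ c := by
        rw [hc]; gcongr
        have : N ≤ (N - j - k) + j + k := by omega
        have : (N : ℝ) ≤ ((N - j - k : ℕ) : ℝ) + j + k := by exact_mod_cast this
        linarith
      have e : q - ((N : ℝ) - j - k) / (N - j) = k / N * (j / (N - j)) := by
        rw [hq]; field_simp; ring
      have h1 : (k : ℝ) / N ≤ 1 := by rw [div_le_one hN]; exact hkN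
      calc q - c ≤ q - ((N : ℝ) - j - k) / (N - j) := by linarith
        _ = k / N * (j / (N - j)) := e
        _ ≤ 1 * (j / (N - j)) := by gcongr
        _ ≤ j / ((N : ℝ) - (j + 1)) := by rw [one_mul]; gcongr; linarith
    rw [hstep, pow_succ]
    have e : r * c - q ^ j * q = r * (c - q) + (r - q ^ j) * q := by ring
    calc |r * c - q ^ j * q| ≤ |r * (c - q)| + |(r - q ^ j) * q| := by rw [e]; exact abs_add_le _ _
      _ = r * |c - q| + |r - q ^ j| * q := by
          rw [abs_mul, abs_mul, abs_of_nonneg hr0, abs_of_nonneg hq0]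
      _ ≤ 1 * (j / ((N : ℝ) - (j + 1))) + ((j : ℝ) ^ 2 / ((N : ℝ) - j)) * 1 := by
          have : 0 ≤ (j : ℝ) ^ 2 / ((N : ℝ) - j) := (abs_nonneg _).trans ih
          gcongr
      _ ≤ j / ((N : ℝ) - (j + 1)) + (j : ℝ) ^ 2 / ((N : ℝ) - (j + 1)) := by
          rw [one_mul, mul_one]; gcongr _ + (j : ℝ) ^ 2 / ?_; linarith
      _ ≤ ((j + 1 : ℕ) : ℝ) ^ 2 / ((N : ℝ) - (j + 1 : ℕ)) := by
          rw [← add_div]; push_cast; gcongr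
          nlinarith [Nat.cast_nonneg (α := ℝ) j]

/-- The power function `x ↦ x ^ t` on the unit interval. -/
noncomputable def unitIntervalRpow (t : ℝ) (ht : 0 ≤ t) : BoundedContinuousFunction unitInterval ℝ :=
  BoundedContinuousFunction.mkOfCompact
    ⟨fun x => (x : ℝ) ^ t, continuous_subtype_val.rpow_const fun _ => Or.inr ht⟩

/-- The Newton expansion of `f` backwards from `N h` has nonnegative coefficients. Normalised by
`N.choose k` they become weights, which sum to `f 0 = 1`, and `f (j h)` is the weighted mean of the
ratios `(N - j).choose k / N.choose k`. Replacing these by `(1 - k/N)^j` gives a moment of a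
discrete measure. The mesh is `h = 2^(-M)` and `N = 8^M`, so that the error vanishes at a fixed
dyadic point as `M` grows. -/
lemma exists_probabilityMeasure_abs_integral_sub_le {f : ℝ → ℝ} (hf : CompletelyMonotone f)
    (hc : Continuous f) (h0 : f 0 = 1) (M : ℕ) :
    ∃ μ : ProbabilityMeasure unitInterval, ∀ j : ℕ, j < 8 ^ M →
      ∀ h : (0 : ℝ) ≤ (j : ℝ) / 2 ^ M,
      |∫ x, unitIntervalRpow ((j : ℝ) / 2 ^ M) h x ∂(μ : Measure unitInterval)
        - f ((j : ℝ) / 2 ^ M)| ≤ (j : ℝ) ^ 2 / ((8 : ℝ) ^ M - j) := by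
  set N : ℕ := 8 ^ M with hN
  set m : ℕ := 2 ^ M with hm
  set h : ℝ := ((2 : ℝ) ^ M)⁻¹ with hh
  have hNpos : (0 : ℝ) < N := by rw [hN]; positivity
  set w : ℕ → ℝ := fun k => (N.choose k : ℝ) * (fwdDiff (-h))^[k] f (N * h) with hw
  have hw0 : ∀ k ∈ Finset.range (N + 1), 0 ≤ w k := fun k hk => by
    refine mul_nonneg (Nat.cast_nonneg _)
      (hf.fwdDiff_neg_iter_nonneg hc (by positivity) k ?_)
    have : (k : ℝ) ≤ N := by exact_mod_cast Nat.lt_succ_iff.1 (Finset.mem_range.1 hk)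
    have hpos : 0 ≤ h := by positivity
    gcongr
  have hwsum : ∑ k ∈ Finset.range (N + 1), w k = 1 := by
    have := eq_sum_choose_mul_fwdDiff_neg f h (Nat.zero_le N)
    simp only [Nat.cast_zero, zero_mul, h0, Nat.sub_zero] at this
    exact this.symm
  -- The node is `(1 - k/N)^(2^M)`, so that its power `j / 2^M` is `(1 - k/N)^j`. The `max` only
  -- keeps nodes with `k > N`, which carry no weight, inside the interval.
  have hx : ∀ k : ℕ, max 0 (1 - (k : ℝ) / N) ^ m ∈ unitInterval := fun k =>
    ⟨pow_nonneg (le_max_left _ _) m, pow_le_one₀ (le_max_left _ _) (max_le zero_le_one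
      (by linarith [div_nonneg (Nat.cast_nonneg (α := ℝ) k) hNpos.le]))⟩
  set x : ℕ → unitInterval := fun k => ⟨max 0 (1 - (k : ℝ) / N) ^ m, hx k⟩ with hxdef
  set μ : Measure unitInterval :=
    ∑ k ∈ Finset.range (N + 1), ENNReal.ofReal (w k) • Measure.dirac (x k) with hμ
  have hprob : IsProbabilityMeasure μ := by
    constructor
    simp only [hμ, Measure.coe_finsetSum, Finset.sum_apply, Measure.smul_apply, measure_univ,
      smul_eq_mul, mul_one]
    rw [← ENNReal.ofReal_sum_of_nonneg hw0, hwsum, ENNReal.ofReal_one]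
  refine ⟨⟨μ, hprob⟩, fun j hj hj0 => ?_⟩
  have hint : ∫ y, unitIntervalRpow ((j : ℝ) / 2 ^ M) hj0 y ∂μ
      = ∑ k ∈ Finset.range (N + 1), w k * (1 - (k : ℝ) / N) ^ j := by
    rw [hμ, integral_finsetSum_measure (fun k _ => (BoundedContinuousFunction.integrable
      (Measure.dirac (x k)) _).smul_measure ENNReal.ofReal_ne_top)]
    refine Finset.sum_congr rfl fun k hk => ?_
    rw [integral_smul_measure, integral_dirac, ENNReal.toReal_ofReal (hw0 k hk), smul_eq_mul]
    congr 1
    have hk' : (k : ℝ) ≤ N := by exact_mod_cast Nat.lt_succ_iff.1 (Finset.mem_range.1 hk)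
    have h1 : 0 ≤ 1 - (k : ℝ) / N := by rw [sub_nonneg, div_le_one hNpos]; exact hk'
    change ((x k : unitInterval) : ℝ) ^ ((j : ℝ) / 2 ^ M) = _
    have e : ((x k : unitInterval) : ℝ) = (1 - (k : ℝ) / N) ^ m := by
      simp only [hxdef, max_eq_right h1]
    have em : (m : ℝ) * ((j : ℝ) / 2 ^ M) = j := by rw [hm]; push_cast; field_simp
    rw [e, ← Real.rpow_natCast, ← Real.rpow_mul h1, em, Real.rpow_natCast]
  change |∫ y, unitIntervalRpow ((j : ℝ) / 2 ^ M) hj0 y ∂μ - _| ≤ _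
  have hfj : f ((j : ℝ) / 2 ^ M) = ∑ k ∈ Finset.range (N + 1),
      w k * (((N - j).choose k : ℝ) / (N.choose k : ℝ)) := by
    rw [div_eq_mul_inv, ← hh, eq_sum_choose_mul_fwdDiff_neg f _ hj.le]
    refine Finset.sum_congr rfl fun k hk => ?_
    have : (N.choose k : ℝ) ≠ 0 := by
      exact_mod_cast (Nat.choose_pos (Nat.lt_succ_iff.1 (Finset.mem_range.1 hk))).ne'
    simp only [hw]; field_simp
  rw [hint, hfj, ← Finset.sum_sub_distrib]
  have hNc : (N : ℝ) = 8 ^ M := by rw [hN]; push_cast; rfl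
  calc |∑ k ∈ Finset.range (N + 1), (w k * (1 - (k : ℝ) / N) ^ j
          - w k * (((N - j).choose k : ℝ) / (N.choose k : ℝ)))|
      ≤ ∑ k ∈ Finset.range (N + 1), |w k * (1 - (k : ℝ) / N) ^ j
          - w k * (((N - j).choose k : ℝ) / (N.choose k : ℝ))| := Finset.abs_sum_le_sum_abs _ _
    _ ≤ ∑ k ∈ Finset.range (N + 1), w k * ((j : ℝ) ^ 2 / ((8 : ℝ) ^ M - j)) := by
        refine Finset.sum_le_sum fun k hk => ?_
        rw [← mul_sub, abs_mul, abs_of_nonneg (hw0 k hk), abs_sub_comm]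
        refine mul_le_mul_of_nonneg_left ?_ (hw0 k hk)
        rw [← hNc]
        exact abs_choose_div_choose_sub_pow_le (Nat.lt_succ_iff.1 (Finset.mem_range.1 hk)) hj
    _ = _ := by rw [← Finset.sum_mul, hwsum, one_mul]

/-- Probability measures on a compact interval are weakly compact. A limit of the discrete measures
has the right moments at dyadic exponents, and both sides are continuous in the exponent. -/
lemma exists_probabilityMeasure_integral_rpow_eq {f : ℝ → ℝ} (hf : CompletelyMonotone f)
    (hc : Continuous f) (h0 : f 0 = 1) :
    ∃ μ : ProbabilityMeasure unitInterval, ∀ t : ℝ, 0 < t →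
      ∫ x, (x : ℝ) ^ t ∂(μ : Measure unitInterval) = f t := by
  choose ρ hρ using exists_probabilityMeasure_abs_integral_sub_le hf hc h0
  obtain ⟨μ, -, hμ⟩ := isCompact_univ.ultrafilter_le_nhds ((hyperfilter ℕ).map ρ) (by simp)
  have hlim : Tendsto ρ (hyperfilter ℕ : Filter ℕ) (𝓝 μ) := hμ
  refine ⟨μ, ?_⟩
  have hdy : ∀ a b : ℕ, ∫ x, (x : ℝ) ^ ((a : ℝ) / 2 ^ b) ∂(μ : Measure unitInterval)
      = f ((a : ℝ) / 2 ^ b) := by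
    intro a b
    have hnn : (0 : ℝ) ≤ (a : ℝ) / 2 ^ b := by positivity
    have h1 := (ProbabilityMeasure.tendsto_iff_forall_integral_tendsto.1 hlim)
      (unitIntervalRpow ((a : ℝ) / 2 ^ b) hnn)
    have h2 : Tendsto (fun M : ℕ => ∫ x, unitIntervalRpow ((a : ℝ) / 2 ^ b) hnn x
        ∂(ρ M : Measure unitInterval)) atTop (𝓝 (f ((a : ℝ) / 2 ^ b))) := by
      rw [← tendsto_sub_nhds_zero_iff]
      -- At `a / 2^b = j / 2^M` one has `j ≤ a 2^M` and eventually `8^M - j ≥ 8^M / 2`, so the error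
      -- is at most `2 a² 4^M / 8^M`.
      refine squeeze_zero_norm' (a := fun M : ℕ => 2 * (a : ℝ) ^ 2 * (1 / 2) ^ M) ?_ ?_
      · have hev : ∀ᶠ M : ℕ in atTop, (2 * (a : ℝ)) < 4 ^ M :=
          (tendsto_pow_atTop_atTop_of_one_lt (by norm_num)).eventually_gt_atTop _
        filter_upwards [hev, eventually_ge_atTop b] with M hM hb
        set j : ℕ := a * 2 ^ (M - b) with hj
        have hpow : (2 : ℝ) ^ (M - b) * 2 ^ b = 2 ^ M := by rw [← pow_add]; congr 1; omega
        have hjM : (j : ℝ) / 2 ^ M = (a : ℝ) / 2 ^ b := by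
          rw [hj, ← hpow]; push_cast; field_simp
        have hle : (2 : ℝ) ^ (M - b) ≤ 2 ^ M := pow_le_pow_right₀ (by norm_num) (by omega)
        have h8 : (8 : ℝ) ^ M = 2 ^ M * 4 ^ M := by rw [← mul_pow]; norm_num
        have h4 : (4 : ℝ) ^ M = 2 ^ M * 2 ^ M := by rw [← mul_pow]; norm_num
        have hjle : (j : ℝ) ≤ a * 2 ^ M := by
          rw [hj]; push_cast; gcongr
        have h2p : (0 : ℝ) < 2 ^ M := by positivity
        have hj8 : 2 * (j : ℝ) < 8 ^ M := by rw [h8]; nlinarith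
        have hjlt : j < 8 ^ M := by
          have : (j : ℝ) < 8 ^ M := by linarith [Nat.cast_nonneg (α := ℝ) j]
          exact_mod_cast this
        have key := hρ M j hjlt (by positivity)
        simp only [hjM] at key
        rw [Real.norm_eq_abs]
        refine key.trans ?_
        have hden : (8 : ℝ) ^ M / 2 ≤ 8 ^ M - j := by linarith
        calc (j : ℝ) ^ 2 / (8 ^ M - j) ≤ (a * 2 ^ M) ^ 2 / (8 ^ M / 2) := by gcongr
          _ = 2 * (a : ℝ) ^ 2 * (1 / 2) ^ M := by
            rw [h8, h4, one_div, inv_pow]; field_simp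
      · have := tendsto_pow_atTop_nhds_zero_of_lt_one (r := (1 / 2 : ℝ)) (by norm_num) (by norm_num)
        simpa using this.const_mul (2 * (a : ℝ) ^ 2)
    exact tendsto_nhds_unique h1 (h2.mono_left Nat.hyperfilter_le_atTop)
  intro t ht
  have hcont : ContinuousAt (fun s : ℝ => ∫ x, (x : ℝ) ^ s ∂(μ : Measure unitInterval)) t := by
    refine continuousAt_of_dominated (bound := fun _ => 1) ?_ ?_ (integrable_const _) ?_
    · filter_upwards [Ioi_mem_nhds ht] with s hs
      exact ((unitIntervalRpow s (le_of_lt hs)).continuous).aestronglyMeasurable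
    · filter_upwards [Ioi_mem_nhds ht] with s hs
      refine Eventually.of_forall fun x => ?_
      rw [Real.norm_of_nonneg (Real.rpow_nonneg x.2.1 _)]
      exact Real.rpow_le_one x.2.1 x.2.2 (le_of_lt hs)
    · exact Eventually.of_forall fun x => Real.continuousAt_const_rpow' ht.ne'
  have hseq : Tendsto (fun b : ℕ => (⌊t * 2 ^ b⌋₊ : ℝ) / 2 ^ b) atTop (𝓝 t) :=
    (tendsto_nat_floor_mul_div_atTop ht.le).comp
      (tendsto_pow_atTop_atTop_of_one_lt (by norm_num : (1 : ℝ) < 2))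
  have h1 := hcont.tendsto.comp hseq
  have h2 := (hc.tendsto t).comp hseq
  refine tendsto_nhds_unique h1 (h2.congr fun b => ?_)
  exact (hdy _ b).symm

/-- **Bernstein's theorem** for completely monotone functions with a finite limit at zero. -/
theorem CompletelyMonotone.exists_isLaplaceTransformOf {g : ℝ → ℝ} (hg : CompletelyMonotone g)
    (h0 : HasDerivLimitAtZero g 0 1) : ∃ ν : Measure ℝ≥0, IsLaplaceTransformOf g ν := by
  set f : ℝ → ℝ := fun x => if x ≤ 0 then 1 else g x with hfdef
  have hEq : EqOn f g (Ioi 0) := fun x hx => by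
    rw [hfdef]; simp only [if_neg (not_le.2 (mem_Ioi.1 hx))]
  have hf : CompletelyMonotone f := hg.congr hEq
  have hlim : Tendsto g (𝓝[>] 0) (𝓝 1) := by simpa [HasDerivLimitAtZero] using h0
  have hc : Continuous f := by
    rw [continuous_iff_continuousAt]
    intro x
    rcases lt_trichotomy x 0 with hx | rfl | hx
    · have : f =ᶠ[𝓝 x] fun _ => 1 := by
        filter_upwards [Iio_mem_nhds hx] with y hy
        rw [hfdef]; simp only [if_pos (le_of_lt (mem_Iio.1 hy))]
      exact (continuousAt_congr this).2 continuousAt_const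
    · have hf0 : f 0 = 1 := by simp [hfdef]
      rw [← continuousWithinAt_univ, ← Iic_union_Ioi (a := (0 : ℝ)), continuousWithinAt_union]
      refine ⟨?_, ?_⟩
      · refine (continuousWithinAt_const (b := (1 : ℝ))).congr (fun y hy => ?_) hf0
        exact if_pos (mem_Iic.1 hy)
      · unfold ContinuousWithinAt
        rw [hf0]
        exact hlim.congr' (eventuallyEq_nhdsWithin_of_eqOn hEq.symm)
    · exact (hf.contDiffAt hx).continuousAt
  obtain ⟨μ, hμ⟩ := exists_probabilityMeasure_integral_rpow_eq hf hc (by simp [hfdef])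
  set φ : unitInterval → ℝ≥0 := fun x => Real.toNNReal (-Real.log x) with hφ
  have hφm : Measurable φ := by fun_prop
  -- The substitution `x = e^(-s)` misses `x = 0`. An atom there may be dropped, since `0 ^ t = 0`
  -- for `t > 0`.
  set E : Set unitInterval := {x | (x : ℝ) ≠ 0} with hE
  have hEm : MeasurableSet E :=
    (isOpen_ne_fun continuous_subtype_val continuous_const).measurableSet
  have hcov : ∀ t : ℝ, ∀ x ∈ E, Real.exp (-(t * (φ x : ℝ))) = (x : ℝ) ^ t := fun t x hx => by
    have hx0 : 0 < (x : ℝ) := lt_of_le_of_ne x.2.1 (Ne.symm hx)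
    rw [hφ, Real.coe_toNNReal _ (by simpa using Real.log_nonpos x.2.1 x.2.2),
      Real.rpow_def_of_pos hx0]
    ring_nf
  refine ⟨((μ : Measure unitInterval).restrict E).map φ, fun t ht => ⟨?_, ?_⟩⟩
  · refine (integrable_const (1 : ℝ)).mono' (by fun_prop) (Eventually.of_forall fun s => ?_)
    rw [Real.norm_of_nonneg (Real.exp_nonneg _), Real.exp_le_one_iff]
    have := s.2
    exact neg_nonpos.2 (mul_nonneg ht.le this)
  · rw [integral_map hφm.aemeasurable (by fun_prop), setIntegral_congr_fun hEm (hcov t),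
      setIntegral_eq_integral_of_forall_compl_eq_zero, hμ t ht, hEq ht]
    intro x hx
    have : (x : ℝ) = 0 := by simpa [hE] using hx
    rw [this, Real.zero_rpow ht.ne']

/-! ### Moments of the representing measure -/

lemma ClassB4.isLaplaceTransformOf {g : ℝ → ℝ} (hg : ClassB4 g) :
    IsLaplaceTransformOf g (bernsteinMeasure g) := by
  have h := hg.completelyMonotone.exists_isLaplaceTransformOf hg.map_zero
  rw [bernsteinMeasure, dif_pos h]
  exact h.choose_spec

namespace IsLaplaceTransformOf

variable {g : ℝ → ℝ} {ν : Measure ℝ≥0}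

lemma mem_interior_integrableExpSet (h : IsLaplaceTransformOf g ν) {t : ℝ} (ht : 0 < t) :
    t ∈ interior (ProbabilityTheory.integrableExpSet (fun s : ℝ≥0 => -(s : ℝ)) ν) := by
  have : Ioi (0 : ℝ) ⊆ ProbabilityTheory.integrableExpSet (fun s : ℝ≥0 => -(s : ℝ)) ν := by
    intro u hu
    simpa [ProbabilityTheory.integrableExpSet] using (h u hu).1
  exact interior_mono this (by rw [interior_Ioi]; exact ht)

lemma iteratedDeriv_eq (h : IsLaplaceTransformOf g ν) (k : ℕ) {t : ℝ} (ht : 0 < t) :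
    (-1 : ℝ) ^ k * iteratedDeriv k g t = ∫ s : ℝ≥0, (s : ℝ) ^ k * Real.exp (-(t * s)) ∂ν := by
  have hE : EqOn g (ProbabilityTheory.mgf (fun s : ℝ≥0 => -(s : ℝ)) ν) (Ioi 0) := fun u hu => by
    rw [(h u hu).2]; simp [ProbabilityTheory.mgf]
  rw [hE.iteratedDeriv_of_isOpen isOpen_Ioi k ht,
    ProbabilityTheory.iteratedDeriv_mgf (h.mem_interior_integrableExpSet ht), ← integral_const_mul]
  refine integral_congr_ae (Eventually.of_forall fun s => ?_)
  simp only [mul_neg]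
  rw [← mul_assoc, ← mul_pow]
  simp

lemma integrable_pow_mul_exp (h : IsLaplaceTransformOf g ν) (k : ℕ) {t : ℝ} (ht : 0 < t) :
    Integrable (fun s : ℝ≥0 => (s : ℝ) ^ k * Real.exp (-(t * s))) ν := by
  have := (ProbabilityTheory.integrable_pow_mul_exp_of_mem_interior_integrableExpSet
    (h.mem_interior_integrableExpSet ht) k).const_mul ((-1) ^ k)
  refine this.congr (Eventually.of_forall fun s => ?_)
  simp only [mul_neg]
  rw [← mul_assoc, ← mul_pow]
  simp

/-- Monotone convergence along `t = 1/(n+1)`: the integrals `∫ s^k e^(-ts) dν` increase to the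
`k`-th moment and equal `(-1)^k g⁽ᵏ⁾(t)`, so a finite limit of the derivative forces the moment to
be finite. -/
lemma moment_of_hasDerivLimitAtZero (h : IsLaplaceTransformOf g ν) {k : ℕ} {L : ℝ}
    (hL : HasDerivLimitAtZero g k L) :
    Integrable (fun s : ℝ≥0 => (s : ℝ) ^ k) ν ∧ ∫ s : ℝ≥0, (s : ℝ) ^ k ∂ν = (-1) ^ k * L := by
  have hseq : Tendsto (fun n : ℕ => (1 : ℝ) / (n + 1)) atTop (𝓝[>] 0) :=
    tendsto_nhdsWithin_iff.2 ⟨tendsto_one_div_add_atTop_nhds_zero_nat,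
      Eventually.of_forall fun n => by simp only [mem_Ioi]; positivity⟩
  have h1 : Tendsto (fun n : ℕ => ∫ s : ℝ≥0, (s : ℝ) ^ k * Real.exp (-(1 / ((n : ℝ) + 1) * s)) ∂ν)
      atTop (𝓝 ((-1) ^ k * L)) := by
    refine ((hL.comp hseq).const_mul _).congr fun n => ?_
    exact h.iteratedDeriv_eq k (by positivity)
  have hnn : 0 ≤ (-1) ^ k * L := ge_of_tendsto' h1 fun n =>
    integral_nonneg fun s => by positivity
  have h2 : Tendsto (fun n : ℕ => ∫⁻ s : ℝ≥0, ENNReal.ofReal ((s : ℝ) ^ k *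
      Real.exp (-(1 / ((n : ℝ) + 1) * s))) ∂ν) atTop
      (𝓝 (∫⁻ s : ℝ≥0, ENNReal.ofReal ((s : ℝ) ^ k) ∂ν)) := by
    refine lintegral_tendsto_of_tendsto_of_monotone (fun n => by fun_prop) ?_ ?_
    · refine Eventually.of_forall fun s m n hmn => ENNReal.ofReal_le_ofReal ?_
      have hs : (0 : ℝ) ≤ s := s.2
      gcongr
    · refine Eventually.of_forall fun s => ENNReal.tendsto_ofReal ?_
      have : Tendsto (fun n : ℕ => (s : ℝ) ^ k * Real.exp (-(1 / ((n : ℝ) + 1) * s))) atTop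
          (𝓝 ((s : ℝ) ^ k * Real.exp (-(0 * s)))) :=
        ((Real.continuous_exp.tendsto _).comp
          (tendsto_one_div_add_atTop_nhds_zero_nat.mul_const (s : ℝ)).neg).const_mul _
      simpa using this
  have h3 : ∫⁻ s : ℝ≥0, ENNReal.ofReal ((s : ℝ) ^ k) ∂ν = ENNReal.ofReal ((-1) ^ k * L) := by
    refine tendsto_nhds_unique h2 ((ENNReal.tendsto_ofReal h1).congr fun n => ?_)
    exact ofReal_integral_eq_lintegral_ofReal (h.integrable_pow_mul_exp k (by positivity))
      (Eventually.of_forall fun s => by positivity)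
  have hint : Integrable (fun s : ℝ≥0 => (s : ℝ) ^ k) ν := by
    refine ⟨by fun_prop, ?_⟩
    rw [hasFiniteIntegral_iff_ofReal (Eventually.of_forall fun s => by positivity), h3]
    exact ENNReal.ofReal_lt_top
  refine ⟨hint, ?_⟩
  rw [integral_eq_lintegral_of_nonneg_ae (Eventually.of_forall fun s => by positivity)
    hint.aestronglyMeasurable, h3, ENNReal.toReal_ofReal hnn]

end IsLaplaceTransformOf

/-- A probability measure on `[0,∞)` with mean one and finite fourth moment. -/
structure HasUnitMean (ν : Measure ℝ≥0) : Prop where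
  prob : IsProbabilityMeasure ν
  integrable_pow_four : Integrable (fun s : ℝ≥0 => (s : ℝ) ^ 4) ν
  mean : ∫ s : ℝ≥0, (s : ℝ) ∂ν = 1

lemma ClassB4.hasUnitMean {g : ℝ → ℝ} (hg : ClassB4 g) : HasUnitMean (bernsteinMeasure g) := by
  have h := hg.isLaplaceTransformOf
  obtain ⟨L, hL⟩ := hg.deriv4_zero
  have h0 := h.moment_of_hasDerivLimitAtZero hg.map_zero
  have h1 := h.moment_of_hasDerivLimitAtZero hg.deriv_zero
  refine ⟨?_, (h.moment_of_hasDerivLimitAtZero hL).1, by simpa using h1.2⟩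
  have hm : (bernsteinMeasure g).real univ = 1 := by simpa using h0.2
  refine ⟨?_⟩
  rw [Measure.real, ENNReal.toReal_eq_one_iff] at hm
  exact hm

namespace HasUnitMean

variable {ν : Measure ℝ≥0}

lemma integrable_shift_pow (h : HasUnitMean ν) {k : ℕ} (hk : k ≤ 4) :
    Integrable (fun s : ℝ≥0 => (1 - (s : ℝ)) ^ k) ν := by
  have := h.prob
  refine ((h.integrable_pow_four.add (integrable_const (1 : ℝ)))).mono' (by fun_prop)
    (Eventually.of_forall fun s => ?_)
  have hs : (0 : ℝ) ≤ s := s.2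
  simp only [norm_pow, Real.norm_eq_abs, Pi.add_apply]
  rcases le_total (s : ℝ) 2 with h2 | h2
  · have : |1 - (s : ℝ)| ≤ 1 := abs_le.2 ⟨by linarith, by linarith⟩
    have := pow_le_one₀ (n := k) (abs_nonneg _) this
    nlinarith [pow_nonneg hs 4]
  · have h1 : |1 - (s : ℝ)| ≤ s := abs_le.2 ⟨by linarith, by linarith⟩
    calc |1 - (s : ℝ)| ^ k ≤ (s : ℝ) ^ k := by gcongr
      _ ≤ (s : ℝ) ^ 4 := pow_le_pow_right₀ (by linarith) hk
      _ ≤ _ := by linarith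

lemma integrable_coe (h : HasUnitMean ν) : Integrable (fun s : ℝ≥0 => (s : ℝ)) ν := by
  have := h.prob
  refine ((integrable_const (1 : ℝ)).sub (h.integrable_shift_pow (k := 1) (by norm_num))).congr
    (Eventually.of_forall fun s => ?_)
  simp

lemma integral_one_sub (h : HasUnitMean ν) : ∫ s : ℝ≥0, (1 - (s : ℝ)) ∂ν = 0 := by
  have := h.prob
  rw [integral_sub (integrable_const _) h.integrable_coe, h.mean]
  simp

lemma integrable_exp (h : HasUnitMean ν) {z : ℝ} (hz : 0 ≤ z) :
    Integrable (fun s : ℝ≥0 => Real.exp (-(z * (s : ℝ)))) ν := by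
  have := h.prob
  refine (integrable_const (1 : ℝ)).mono' (by fun_prop) (Eventually.of_forall fun s => ?_)
  rw [Real.norm_of_nonneg (Real.exp_nonneg _), Real.exp_le_one_iff]
  exact neg_nonpos.2 (mul_nonneg hz s.2)

end HasUnitMean

/-! ### The functionals `a[g]` and `b[g]` as centered moments -/

/-- Both branches integrate `|s - τ|` over those `τ` for which `s` lies between `τ` and `1`. The two
sets can differ only at `τ = s`, where the integrand vanishes. A single kernel is what Fubini needs.
-/
lemma densityG_eq (g : ℝ → ℝ) (s : ℝ) :
    densityG g s = ∫ τ : ℝ≥0, (uIoc (τ : ℝ) 1).indicator (fun s => |s - τ|) s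
      ∂(bernsteinMeasure g) := by
  rw [densityG]
  split_ifs with hs
  · rw [← integral_indicator (measurableSet_le (by fun_prop) (by fun_prop))]
    refine integral_congr_ae (Eventually.of_forall fun τ => ?_)
    simp only [indicator, mem_ofPred_eq, mem_uIoc]
    split_ifs with h1 h2 h2
    · rw [abs_of_nonneg (by linarith)]
    · have : (τ : ℝ) = s := le_antisymm h1 (by by_contra hc; push Not at hc; exact h2 (Or.inl ⟨hc, hs⟩))
      linarith
    · rcases h2 with h2 | h2
      · exact absurd h2.1.le h1
      · linarith
    · rfl
  · push Not at hs
    rw [← integral_indicator (measurableSet_le (by fun_prop) (by fun_prop))]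
    refine integral_congr_ae (Eventually.of_forall fun τ => ?_)
    simp only [indicator, mem_ofPred_eq, mem_uIoc]
    split_ifs with h1 h2 h2
    · rw [abs_of_nonpos (by linarith)]; ring
    · exact absurd (Or.inr ⟨hs, h1⟩) h2
    · rcases h2 with h2 | h2
      · linarith
      · exact absurd h2.2 h1
    · rfl

lemma integral_uIoc_one_sub_pow_mul_abs (m : ℕ) (τ : ℝ) :
    ∫ s in uIoc τ 1, (1 - s) ^ m * |s - τ| = (1 - τ) ^ (m + 2) / ((m + 1) * (m + 2)) := by
  have key : ∫ s in τ..1, (1 - s) ^ m * (s - τ) = (1 - τ) ^ (m + 2) / ((m + 1) * (m + 2)) := by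
    have hd : ∀ s ∈ uIcc τ 1, HasDerivAt (fun s : ℝ => (1 - s) ^ (m + 2) / (m + 2)
        - (1 - τ) * (1 - s) ^ (m + 1) / (m + 1)) ((1 - s) ^ m * (s - τ)) s := by
      intro s _
      have h1 : HasDerivAt (fun s : ℝ => 1 - s) (-1) s := by
        simpa using (hasDerivAt_id s).const_sub 1
      have h2 := ((h1.pow (m + 2)).div_const (m + 2 : ℝ)).sub
        (((h1.pow (m + 1)).const_mul (1 - τ)).div_const (m + 1 : ℝ))
      convert! h2 using 1
      push_cast
      have : (m : ℝ) + 1 ≠ 0 := by positivity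
      have : (m : ℝ) + 2 ≠ 0 := by positivity
      field_simp
      ring
    rw [intervalIntegral.integral_eq_sub_of_hasDerivAt hd
      (Continuous.intervalIntegrable (by fun_prop) _ _)]
    have : (m : ℝ) + 1 ≠ 0 := by positivity
    have : (m : ℝ) + 2 ≠ 0 := by positivity
    field_simp
    ring
  rcases le_total τ 1 with h | h
  · rw [← key, uIoc_of_le h, intervalIntegral.integral_of_le h]
    refine setIntegral_congr_fun measurableSet_Ioc fun s hs => ?_
    rw [abs_of_nonneg (by linarith [hs.1])]
  · rw [← key, uIoc_of_ge h, intervalIntegral.integral_of_ge h, ← integral_neg]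
    refine setIntegral_congr_fun measurableSet_Ioc fun s hs => ?_
    rw [abs_of_nonpos (by linarith [hs.2])]
    ring

/-- Fubini, with the inner integral over the segment from `τ` to `1` evaluated in closed form. The
cases `m = 0` and `m = 1` are `a[g]` and `b[g]`. -/
lemma integral_one_sub_pow_mul_densityG (g : ℝ → ℝ) [SFinite (bernsteinMeasure g)] (m : ℕ)
    (hm : Integrable (fun τ : ℝ≥0 => |1 - (τ : ℝ)| ^ (m + 2)) (bernsteinMeasure g)) :
    ∫ s in Ioi (0 : ℝ), (1 - s) ^ m * densityG g s =
      ∫ τ : ℝ≥0, (1 - (τ : ℝ)) ^ (m + 2) / ((m + 1) * (m + 2)) ∂(bernsteinMeasure g) := by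
  set ν := bernsteinMeasure g
  set F : ℝ → ℝ≥0 → ℝ := fun s τ =>
    (uIoc (τ : ℝ) 1).indicator (fun s => (1 - s) ^ m * |s - τ|) s with hF
  have hFm : Measurable (Function.uncurry F) := by
    have : Function.uncurry F = {p : ℝ × ℝ≥0 | min (p.2 : ℝ) 1 < p.1 ∧ p.1 ≤ max (p.2 : ℝ) 1}.indicator
        (fun p => (1 - p.1) ^ m * |p.1 - p.2|) := by
      ext p; simp [hF, indicator, Function.uncurry, uIoc]
    rw [this]
    have h1 : MeasurableSet {p : ℝ × ℝ≥0 | min (p.2 : ℝ) 1 < p.1} :=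
      measurableSet_lt (by fun_prop) (by fun_prop)
    have h2 : MeasurableSet {p : ℝ × ℝ≥0 | p.1 ≤ max (p.2 : ℝ) 1} :=
      measurableSet_le (by fun_prop) (by fun_prop)
    exact Measurable.indicator (by fun_prop) (h1.inter h2)
  have hsub : ∀ τ : ℝ≥0, uIoc (τ : ℝ) 1 ⊆ Ioi 0 := fun τ s hs =>
    lt_of_le_of_lt (le_min τ.2 zero_le_one) hs.1
  have hsec : ∀ τ : ℝ≥0, ∫ s in Ioi (0 : ℝ), F s τ = (1 - (τ : ℝ)) ^ (m + 2) / ((m + 1) * (m + 2)) :=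
    fun τ => by
      rw [← integral_uIoc_one_sub_pow_mul_abs m τ]
      simp only [hF]
      rw [setIntegral_indicator measurableSet_uIoc, inter_eq_self_of_subset_right (hsub τ)]
  have hsecint : ∀ τ : ℝ≥0, IntegrableOn (fun s => F s τ) (Ioi 0) := fun τ => by
    simp only [hF]
    refine Integrable.integrableOn ?_
    rw [integrable_indicator_iff measurableSet_uIoc, ← intervalIntegrable_iff]
    exact Continuous.intervalIntegrable (by fun_prop) _ _
  have hint : Integrable (Function.uncurry F) ((volume.restrict (Ioi 0)).prod ν) := by
    rw [integrable_prod_iff' hFm.aestronglyMeasurable]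
    refine ⟨Eventually.of_forall hsecint, hm.mono' ?_ (Eventually.of_forall fun τ => ?_)⟩
    · exact hFm.norm.stronglyMeasurable.integral_prod_left'.aestronglyMeasurable
    · rw [Real.norm_of_nonneg (integral_nonneg fun _ => norm_nonneg _)]
      have e : ∀ s, ‖Function.uncurry F (s, τ)‖
          = (uIoc (τ : ℝ) 1).indicator (fun s => ‖(1 - s) ^ m * |s - τ|‖) s := fun s => by
        simp only [Function.uncurry, hF, norm_indicator_eq_indicator_norm]
      simp only [e]
      rw [setIntegral_indicator measurableSet_uIoc, inter_eq_self_of_subset_right (hsub τ)]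
      refine (le_abs_self _).trans ?_
      rw [← Real.norm_eq_abs, ← intervalIntegral.norm_intervalIntegral_eq]
      refine (intervalIntegral.norm_integral_le_of_norm_le_const
        (C := |1 - (τ : ℝ)| ^ (m + 1)) fun s hs => ?_).trans (by rw [pow_succ _ (m + 1)])
      have h1 : |1 - s| ≤ |1 - (τ : ℝ)| :=
        abs_sub_right_of_mem_uIcc (uIoc_subset_uIcc hs)
      have h2 : |s - τ| ≤ |1 - (τ : ℝ)| := abs_sub_left_of_mem_uIcc (uIoc_subset_uIcc hs)
      rw [norm_norm, norm_mul, norm_pow, Real.norm_eq_abs, Real.norm_eq_abs, abs_abs, pow_succ]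
      gcongr
  calc ∫ s in Ioi (0 : ℝ), (1 - s) ^ m * densityG g s
      = ∫ s in Ioi (0 : ℝ), ∫ τ : ℝ≥0, F s τ ∂ν := by
        refine setIntegral_congr_fun measurableSet_Ioi fun s _ => ?_
        rw [densityG_eq, ← integral_const_mul]
        refine integral_congr_ae (Eventually.of_forall fun τ => ?_)
        simp only [hF, indicator]
        split_ifs <;> simp
    _ = ∫ τ : ℝ≥0, (∫ s in Ioi (0 : ℝ), F s τ) ∂ν := integral_integral_swap hint
    _ = _ := by simp only [hsec]

lemma ClassB4.functionalA_eq {g : ℝ → ℝ} (hg : ClassB4 g) :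
    functionalA g = ∫ τ : ℝ≥0, (1 - (τ : ℝ)) ^ 2 / 2 ∂(bernsteinMeasure g) := by
  have := hg.hasUnitMean.prob
  have h := integral_one_sub_pow_mul_densityG g 0
    (by simpa using (hg.hasUnitMean.integrable_shift_pow (k := 2) (by norm_num)).norm)
  simpa [functionalA] using h

lemma ClassB4.functionalB_eq {g : ℝ → ℝ} (hg : ClassB4 g) :
    functionalB g = ∫ τ : ℝ≥0, (1 - (τ : ℝ)) ^ 3 / 6 ∂(bernsteinMeasure g) := by
  have := hg.hasUnitMean.prob
  have h := integral_one_sub_pow_mul_densityG g 1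
    (by simpa using (hg.hasUnitMean.integrable_shift_pow (k := 3) (by norm_num)).norm)
  norm_num at h
  rw [functionalB, h]

/-! ### Scalar lower bounds -/

namespace HasUnitMean

variable {ν : Measure ℝ≥0}

/-- Factor out `e^(-z)` and integrate `e^y ≥ 1 + y + max(y,0)²/2` at `y = z(1 - s)`; the linear term
has mean zero. Only the positive part can be used, because the quadratic Taylor polynomial exceeds
`e^y` for `y < 0`. -/
lemma exp_neg_add_le_integral (h : HasUnitMean ν) {z : ℝ} (hz : 0 ≤ z) :
    Real.exp (-z) * (1 + z ^ 2 * ∫ s : ℝ≥0, max (1 - (s : ℝ)) 0 ^ 2 / 2 ∂ν)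
      ≤ ∫ s : ℝ≥0, Real.exp (-(z * (s : ℝ))) ∂ν := by
  have := h.prob
  have hmax : Integrable (fun s : ℝ≥0 => max (1 - (s : ℝ)) 0 ^ 2 / 2) ν := by
    refine (integrable_const (1 : ℝ)).mono' (by fun_prop) (Eventually.of_forall fun s => ?_)
    have hs : (0 : ℝ) ≤ s := s.2
    have h1 : max (1 - (s : ℝ)) 0 ≤ 1 := max_le (by linarith) zero_le_one
    have h0 : 0 ≤ max (1 - (s : ℝ)) 0 := le_max_right _ _
    rw [Real.norm_of_nonneg (by positivity)]
    nlinarith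
  have h1 : Integrable (fun s : ℝ≥0 => 1 - (s : ℝ)) ν := by
    simpa using h.integrable_shift_pow (k := 1) (by norm_num)
  have e : Real.exp (-z) * (1 + z ^ 2 * ∫ s : ℝ≥0, max (1 - (s : ℝ)) 0 ^ 2 / 2 ∂ν)
      = ∫ s : ℝ≥0, Real.exp (-z) * (1 + z * (1 - (s : ℝ)) + z ^ 2 * (max (1 - (s : ℝ)) 0 ^ 2 / 2)) ∂ν := by
    have i1 : Integrable (fun s : ℝ≥0 => 1 + z * (1 - (s : ℝ))) ν :=
      (integrable_const _).add (h1.const_mul z)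
    rw [integral_const_mul, integral_add i1
      (hmax.const_mul _), integral_add (integrable_const _) (h1.const_mul z), integral_const_mul,
      integral_const_mul, h.integral_one_sub]
    simp
  rw [e]
  refine integral_mono ((((integrable_const _).add (h1.const_mul z)).add
    (hmax.const_mul _)).const_mul _) (h.integrable_exp hz) fun s => ?_
  have e2 : Real.exp (-(z * (s : ℝ))) = Real.exp (-z) * Real.exp (z * (1 - s)) := by
    rw [← Real.exp_add]; ring_nf
  simp only
  rw [e2]
  refine mul_le_mul_of_nonneg_left ?_ (Real.exp_nonneg _)
  rcases le_total (s : ℝ) 1 with hs | hs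
  · rw [max_eq_left (by linarith)]
    have := Real.quadratic_le_exp_of_nonneg (x := z * (1 - s)) (mul_nonneg hz (by linarith))
    linarith [mul_pow z (1 - (s : ℝ)) 2]
  · rw [max_eq_right (by linarith)]
    have := Real.add_one_le_exp (z * (1 - (s : ℝ)))
    linarith

/-- If the integral vanished, `s ≥ 1` almost everywhere. Mean one would then concentrate `ν` at `1`,
where the transform is `e^(-z)`. -/
lemma integral_max_sq_pos (h : HasUnitMean ν)
    (hne : ∃ z : ℝ, 0 < z ∧ ∫ s : ℝ≥0, Real.exp (-(z * (s : ℝ))) ∂ν ≠ Real.exp (-z)) :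
    0 < ∫ s : ℝ≥0, max (1 - (s : ℝ)) 0 ^ 2 / 2 ∂ν := by
  have := h.prob
  have hmax : Integrable (fun s : ℝ≥0 => max (1 - (s : ℝ)) 0 ^ 2 / 2) ν := by
    refine (integrable_const (1 : ℝ)).mono' (by fun_prop) (Eventually.of_forall fun s => ?_)
    have hs : (0 : ℝ) ≤ s := s.2
    have h1 : max (1 - (s : ℝ)) 0 ≤ 1 := max_le (by linarith) zero_le_one
    have h0 : 0 ≤ max (1 - (s : ℝ)) 0 := le_max_right _ _
    rw [Real.norm_of_nonneg (by positivity)]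
    nlinarith
  refine lt_of_le_of_ne (integral_nonneg fun s => by positivity) fun h0 => ?_
  rw [eq_comm, integral_eq_zero_iff_of_nonneg (fun s => by positivity) hmax] at h0
  have hge : ∀ᵐ s : ℝ≥0 ∂ν, (0 : ℝ) ≤ (s : ℝ) - 1 := by
    filter_upwards [h0] with s hs
    have : max (1 - (s : ℝ)) 0 = 0 := by simpa using hs
    have := le_max_left (1 - (s : ℝ)) 0
    linarith
  have hzero : ∫ s : ℝ≥0, ((s : ℝ) - 1) ∂ν = 0 := by
    rw [integral_sub h.integrable_coe (integrable_const _), h.mean]; simp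
  rw [integral_eq_zero_iff_of_nonneg_ae hge (h.integrable_coe.sub (integrable_const _))] at hzero
  obtain ⟨z, -, hz⟩ := hne
  apply hz
  have : ∀ᵐ s : ℝ≥0 ∂ν, Real.exp (-(z * (s : ℝ))) = Real.exp (-z) := by
    filter_upwards [hzero] with s hs
    have : (s : ℝ) = 1 := by simpa [sub_eq_zero] using hs
    rw [this, mul_one]
  rw [integral_congr_ae this]
  simp

lemma succ_mul_pow_mul_sub_le {u w : ℝ} (hw : 0 ≤ w) (huw : w ≤ u) (n : ℕ) :
    (n + 1) * w ^ n * (u - w) ≤ u ^ (n + 1) - w ^ (n + 1) := by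
  induction n with
  | zero => simp
  | succ n ih =>
    have e : u ^ (n + 1 + 1) - w ^ (n + 1 + 1)
        = u * (u ^ (n + 1) - w ^ (n + 1)) + w ^ (n + 1) * (u - w) := by ring
    have h0 : 0 ≤ u ^ (n + 1) - w ^ (n + 1) := sub_nonneg.2 (pow_le_pow_left₀ hw huw _)
    have h1 : w * ((n + 1) * w ^ n * (u - w)) ≤ u * (u ^ (n + 1) - w ^ (n + 1)) :=
      (mul_le_mul_of_nonneg_left ih hw).trans (mul_le_mul_of_nonneg_right huw h0)
    rw [e]
    push_cast
    calc _ = w * ((n + 1) * w ^ n * (u - w)) + w ^ (n + 1) * (u - w) := by ring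
      _ ≤ _ := by linarith

/-- With `u` the transform and `w = e^(-z)` at `z = 1/n`, one has `u - w ≥ w z² κ`, and `uⁿ - wⁿ ≥ n
w^(n-1) (u - w)`. Since `wⁿ = e^(-1)` and `n z² = 1/n`, the constant is `e^(-1) κ`. -/
lemma exists_first_order_lower_bound (h : HasUnitMean ν)
    (hne : ∃ z : ℝ, 0 < z ∧ ∫ s : ℝ≥0, Real.exp (-(z * (s : ℝ))) ∂ν ≠ Real.exp (-z)) :
    ∃ c : ℝ, 0 < c ∧ ∀ n : ℕ, 1 ≤ n →
      c / n ≤ (∫ s : ℝ≥0, Real.exp (-(1 / n * (s : ℝ))) ∂ν) ^ n - Real.exp (-1) := by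
  set κ := ∫ s : ℝ≥0, max (1 - (s : ℝ)) 0 ^ 2 / 2 ∂ν with hκ
  have hκ0 : 0 < κ := h.integral_max_sq_pos hne
  refine ⟨Real.exp (-1) * κ, by positivity, fun n hn => ?_⟩
  obtain ⟨m, rfl⟩ : ∃ m, n = m + 1 := ⟨n - 1, by omega⟩
  set z : ℝ := 1 / ((m + 1 : ℕ) : ℝ) with hz
  have hz0 : 0 < z := by positivity
  have hzn : ((m : ℝ) + 1) * z = 1 := by rw [hz]; push_cast; field_simp
  set u := ∫ s : ℝ≥0, Real.exp (-(z * (s : ℝ))) ∂ν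
  set w := Real.exp (-z) with hw
  have hw0 : 0 < w := Real.exp_pos _
  have hu : w * (1 + z ^ 2 * κ) ≤ u := h.exp_neg_add_le_integral hz0.le
  have huw : w * (z ^ 2 * κ) ≤ u - w := by linarith
  have hge : 0 ≤ w * (z ^ 2 * κ) := by positivity
  have hwn : w ^ (m + 1) = Real.exp (-1) := by
    rw [hw, ← Real.exp_nat_mul]; congr 1; push_cast; linarith
  have hB := succ_mul_pow_mul_sub_le hw0.le (by linarith : w ≤ u) m
  rw [hwn] at hB
  refine le_trans ?_ hB
  calc Real.exp (-1) * κ / ((m + 1 : ℕ) : ℝ) = Real.exp (-1) * κ * z := by rw [hz]; ring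
    _ = ((m : ℝ) + 1) * z * (Real.exp (-1) * κ * z) := by rw [hzn, one_mul]
    _ = (m + 1) * w ^ m * (w * (z ^ 2 * κ)) := by rw [← hwn]; ring
    _ ≤ (m + 1) * w ^ m * (u - w) := by gcongr

/-! ### The cubic expansion of the transform and the second-order bound -/

lemma abs_exp_neg_sub_cubic_le {y : ℝ} (hy : -1 ≤ y) :
    |Real.exp (-y) - (1 - y + y ^ 2 / 2 - y ^ 3 / 6)| ≤ 5 * y ^ 4 := by
  rcases le_total y 1 with h1 | h1
  · have := Real.exp_bound (x := -y) (abs_le.2 ⟨by linarith, by linarith⟩) (n := 4) (by norm_num)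
    simp only [Finset.sum_range_succ, Finset.sum_range_zero, abs_neg] at this
    norm_num [Nat.factorial] at this
    have e : |y| ^ 4 = y ^ 4 := by rw [← abs_pow, abs_of_nonneg (by positivity)]
    rw [e] at this
    have e2 : Real.exp (-y) - (1 + -y + y ^ 2 / 2 + (-y) ^ 3 / 6)
      = Real.exp (-y) - (1 - y + y ^ 2 / 2 - y ^ 3 / 6) := by ring
    rw [e2] at this
    nlinarith [sq_nonneg (y ^ 2)]
  · have h0 := Real.exp_pos (-y)
    have h2 : Real.exp (-y) ≤ 1 := Real.exp_le_one_iff.2 (by linarith)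
    have a1 : y ≤ y ^ 4 := by nlinarith [pow_le_pow_right₀ h1 (show 1 ≤ 4 by norm_num)]
    have a2 : y ^ 2 ≤ y ^ 4 := pow_le_pow_right₀ h1 (by norm_num)
    have a3 : y ^ 3 ≤ y ^ 4 := pow_le_pow_right₀ h1 (by norm_num)
    have a4 : (0 : ℝ) < y ^ 2 := by positivity
    have a5 : (0 : ℝ) < y ^ 3 := by positivity
    rw [abs_le]
    constructor <;> linarith

/-- Integrate the cubic Taylor estimate at `y = z(s - 1)`. The restriction `z ≤ 1` ensures `y ≥ -1`
for all `s ≥ 0`. -/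
lemma abs_exp_mul_integral_sub_le (h : HasUnitMean ν) {z : ℝ} (hz : 0 ≤ z) (hz1 : z ≤ 1) :
    |Real.exp z * ∫ s : ℝ≥0, Real.exp (-(z * (s : ℝ))) ∂ν
      - (1 + z ^ 2 * (∫ s : ℝ≥0, (1 - (s : ℝ)) ^ 2 / 2 ∂ν) + z ^ 3 * ∫ s : ℝ≥0, (1 - (s : ℝ)) ^ 3 / 6 ∂ν)|
      ≤ 5 * z ^ 4 * ∫ s : ℝ≥0, (1 - (s : ℝ)) ^ 4 ∂ν := by
  have := h.prob
  have h1 : Integrable (fun s : ℝ≥0 => 1 - (s : ℝ)) ν := by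
    simpa using h.integrable_shift_pow (k := 1) (by norm_num)
  have h2 := (h.integrable_shift_pow (k := 2) (by norm_num)).div_const 2
  have h3 := (h.integrable_shift_pow (k := 3) (by norm_num)).div_const 6
  have h4 := h.integrable_shift_pow (k := 4) (by norm_num)
  have hP : Integrable (fun s : ℝ≥0 => 1 + z * (1 - (s : ℝ)) + z ^ 2 * ((1 - (s : ℝ)) ^ 2 / 2)
      + z ^ 3 * ((1 - (s : ℝ)) ^ 3 / 6)) ν :=
    (((integrable_const _).add (h1.const_mul z)).add (h2.const_mul _)).add (h3.const_mul _)
  have eP : ∫ s : ℝ≥0, (1 + z * (1 - (s : ℝ)) + z ^ 2 * ((1 - (s : ℝ)) ^ 2 / 2)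
      + z ^ 3 * ((1 - (s : ℝ)) ^ 3 / 6)) ∂ν = 1 + z ^ 2 * (∫ s : ℝ≥0, (1 - (s : ℝ)) ^ 2 / 2 ∂ν)
      + z ^ 3 * ∫ s : ℝ≥0, (1 - (s : ℝ)) ^ 3 / 6 ∂ν := by
    have i1 : Integrable (fun s : ℝ≥0 => 1 + z * (1 - (s : ℝ))) ν :=
      (integrable_const _).add (h1.const_mul z)
    have i2 : Integrable (fun s : ℝ≥0 => 1 + z * (1 - (s : ℝ)) + z ^ 2 * ((1 - (s : ℝ)) ^ 2 / 2)) ν :=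
      i1.add (h2.const_mul _)
    rw [integral_add i2 (h3.const_mul _), integral_add i1 (h2.const_mul _),
      integral_add (integrable_const _) (h1.const_mul z), integral_const_mul,
      integral_const_mul, integral_const_mul, h.integral_one_sub]
    simp
  rw [← eP, ← integral_const_mul, ← integral_sub ((h.integrable_exp hz).const_mul _) hP,
    ← integral_const_mul, ← Real.norm_eq_abs]
  refine (norm_integral_le_of_norm_le (h4.const_mul _) (Eventually.of_forall fun s => ?_))
  have hs : (0 : ℝ) ≤ s := s.2
  have := abs_exp_neg_sub_cubic_le (y := z * (s - 1)) (by nlinarith)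
  have e2 : Real.exp z * Real.exp (-(z * (s : ℝ))) = Real.exp (-(z * (s - 1))) := by
    rw [← Real.exp_add]; ring_nf
  rw [Real.norm_eq_abs, e2]
  convert this using 1
  · congr 1; ring
  · ring

lemma exists_second_order_lower_bound (h : HasUnitMean ν) {a b : ℝ}
    (ha : a = ∫ s : ℝ≥0, (1 - (s : ℝ)) ^ 2 / 2 ∂ν) (hb : b = ∫ s : ℝ≥0, (1 - (s : ℝ)) ^ 3 / 6 ∂ν)
    (hb0 : b ≠ 0) :
    ∃ s : ℝ, 0 < s ∧ ∃ c : ℝ, 0 < c ∧ ∀ n : ℕ, 1 ≤ n → c / n ^ 2 ≤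
      |(∫ τ : ℝ≥0, Real.exp (-(s / n * (τ : ℝ))) ∂ν) ^ n - Real.exp (-s)
        - a * (n : ℝ)⁻¹ * (s ^ 2 * Real.exp (-s))| := by
  set m := ∫ s : ℝ≥0, (1 - (s : ℝ)) ^ 4 ∂ν with hm
  have hm0 : 0 ≤ m := integral_nonneg fun s => by positivity
  set C : ℝ := |a| + |b| + 5 * m with hC
  have hC0 : 0 ≤ C := by positivity
  set K : ℝ := C ^ 2 + 5 * m with hK
  have hK0 : 0 ≤ K := by positivity
  have hbpos : 0 < |b| := abs_pos.2 hb0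
  -- The error of the expansion is `K s⁴/n²`, of the same order in `n` as the main term `b s³/n²`,
  -- so only small `s` separates them: `K s ≤ |b|/2`. The condition `C s ≤ 1` keeps `n η ≤ 1`, where
  -- `e^x ≤ 1 + x + x²` is available.
  set s : ℝ := min 1 (min (1 / (C + 1)) (|b| / (2 * (K + 1)))) with hs
  have hs0 : 0 < s := by rw [hs]; positivity
  have hs1 : s ≤ 1 := min_le_left _ _
  have hsC : C * s ≤ 1 := by
    have : s ≤ 1 / (C + 1) := (min_le_right _ _).trans (min_le_left _ _)
    rw [le_div_iff₀ (by positivity)] at this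
    nlinarith
  have hsK : K * s ≤ |b| / 2 := by
    have : s ≤ |b| / (2 * (K + 1)) := (min_le_right _ _).trans (min_le_right _ _)
    rw [le_div_iff₀ (by positivity)] at this
    nlinarith
  refine ⟨s, hs0, Real.exp (-s) * (|b| * s ^ 3 / 2), by positivity, fun n hn => ?_⟩
  have hn1 : (1 : ℝ) ≤ n := by exact_mod_cast hn
  have hn0 : (0 : ℝ) < n := by linarith
  set z := s / n with hz
  have hz0 : 0 < z := by positivity
  have hnz : n * z = s := by rw [hz]; field_simp
  have hz1 : z ≤ 1 := by nlinarith
  set u := ∫ τ : ℝ≥0, Real.exp (-(z * (τ : ℝ))) ∂ν with hu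
  -- Since `n z = s`, the quantity to be bounded is `e^(-s) ((1 + η)ⁿ - 1 - a s²/n)`, and `(1 + η)ⁿ`
  -- lies between `1 + nη` and `1 + nη + (nη)²`.
  set η := Real.exp z * u - 1 with hη
  have hη0 : 0 ≤ η := by
    have h1 := h.exp_neg_add_le_integral hz0.le
    have h2 : Real.exp (-z) ≤ u := by
      refine le_trans ?_ h1
      have : 0 ≤ ∫ s : ℝ≥0, max (1 - (s : ℝ)) 0 ^ 2 / 2 ∂ν :=
        integral_nonneg fun s => by positivity
      exact le_mul_of_one_le_right (Real.exp_nonneg _) (by nlinarith [sq_nonneg z])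
    have h3 := mul_le_mul_of_nonneg_left h2 (Real.exp_nonneg z)
    rw [← Real.exp_add, add_neg_cancel, Real.exp_zero] at h3
    linarith
  have hexp : |η - (a * z ^ 2 + b * z ^ 3)| ≤ 5 * z ^ 4 * m := by
    have := h.abs_exp_mul_integral_sub_le hz0.le hz1
    rw [← ha, ← hb] at this
    convert this using 2
    rw [hη]; ring
  have hηC : η ≤ C * z ^ 2 := by
    have h1 := (abs_le.1 hexp).2
    have h2 : z ^ 3 ≤ z ^ 2 := pow_le_pow_of_le_one hz0.le hz1 (by norm_num)
    have h3 : z ^ 4 ≤ z ^ 2 := pow_le_pow_of_le_one hz0.le hz1 (by norm_num)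
    have h4 : b * z ^ 3 ≤ |b| * z ^ 2 :=
      mul_le_mul (le_abs_self b) h2 (by positivity) (abs_nonneg b)
    have h5 : a * z ^ 2 ≤ |a| * z ^ 2 := by gcongr; exact le_abs_self a
    have h6 : z ^ 4 * m ≤ z ^ 2 * m := by gcongr
    rw [hC]; linarith
  have hnη : n * η ≤ C * s ^ 2 / n := by
    calc n * η ≤ n * (C * z ^ 2) := by gcongr
      _ = C * s ^ 2 / n := by rw [hz]; field_simp
  have hnη1 : n * η ≤ 1 := by
    refine hnη.trans ((div_le_self (by positivity) hn1).trans ?_)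
    nlinarith
  have hlow : 1 + n * η ≤ (1 + η) ^ n := one_add_mul_le_pow (by linarith) n
  have hup : (1 + η) ^ n ≤ 1 + n * η + (n * η) ^ 2 := by
    have h1 : (1 + η) ^ n ≤ Real.exp (n * η) := by
      rw [Real.exp_nat_mul]
      exact pow_le_pow_left₀ (by linarith) (by linarith [Real.add_one_le_exp η]) n
    have hnn : 0 ≤ n * η := by positivity
    have h2 := (abs_le.1 (Real.abs_exp_sub_one_sub_id_le (x := n * η) (by rwa [abs_of_nonneg hnn]))).2
    linarith
  set Y := (1 + η) ^ n - 1 - a * s ^ 2 / n with hY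
  have hfac : u ^ n - Real.exp (-s) - a * (n : ℝ)⁻¹ * (s ^ 2 * Real.exp (-s)) = Real.exp (-s) * Y := by
    have e1 : 1 + η = Real.exp z * u := by rw [hη]; ring
    have e2 : Real.exp (-s) * Real.exp z ^ n = 1 := by
      rw [← Real.exp_nat_mul, hnz, ← Real.exp_add]; simp
    rw [hY, e1, mul_pow]
    linear_combination (-u ^ n) * e2
  have hYb : |Y - b * s ^ 3 / n ^ 2| ≤ K * s ^ 4 / n ^ 2 := by
    have e : Y - b * s ^ 3 / n ^ 2 = ((1 + η) ^ n - 1 - n * η)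
        + n * (η - (a * z ^ 2 + b * z ^ 3)) := by
      rw [hY, hz]; field_simp; ring
    have h1 : |(1 + η) ^ n - 1 - n * η| ≤ (C * s ^ 2 / n) ^ 2 := by
      rw [abs_of_nonneg (by linarith)]
      have : (n * η) ^ 2 ≤ (C * s ^ 2 / n) ^ 2 := by gcongr
      linarith
    have h2 : |n * (η - (a * z ^ 2 + b * z ^ 3))| ≤ 5 * m * s ^ 4 / n ^ 2 := by
      rw [abs_mul, abs_of_pos hn0]
      calc n * |η - (a * z ^ 2 + b * z ^ 3)| ≤ n * (5 * z ^ 4 * m) := by gcongr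
        _ = 5 * m * s ^ 4 / n ^ 3 := by rw [hz]; field_simp
        _ ≤ 5 * m * s ^ 4 / n ^ 2 := by
          gcongr
          · norm_num
    rw [e]
    refine (abs_add_le _ _).trans ((add_le_add h1 h2).trans (le_of_eq ?_))
    rw [hK]; field_simp
  rw [hfac, abs_mul, abs_of_pos (Real.exp_pos _), mul_div_assoc]
  refine mul_le_mul_of_nonneg_left ?_ (Real.exp_nonneg _)
  have h1 : |b * s ^ 3 / n ^ 2| = |b| * s ^ 3 / n ^ 2 := by
    rw [abs_div, abs_mul, abs_of_pos (show 0 < s ^ 3 by positivity),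
      abs_of_pos (show (0 : ℝ) < n ^ 2 by positivity)]
  have h2 := abs_sub_abs_le_abs_sub (b * s ^ 3 / n ^ 2) Y
  rw [h1] at h2
  rw [abs_sub_comm] at hYb
  have h3 : |b| * s ^ 3 / 2 / n ^ 2 + K * s ^ 4 / n ^ 2 ≤ |b| * s ^ 3 / n ^ 2 := by
    rw [← add_div]
    gcongr
    have : K * s * s ^ 3 ≤ |b| / 2 * s ^ 3 := by gcongr
    linarith
  linarith

end HasUnitMean

/-! ### Uniqueness of Laplace transforms of complex measures -/

section LaplaceUniqueness

variable {Ω Ω' : Type} [MeasurableSpace Ω] [MeasurableSpace Ω'] {μ : Measure Ω} {μ' : Measure Ω'}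
  {h : Ω → ℂ} {h' : Ω' → ℂ} {τ : Ω → ℝ≥0} {τ' : Ω' → ℝ≥0}

lemma MeasureTheory.Integrable.mul_bounded_comp (hh : Integrable h μ) (hτ : Measurable τ)
    {q : ℝ≥0 → ℂ} (hq : Continuous q) {C : ℝ} (hC : ∀ s, ‖q s‖ ≤ C) :
    Integrable (fun w => h w * q (τ w)) μ :=
  hh.mul_bdd (c := C) (hq.measurable.comp hτ).aestronglyMeasurable (Eventually.of_forall fun _ => hC _)

lemma norm_cexp_neg_mul_le_one {z : ℂ} (hz : 0 ≤ z.re) (s : ℝ≥0) :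
    ‖Complex.exp (-(((s : ℝ) : ℂ) * z))‖ ≤ 1 := by
  rw [Complex.norm_exp, Real.exp_le_one_iff]
  simpa using mul_nonneg s.2 hz

/-- The complex measures appear as images under `τ` of `h dμ` on an arbitrary space, so that
convolutions can later be treated as product measures. The exponent `0` lies outside the open
half-plane and is reached by dominated convergence. -/
lemma integral_mul_cexp_natCast_eq (hh : Integrable h μ) (hh' : Integrable h' μ')
    (hτ : Measurable τ) (hτ' : Measurable τ')
    (H : ∀ z : ℂ, 0 < z.re → ∫ w, h w * Complex.exp (-(((τ w : ℝ) : ℂ) * z)) ∂μ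
      = ∫ w, h' w * Complex.exp (-(((τ' w : ℝ) : ℂ) * z)) ∂μ') (k : ℕ) :
    ∫ w, h w * Complex.exp (-(((τ w : ℝ) : ℂ) * k)) ∂μ
      = ∫ w, h' w * Complex.exp (-(((τ' w : ℝ) : ℂ) * k)) ∂μ' := by
  rcases Nat.eq_zero_or_pos k with rfl | hk
  · have aux : ∀ {Ω : Type} [MeasurableSpace Ω] {μ : Measure Ω} {h : Ω → ℂ} {τ : Ω → ℝ≥0},
        Integrable h μ → Measurable τ →
        Tendsto (fun n : ℕ => ∫ w, h w * Complex.exp (-(((τ w : ℝ) : ℂ) * (1 / ((n : ℂ) + 1)))) ∂μ)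
          atTop (𝓝 (∫ w, h w * Complex.exp (-(((τ w : ℝ) : ℂ) * ((0 : ℕ) : ℂ))) ∂μ)) := by
      intro Ω _ μ h τ hh hτ
      refine tendsto_integral_of_dominated_convergence (fun w => ‖h w‖) (fun n => ?_) hh.norm
        (fun n => Eventually.of_forall fun w => ?_) (Eventually.of_forall fun w => ?_)
      · exact hh.aestronglyMeasurable.mul (by fun_prop)
      · rw [norm_mul]
        refine mul_le_of_le_one_right (norm_nonneg _) (norm_cexp_neg_mul_le_one ?_ _)
        have : (1 / ((n : ℂ) + 1)) = ((1 / ((n : ℝ) + 1) : ℝ) : ℂ) := by push_cast; rfl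
        rw [this, Complex.ofReal_re]; positivity
      · refine ((Complex.continuous_exp.tendsto _).comp
          (Tendsto.neg (Tendsto.const_mul _ ?_))).const_mul _
        have := (Complex.continuous_ofReal.tendsto 0).comp
          (tendsto_one_div_add_atTop_nhds_zero_nat (𝕜 := ℝ))
        simpa [Function.comp_def] using this
    refine tendsto_nhds_unique (aux hh hτ) ((aux hh' hτ').congr fun n => (H _ ?_).symm)
    have : (1 / ((n : ℂ) + 1)) = ((1 / ((n : ℝ) + 1) : ℝ) : ℂ) := by push_cast; rfl
    rw [this, Complex.ofReal_re]; positivity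
  · exact H k (by simpa using hk)

/-- Agreement at integer exponents is agreement on polynomials in `e^(-s)`. Weierstrass
approximation extends it to continuous functions of `e^(-s)` on `[0,1]`. -/
lemma integral_mul_comp_exp_eq (hh : Integrable h μ) (hh' : Integrable h' μ')
    (hτ : Measurable τ) (hτ' : Measurable τ')
    (H : ∀ z : ℂ, 0 < z.re → ∫ w, h w * Complex.exp (-(((τ w : ℝ) : ℂ) * z)) ∂μ
      = ∫ w, h' w * Complex.exp (-(((τ' w : ℝ) : ℂ) * z)) ∂μ')
    {f : ℝ → ℝ} (hf : ContinuousOn f (Icc 0 1)) :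
    ∫ w, h w * (f (Real.exp (-(τ w : ℝ))) : ℂ) ∂μ
      = ∫ w, h' w * (f (Real.exp (-(τ' w : ℝ))) : ℂ) ∂μ' := by
  have hmem : ∀ s : ℝ≥0, Real.exp (-(s : ℝ)) ∈ Icc (0 : ℝ) 1 := fun s =>
    ⟨Real.exp_nonneg _, Real.exp_le_one_iff.2 (neg_nonpos.2 s.2)⟩
  have hcont : Continuous fun s : ℝ≥0 => Real.exp (-(s : ℝ)) := by fun_prop
  have hint : ∀ {Ω : Type} [MeasurableSpace Ω] {μ : Measure Ω} {h : Ω → ℂ} {τ : Ω → ℝ≥0},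
      Integrable h μ → Measurable τ → ∀ {f : ℝ → ℝ}, ContinuousOn f (Icc 0 1) →
      Integrable (fun w => h w * (f (Real.exp (-(τ w : ℝ))) : ℂ)) μ := by
    intro Ω _ μ h τ hh hτ f hf
    obtain ⟨C, hC⟩ := isCompact_Icc.exists_bound_of_continuousOn hf
    refine hh.mul_bounded_comp hτ (q := fun s : ℝ≥0 => (f (Real.exp (-(s : ℝ))) : ℂ))
      (C := C) (Complex.continuous_ofReal.comp (hf.comp_continuous hcont hmem)) fun s => ?_
    rw [Complex.norm_real]
    exact hC _ (hmem s)
  have hpoly : ∀ p : Polynomial ℝ, ∫ w, h w * ((p.eval (Real.exp (-(τ w : ℝ))) : ℝ) : ℂ) ∂μ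
      = ∫ w, h' w * ((p.eval (Real.exp (-(τ' w : ℝ))) : ℝ) : ℂ) ∂μ' := by
    intro p
    induction p using Polynomial.induction_on' with
    | add p q hp hq =>
      have e1 := integral_add (hint hh hτ (f := fun x => p.eval x) p.continuous.continuousOn)
        (hint hh hτ (f := fun x => q.eval x) q.continuous.continuousOn)
      have e2 := integral_add (hint hh' hτ' (f := fun x => p.eval x) p.continuous.continuousOn)
        (hint hh' hτ' (f := fun x => q.eval x) q.continuous.continuousOn)
      simp only [Polynomial.eval_add, Complex.ofReal_add, mul_add]
      rw [e1, e2, hp, hq]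
    | monomial k a =>
      have key := integral_mul_cexp_natCast_eq hh hh' hτ hτ' H k
      have e : ∀ (c : ℂ) (s : ℝ≥0), c * (((Polynomial.monomial k a).eval (Real.exp (-(s : ℝ))) : ℝ) : ℂ)
          = a * (c * Complex.exp (-(((s : ℝ) : ℂ) * k))) := by
        intro c s
        rw [Polynomial.eval_monomial, ← Real.exp_nat_mul]
        push_cast
        rw [show (k : ℂ) * -((s : ℝ) : ℂ) = -(((s : ℝ) : ℂ) * k) by ring]
        ring
      simp only [e]
      rw [integral_const_mul, integral_const_mul, key]
  set A : ℝ := ∫ w, ‖h w‖ ∂μ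
  set A' : ℝ := ∫ w, ‖h' w‖ ∂μ'
  have hA : 0 ≤ A := integral_nonneg fun _ => norm_nonneg _
  have hA' : 0 ≤ A' := integral_nonneg fun _ => norm_nonneg _
  have hclose : ∀ {Ω : Type} [MeasurableSpace Ω] {μ : Measure Ω} {h : Ω → ℂ} {τ : Ω → ℝ≥0},
      Integrable h μ → Measurable τ → ∀ (p : Polynomial ℝ) (ε : ℝ),
      (∀ x ∈ Icc (0 : ℝ) 1, |p.eval x - f x| < ε) →
      ‖∫ w, h w * (f (Real.exp (-(τ w : ℝ))) : ℂ) ∂μ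
        - ∫ w, h w * ((p.eval (Real.exp (-(τ w : ℝ))) : ℝ) : ℂ) ∂μ‖ ≤ ε * ∫ w, ‖h w‖ ∂μ := by
    intro Ω _ μ h τ hh hτ p ε hp
    rw [← integral_sub (hint hh hτ hf)
      (hint hh hτ (f := fun x => p.eval x) p.continuous.continuousOn), ← integral_const_mul]
    refine norm_integral_le_of_norm_le (hh.norm.const_mul ε) (Eventually.of_forall fun w => ?_)
    rw [← mul_sub, norm_mul, mul_comm, ← Complex.ofReal_sub, Complex.norm_real, Real.norm_eq_abs,
      abs_sub_comm]
    exact mul_le_mul_of_nonneg_right (hp _ (hmem _)).le (norm_nonneg _)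
  rw [← sub_eq_zero, ← norm_le_zero_iff]
  refine le_of_forall_pos_le_add fun ε hε => ?_
  obtain ⟨p, hp⟩ := exists_polynomial_near_of_continuousOn 0 1 f hf (ε / (A + A' + 1)) (by positivity)
  have h1 := hclose hh hτ p _ hp
  have h2 := hclose hh' hτ' p _ hp
  rw [← hpoly p, norm_sub_rev] at h2
  refine (norm_sub_le_norm_sub_add_norm_sub _ _ _).trans ((add_le_add h1 h2).trans ?_)
  rw [← mul_add, zero_add, div_mul_eq_mul_div, div_le_iff₀ (by positivity)]
  exact mul_le_mul_of_nonneg_left (by linarith) hε.le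

/-- A bounded continuous `q` need not have a limit at infinity, so it is damped by `e^(-s/(n+1))`,
which makes it a continuous function of `e^(-s)` vanishing at `0`. Dominated convergence removes the
damping. -/
lemma integral_mul_ofReal_comp_eq (hh : Integrable h μ) (hh' : Integrable h' μ')
    (hτ : Measurable τ) (hτ' : Measurable τ')
    (H : ∀ z : ℂ, 0 < z.re → ∫ w, h w * Complex.exp (-(((τ w : ℝ) : ℂ) * z)) ∂μ
      = ∫ w, h' w * Complex.exp (-(((τ' w : ℝ) : ℂ) * z)) ∂μ')
    {q : ℝ≥0 → ℝ} (hq : Continuous q) {C : ℝ} (hC : ∀ s, |q s| ≤ C) :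
    ∫ w, h w * (q (τ w) : ℂ) ∂μ = ∫ w, h' w * (q (τ' w) : ℂ) ∂μ' := by
  set f : ℕ → ℝ → ℝ := fun n x => q (Real.toNNReal (-Real.log x)) * x ^ (1 / ((n : ℝ) + 1)) with hf
  have hfc : ∀ n, ContinuousOn (f n) (Icc 0 1) := by
    intro n
    have hpos : (0 : ℝ) < 1 / ((n : ℝ) + 1) := by positivity
    intro x hx
    refine ContinuousAt.continuousWithinAt ?_
    rcases eq_or_ne x 0 with rfl | hx0
    · have h0 : f n 0 = 0 := by simp only [hf]; rw [Real.zero_rpow hpos.ne', mul_zero]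
      rw [ContinuousAt, h0]
      have hr : Tendsto (fun x : ℝ => C * |x ^ (1 / ((n : ℝ) + 1))|) (𝓝 0) (𝓝 0) := by
        have := (Real.continuousAt_rpow_const (0 : ℝ) (1 / ((n : ℝ) + 1)) (Or.inr hpos.le)).tendsto.abs.const_mul C
        rwa [Real.zero_rpow hpos.ne', abs_zero, mul_zero] at this
      refine squeeze_zero_norm (fun y => ?_) hr
      rw [Real.norm_eq_abs, abs_mul]
      gcongr
      exact hC _
    · refine ContinuousAt.mul ?_ (Real.continuousAt_rpow_const _ _ (Or.inr hpos.le))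
      exact hq.continuousAt.comp (continuous_real_toNNReal.continuousAt.comp
        (Real.continuousAt_log hx0).neg)
  have hval : ∀ n (s : ℝ≥0), f n (Real.exp (-(s : ℝ))) = q s * Real.exp (-(s * (1 / ((n : ℝ) + 1)))) := by
    intro n s
    simp only [hf]
    rw [Real.log_exp, neg_neg, Real.toNNReal_coe, ← Real.exp_mul, neg_mul]
  have hlim : ∀ {Ω : Type} [MeasurableSpace Ω] {μ : Measure Ω} {h : Ω → ℂ} {τ : Ω → ℝ≥0},
      Integrable h μ → Measurable τ →
      Tendsto (fun n : ℕ => ∫ w, h w * (f n (Real.exp (-(τ w : ℝ))) : ℂ) ∂μ) atTop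
        (𝓝 (∫ w, h w * (q (τ w) : ℂ) ∂μ)) := by
    intro Ω _ μ h τ hh hτ
    simp only [hval]
    refine tendsto_integral_of_dominated_convergence (fun w => ‖h w‖ * C) (fun n => ?_)
      (hh.norm.mul_const C) (fun n => Eventually.of_forall fun w => ?_)
      (Eventually.of_forall fun w => ?_)
    · have := hq.measurable
      exact hh.aestronglyMeasurable.mul (by fun_prop)
    · rw [norm_mul, Complex.norm_real, norm_mul, Real.norm_eq_abs]
      refine mul_le_mul_of_nonneg_left ?_ (norm_nonneg _)
      rw [Real.norm_of_nonneg (Real.exp_nonneg _)]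
      refine (mul_le_of_le_one_right (abs_nonneg _) (Real.exp_le_one_iff.2 ?_)).trans (hC _)
      exact neg_nonpos.2 (mul_nonneg (τ w).2 (by positivity))
    · have h1 : Tendsto (fun n : ℕ => q (τ w) * Real.exp (-((τ w : ℝ) * (1 / ((n : ℝ) + 1))))) atTop
          (𝓝 (q (τ w) * Real.exp (-((τ w : ℝ) * 0)))) :=
        ((Real.continuous_exp.tendsto _).comp
          (tendsto_one_div_add_atTop_nhds_zero_nat.const_mul _).neg).const_mul _
      rw [mul_zero, neg_zero, Real.exp_zero, mul_one] at h1
      exact ((Complex.continuous_ofReal.tendsto _).comp h1).const_mul _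
  exact tendsto_nhds_unique (hlim hh hτ) ((hlim hh' hτ').congr fun n =>
    (integral_mul_comp_exp_eq hh hh' hτ hτ' H (hfc n)).symm)

lemma integral_mul_comp_eq (hh : Integrable h μ) (hh' : Integrable h' μ')
    (hτ : Measurable τ) (hτ' : Measurable τ')
    (H : ∀ z : ℂ, 0 < z.re → ∫ w, h w * Complex.exp (-(((τ w : ℝ) : ℂ) * z)) ∂μ
      = ∫ w, h' w * Complex.exp (-(((τ' w : ℝ) : ℂ) * z)) ∂μ')
    {q : ℝ≥0 → ℂ} (hq : Continuous q) {C : ℝ} (hC : ∀ s, ‖q s‖ ≤ C) :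
    ∫ w, h w * q (τ w) ∂μ = ∫ w, h' w * q (τ' w) ∂μ' := by
  have hre := integral_mul_ofReal_comp_eq hh hh' hτ hτ' H (q := fun s => (q s).re)
    (Complex.continuous_re.comp hq) fun s => (Complex.abs_re_le_norm _).trans (hC s)
  have him := integral_mul_ofReal_comp_eq hh hh' hτ hτ' H (q := fun s => (q s).im)
    (Complex.continuous_im.comp hq) fun s => (Complex.abs_im_le_norm _).trans (hC s)
  have hsplit : ∀ {Ω : Type} [MeasurableSpace Ω] {μ : Measure Ω} {h : Ω → ℂ} {τ : Ω → ℝ≥0},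
      Integrable h μ → Measurable τ → ∫ w, h w * q (τ w) ∂μ
        = ∫ w, h w * ((q (τ w)).re : ℂ) ∂μ + (∫ w, h w * ((q (τ w)).im : ℂ) ∂μ) * Complex.I := by
    intro Ω _ μ h τ hh hτ
    rw [← integral_mul_const, ← integral_add]
    · refine integral_congr_ae (Eventually.of_forall fun w => ?_)
      simp only
      conv_lhs => rw [← Complex.re_add_im (q (τ w))]
      ring
    · exact hh.mul_bounded_comp hτ (q := fun s => ((q s).re : ℂ)) (C := C) (by fun_prop)
        fun s => by rw [Complex.norm_real]; exact (Complex.abs_re_le_norm _).trans (hC s)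
    · exact (hh.mul_bounded_comp hτ (q := fun s => ((q s).im : ℂ)) (C := C) (by fun_prop)
        fun s => by rw [Complex.norm_real]; exact (Complex.abs_im_le_norm _).trans (hC s)).mul_const _
  rw [hsplit hh hτ, hsplit hh' hτ', hre, him]

end LaplaceUniqueness

/-! ### The Hille–Phillips calculus of a bounded semigroup -/

namespace C0Semigroup

variable {X : Type*} [NormedAddCommGroup X] [NormedSpace ℂ X] [CompleteSpace X]
  {S : C0Semigroup X} {M : ℝ}

lemma norm_op_apply_le (hM : ∀ s, ‖S.op s‖ ≤ M) (s : ℝ≥0) (x : X) : ‖S.op s x‖ ≤ M * ‖x‖ :=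
  ((S.op s).le_opNorm x).trans (mul_le_mul_of_nonneg_right (hM s) (norm_nonneg x))

lemma integrable_smul_op (hM : ∀ s, ‖S.op s‖ ≤ M) {μ : Measure ℝ≥0} {h : ℝ≥0 → ℂ}
    (hh : Integrable h μ) (x : X) : Integrable (fun s => h s • S.op s x) μ :=
  hh.smul_bdd (M * ‖x‖) (S.continuous_op x).aestronglyMeasurable
    (Eventually.of_forall fun s => S.norm_op_apply_le hM s x)

lemma exists_isHPValue (hM : ∀ s, ‖S.op s‖ ≤ M) {F : ℂ → ℂ} {μ : Measure ℝ≥0} {h : ℝ≥0 → ℂ}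
    (hF : IsComplexLaplace F μ h) :
    ∃ T : X →L[ℂ] X, ∀ x, T x = ∫ s : ℝ≥0, h s • S.op s x ∂μ := by
  let T : X →ₗ[ℂ] X :=
    { toFun := fun x => ∫ s : ℝ≥0, h s • S.op s x ∂μ
      map_add' := fun x y => by
        simp only [map_add, smul_add]
        exact integral_add (S.integrable_smul_op hM hF.2.1 x) (S.integrable_smul_op hM hF.2.1 y)
      map_smul' := fun c x => by
        simp only [map_smul, RingHom.id_apply]
        rw [← integral_smul]
        simp only [smul_comm c] }
  refine ⟨T.mkContinuous ((∫ s, ‖h s‖ ∂μ) * M) fun x => ?_, fun x => rfl⟩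
  rw [mul_assoc, ← integral_mul_const]
  refine norm_integral_le_of_norm_le (hF.2.1.norm.mul_const _) (Eventually.of_forall fun s => ?_)
  rw [norm_smul]
  exact mul_le_mul_of_nonneg_left (S.norm_op_apply_le hM s x) (norm_nonneg _)

lemma isHPValue_hp (hM : ∀ s, ‖S.op s‖ ≤ M) {F : ℂ → ℂ} (hF : MemLaplaceAlgebra F) :
    S.IsHPValue F (S.hp F) := by
  obtain ⟨μ, h, hh⟩ := hF
  obtain ⟨T, hT⟩ := S.exists_isHPValue hM hh
  have hex : ∃ T : X →L[ℂ] X, S.IsHPValue F T := ⟨T, μ, h, hh, hT⟩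
  rw [hp, dif_pos hex]
  exact hex.choose_spec

/-- By the semigroup law the product becomes one integral over the product measure, with `p.1 + p.2`
as time variable. Pairing with a functional makes it scalar, ready for uniqueness of Laplace
transforms without forming a convolution. -/
lemma dual_apply_mul_apply (hM : ∀ s, ‖S.op s‖ ≤ M) {μ₁ μ₂ : Measure ℝ≥0} {h₁ h₂ : ℝ≥0 → ℂ}
    [SFinite μ₁] [SFinite μ₂] (hh₁ : Integrable h₁ μ₁) (hh₂ : Integrable h₂ μ₂) {T₁ T₂ : X →L[ℂ] X}
    (hT₁ : ∀ x, T₁ x = ∫ s : ℝ≥0, h₁ s • S.op s x ∂μ₁)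
    (hT₂ : ∀ x, T₂ x = ∫ s : ℝ≥0, h₂ s • S.op s x ∂μ₂) (φ : X →L[ℂ] ℂ) (x : X) :
    φ (T₁ (T₂ x)) = ∫ p : ℝ≥0 × ℝ≥0, (h₁ p.1 * h₂ p.2) * φ (S.op (p.1 + p.2) x) ∂(μ₁.prod μ₂) := by
  have hint : Integrable (fun p : ℝ≥0 × ℝ≥0 => (h₁ p.1 * h₂ p.2) * φ (S.op (p.1 + p.2) x))
      (μ₁.prod μ₂) := by
    refine (hh₁.mul_prod hh₂).mul_bounded_comp (τ := fun p : ℝ≥0 × ℝ≥0 => p.1 + p.2) (by fun_prop)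
      (q := fun s => φ (S.op s x)) (C := ‖φ‖ * (M * ‖x‖)) (φ.continuous.comp (S.continuous_op x))
      fun s => ?_
    exact (φ.le_opNorm _).trans
      (mul_le_mul_of_nonneg_left (S.norm_op_apply_le hM s x) (norm_nonneg _))
  rw [integral_prod _ hint, hT₁, ← φ.integral_comp_comm (S.integrable_smul_op hM hh₁ _)]
  refine integral_congr_ae (Eventually.of_forall fun s => ?_)
  simp only
  rw [hT₂, ← (S.op s).integral_comp_comm (S.integrable_smul_op hM hh₂ _), map_smul,
    ← φ.integral_comp_comm]
  · rw [smul_eq_mul, ← integral_const_mul]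
    refine integral_congr_ae (Eventually.of_forall fun u => ?_)
    simp only [map_smul, smul_eq_mul, S.op_add s u, ContinuousLinearMap.comp_apply]
    ring
  · exact (S.op s).integrable_comp (S.integrable_smul_op hM hh₂ x)

/-- Products in the Hille–Phillips calculus depend only on the product of the functions. -/
theorem IsHPValue.mul_eq_mul (hM : ∀ s, ‖S.op s‖ ≤ M) {F₁ F₂ F₃ F₄ : ℂ → ℂ}
    {T₁ T₂ T₃ T₄ : X →L[ℂ] X} (h₁ : S.IsHPValue F₁ T₁) (h₂ : S.IsHPValue F₂ T₂)
    (h₃ : S.IsHPValue F₃ T₃) (h₄ : S.IsHPValue F₄ T₄)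
    (hF : ∀ z : ℂ, 0 < z.re → F₁ z * F₂ z = F₃ z * F₄ z) : T₁ * T₂ = T₃ * T₄ := by
  obtain ⟨μ₁, k₁, ⟨_, i₁, e₁⟩, v₁⟩ := h₁
  obtain ⟨μ₂, k₂, ⟨_, i₂, e₂⟩, v₂⟩ := h₂
  obtain ⟨μ₃, k₃, ⟨_, i₃, e₃⟩, v₃⟩ := h₃
  obtain ⟨μ₄, k₄, ⟨_, i₄, e₄⟩, v₄⟩ := h₄
  ext x
  refine (SeparatingDual.eq_iff_forall_dual_eq (R := ℂ)).2 fun φ => ?_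
  simp only [mul_apply_eq_comp]
  rw [S.dual_apply_mul_apply hM i₁ i₂ v₁ v₂, S.dual_apply_mul_apply hM i₃ i₄ v₃ v₄]
  refine integral_mul_comp_eq (q := fun s => φ (S.op s x)) (C := ‖φ‖ * (M * ‖x‖))
    (τ := fun p : ℝ≥0 × ℝ≥0 => p.1 + p.2) (τ' := fun p : ℝ≥0 × ℝ≥0 => p.1 + p.2)
    (i₁.mul_prod i₂) (i₃.mul_prod i₄) (by fun_prop) (by fun_prop) (fun z hz => ?_)
    (φ.continuous.comp (S.continuous_op x)) fun s => (φ.le_opNorm _).trans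
      (mul_le_mul_of_nonneg_left (S.norm_op_apply_le hM s x) (norm_nonneg _))
  have key := hF z hz
  rw [e₁ z hz, e₂ z hz, e₃ z hz, e₄ z hz, ← integral_prod_mul, ← integral_prod_mul] at key
  convert! key using 3 with p p <;>
  · rw [NNReal.coe_add, Complex.ofReal_add, add_mul, neg_add, Complex.exp_add]
    ring

lemma isHPValue_one : S.IsHPValue (fun _ => 1) 1 := by
  refine ⟨Measure.dirac 0, fun _ => 1, ⟨inferInstance, integrable_const _, fun z _ => ?_⟩, fun x => ?_⟩
  · rw [integral_dirac]; simp
  · rw [integral_dirac]; simp [S.op_zero]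

/-- `hp` is an arbitrary choice among representations, so this independence is what allows it to be
computed. -/
lemma IsHPValue.unique (hM : ∀ s, ‖S.op s‖ ≤ M) {F G : ℂ → ℂ} {T₁ T₂ : X →L[ℂ] X}
    (h₁ : S.IsHPValue F T₁) (h₂ : S.IsHPValue G T₂) (hF : ∀ z : ℂ, 0 < z.re → F z = G z) :
    T₁ = T₂ := by
  simpa using IsHPValue.mul_eq_mul hM h₁ isHPValue_one h₂ isHPValue_one
    (fun z hz => by rw [hF z hz])

lemma IsHPValue.hp_eq (hM : ∀ s, ‖S.op s‖ ≤ M) {F : ℂ → ℂ} {T : X →L[ℂ] X}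
    (h : S.IsHPValue F T) : S.hp F = T := by
  obtain ⟨μ, k, hk, -⟩ := id h
  exact (S.isHPValue_hp hM ⟨μ, k, hk⟩).unique hM h fun _ _ => rfl

lemma IsHPValue.memLaplaceAlgebra {F : ℂ → ℂ} {T : X →L[ℂ] X} (h : S.IsHPValue F T) :
    MemLaplaceAlgebra F := by
  obtain ⟨μ, k, hk, -⟩ := h
  exact ⟨μ, k, hk⟩

lemma _root_.integral_dirac_zero_add_dirac_one_smul {E : Type*} [NormedAddCommGroup E]
    [NormedSpace ℂ E] [CompleteSpace E] {f : ℝ≥0 → E} (hf : Continuous f) :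
    ∫ s : ℝ≥0, (if s = 0 then (1 : ℂ) else -1) • f s
      ∂(Measure.dirac 0 + Measure.dirac 1) = f 0 - f 1 := by
  have hm : ∀ a : ℝ≥0, Integrable (fun s : ℝ≥0 => (if s = 0 then (1 : ℂ) else -1) • f s)
      (Measure.dirac a) := fun a => by
    refine integrable_dirac' (StronglyMeasurable.smul ?_ hf.stronglyMeasurable) (by finiteness)
    exact (Measurable.ite (measurableSet_singleton 0) measurable_const
        measurable_const).stronglyMeasurable
  rw [integral_add_measure (hm 0) (hm 1), integral_dirac, integral_dirac]
  simp [sub_eq_add_neg]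

lemma isHPValue_one_sub_op : S.IsHPValue (fun z => 1 - Complex.exp (-z)) (1 - S.op 1) := by
  have hi : ∀ (a : ℝ≥0), Integrable (fun s : ℝ≥0 => if s = 0 then (1 : ℂ) else -1) (Measure.dirac a) :=
    fun a => by
      refine (integrable_const (1 : ℝ)).mono' ?_ (Eventually.of_forall fun s => ?_)
      · exact (Measurable.ite (measurableSet_singleton 0) measurable_const
          measurable_const).aestronglyMeasurable
      · split_ifs <;> simp
  refine ⟨Measure.dirac 0 + Measure.dirac 1, fun s => if s = 0 then 1 else -1,
    ⟨inferInstance, (hi 0).add_measure (hi 1), fun z _ => ?_⟩, fun x => ?_⟩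
  · have := integral_dirac_zero_add_dirac_one_smul
      (f := fun s : ℝ≥0 => Complex.exp (-(((s : ℝ) : ℂ) * z))) (by fun_prop)
    simp only [smul_eq_mul] at this
    rw [this]; simp
  · have := integral_dirac_zero_add_dirac_one_smul (S.continuous_op x)
    simp only at this ⊢
    rw [this]
    simp [S.op_zero]

/-- To compute `A^{-α} T` it suffices to use the regularizer `1 - e^{-z}`. -/
theorem fracPowCompEq_neg_of_mul_eq (hM : ∀ s, ‖S.op s‖ ≤ M) {α : ℝ} {K T B : X →L[ℂ] X}
    (hK : S.IsHPValue (fun z => (1 - Complex.exp (-z)) * z ^ ((-α : ℝ) : ℂ)) K)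
    (hinj : Function.Injective (1 - S.op 1 : X →L[ℂ] X))
    (hKT : K * T = (1 - S.op 1) * B) : S.FracPowCompEq (-α) T B := by
  have hP : S.hp (fun z => 1 - Complex.exp (-z)) = 1 - S.op 1 := isHPValue_one_sub_op.hp_eq hM
  intro x y
  constructor
  · rintro ⟨-, e, he, hef, heinj, hxy⟩
    have hE := S.isHPValue_hp hM he
    have hE' := S.isHPValue_hp hM hef
    apply heinj
    rw [← hxy]
    apply hinj
    -- An arbitrary regularizer `e` is compared with `1 - e^(-z)`: both sides come from the function
    -- `(1 - e^(-z)) e(z) z^(-α)`. Cancelling the two injective operators leaves `y = B x`.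
    have c1 : (1 - S.op 1) * S.hp (fun z => e z * z ^ ((-α : ℝ) : ℂ)) = S.hp e * K :=
      IsHPValue.mul_eq_mul hM isHPValue_one_sub_op hE' hE hK fun z _ => by ring
    have c2 : S.hp e * (1 - S.op 1) = (1 - S.op 1) * S.hp e :=
      IsHPValue.mul_eq_mul hM hE isHPValue_one_sub_op isHPValue_one_sub_op hE fun z _ => by ring
    change ((1 - S.op 1) * S.hp (fun z => e z * z ^ ((-α : ℝ) : ℂ))) (T x)
      = ((1 - S.op 1) * S.hp e) (B x)
    rw [c1, ← c2]
    change S.hp e ((K * T) x) = S.hp e (((1 - S.op 1) * B) x)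
    rw [hKT]
  · rintro rfl
    refine ⟨fun z hz => ?_, fun z => 1 - Complex.exp (-z), isHPValue_one_sub_op.memLaplaceAlgebra (S := S),
      hK.memLaplaceAlgebra, by rw [hP]; exact hinj, ?_⟩
    · exact (DifferentiableAt.cpow_const differentiableAt_id (Or.inl hz)).differentiableWithinAt
    · rw [hP, hK.hp_eq hM]
      exact congrArg (fun L : X →L[ℂ] X => L x) hKT

end C0Semigroup

/-! ### Closed subspaces and Bochner integrals -/

/-- In the quotient by `p` the integrand is zero. A non-integrable function has integral `0` by
convention, which also lies in `p`. -/
lemma Submodule.integral_mem_of_isClosed {E : Type*} [NormedAddCommGroup E] [NormedSpace ℂ E]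
    [CompleteSpace E] {p : Submodule ℂ E} (hp : IsClosed (p : Set E)) {Ω : Type*}
    [MeasurableSpace Ω] {μ : Measure Ω} {f : Ω → E} (hf : ∀ x, f x ∈ p) : ∫ x, f x ∂μ ∈ p := by
  by_cases hi : Integrable f μ
  · have : Fact (IsClosed (p : Set E)) := ⟨hp⟩
    let L : E →L[ℂ] E ⧸ p := p.mkQL
    have h := L.integral_comp_comm hi
    have h0 : ∀ x, L (f x) = 0 := fun x => (Submodule.Quotient.mk_eq_zero p).2 (hf x)
    simp only [h0, integral_zero] at h
    exact (Submodule.Quotient.mk_eq_zero p).1 h.symm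
  · rw [integral_undef hi]; exact p.zero_mem

/-! ### Operator-norm analyticity, the commutant, and injectivity of `1 - e^(-A)` -/

namespace C0Semigroup

variable {X : Type*} [NormedAddCommGroup X] [NormedSpace ℂ X] [CompleteSpace X]

/-- `Q t = A e^{-tA}` is minus the right derivative in operator norm of a bounded semigroup that is
norm continuous on `(0,∞)`, and `‖Q t‖ ≤ C / t`. -/
structure IsBoundedAnalytic (S : C0Semigroup X) (M C : ℝ) (Q : ℝ≥0 → X →L[ℂ] X) : Prop where
  norm_op_le : ∀ s, ‖S.op s‖ ≤ M
  continuousOn_op : ContinuousOn S.op (Ioi 0)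
  tendsto_slope : ∀ t : ℝ≥0, 0 < t →
    Tendsto (fun h : ℝ≥0 => ((h : ℝ) : ℂ)⁻¹ • (S.op t - S.op (t + h))) (𝓝[>] 0) (𝓝 (Q t))
  norm_le : ∀ t : ℝ≥0, 0 < t → ‖Q t‖ ≤ C / t

/-- Sectors are invariant under positive dilation, so one ball around `1` rescales to all `t`. The
radius proportional to `t` turns Cauchy's estimate into the bound `C / t` on the derivative. -/
lemma exists_closedBall_subset_sector {ξ : ℝ} (hξ : 0 < ξ) :
    ∃ δ : ℝ, 0 < δ ∧ ∀ t : ℝ, 0 < t →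
      Metric.closedBall (t : ℂ) (δ * t) ⊆ {z : ℂ | z ≠ 0 ∧ |z.arg| ≤ ξ} := by
  have h1 : ∀ᶠ z : ℂ in 𝓝 1, |z.arg| < ξ := by
    have := (Complex.continuousAt_arg Complex.one_mem_slitPlane).abs
    refine this.eventually_lt continuousAt_const ?_
    simpa using hξ
  have h2 : ∀ᶠ z : ℂ in 𝓝 1, z ≠ 0 := eventually_ne_nhds one_ne_zero
  obtain ⟨δ, hδ, hsub⟩ := Metric.nhds_basis_closedBall.eventually_iff.1 (h1.and h2)
  refine ⟨δ, hδ, fun t ht z hz => ?_⟩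
  have htc : (t : ℂ) ≠ 0 := by exact_mod_cast ht.ne'
  have hw : z / t ∈ Metric.closedBall (1 : ℂ) δ := by
    rw [Metric.mem_closedBall, dist_eq_norm] at hz ⊢
    rw [div_sub_one htc, norm_div, Complex.norm_real, Real.norm_of_nonneg ht.le, div_le_iff₀ ht]
    exact hz
  have hzw : z = (t : ℂ) * (z / t) := by field_simp
  obtain ⟨ha, h0⟩ := hsub hw
  refine ⟨fun hz0 => h0 (by rw [hz0, zero_div]), ?_⟩
  rw [hzw, Complex.arg_real_mul _ ht]
  exact ha.le

lemma IsSectoriallyBoundedHolomorphic.exists_isBoundedAnalytic {S : C0Semigroup X}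
    (hS : S.IsSectoriallyBoundedHolomorphic) :
    ∃ M C : ℝ, ∃ Q : ℝ≥0 → X →L[ℂ] X, S.IsBoundedAnalytic M C Q := by
  obtain ⟨θ, hθ, -, T, hT, hd, hb⟩ := hS
  obtain ⟨⟨M, hM⟩, -⟩ := hb (θ / 2) (by linarith) (by linarith)
  obtain ⟨δ, hδ, hball⟩ := exists_closedBall_subset_sector (half_pos hθ)
  have hsub : ∀ t : ℝ, 0 < t → Metric.closedBall (t : ℂ) (δ * t) ⊆ {z : ℂ | z ≠ 0 ∧ |z.arg| < θ} :=
    fun t ht z hz => ⟨(hball t ht hz).1, lt_of_le_of_lt (hball t ht hz).2 (by linarith)⟩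
  have hdiff : ∀ t : ℝ, 0 < t → DifferentiableAt ℂ T t := fun t ht =>
    hd.differentiableAt (Filter.mem_of_superset
      (Metric.closedBall_mem_nhds _ (mul_pos hδ ht)) (hsub t ht))
  refine ⟨M, M / δ, fun t => -deriv T ((t : ℝ) : ℂ), fun s => ?_, fun t ht => ?_, fun t ht => ?_,
    fun t ht => ?_⟩
  · rw [← hT]
    refine hM _ ?_
    have : ((s : ℝ) : ℂ).arg = 0 := Complex.arg_ofReal_of_nonneg s.2
    rw [this, abs_zero]
    linarith
  · have h1 : ContinuousAt (fun s : ℝ≥0 => T ((s : ℝ) : ℂ)) t :=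
      ContinuousAt.comp (f := fun s : ℝ≥0 => ((s : ℝ) : ℂ)) (hdiff t (by exact_mod_cast ht)).continuousAt
        (by fun_prop)
    simp only [hT] at h1
    exact h1.continuousWithinAt
  · have ht' : (0 : ℝ) < t := by exact_mod_cast ht
    have h1 := hasDerivAt_iff_tendsto_slope_zero.1 (hdiff t ht').hasDerivAt
    have h2 : Tendsto (fun h : ℝ≥0 => ((h : ℝ) : ℂ)) (𝓝[>] 0) (𝓝[≠] 0) := by
      refine tendsto_nhdsWithin_iff.2 ⟨?_, ?_⟩
      · have : Continuous fun h : ℝ≥0 => ((h : ℝ) : ℂ) := by fun_prop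
        simpa using (this.tendsto 0).mono_left nhdsWithin_le_nhds
      · filter_upwards [self_mem_nhdsWithin] with h hh
        have : (0 : ℝ) < h := by exact_mod_cast hh
        simpa using this.ne'
    refine ((h1.comp h2).neg).congr fun h => ?_
    simp only [Function.comp_apply]
    rw [← Complex.ofReal_add, ← NNReal.coe_add, hT, hT, ← smul_neg, neg_sub]
  · have ht' : (0 : ℝ) < t := by exact_mod_cast ht
    have hδt : 0 < δ * t := mul_pos hδ ht'
    have := Complex.norm_deriv_le_of_forall_mem_sphere_norm_le hδt
      (hd.diffContOnCl_ball (hsub t ht')) (C := M)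
      fun z hz => hM z (hball t ht' (Metric.sphere_subset_closedBall hz)).2
    rw [norm_neg]
    rwa [div_div]

lemma op_commute (S : C0Semigroup X) (s t : ℝ≥0) : S.op s * S.op t = S.op t * S.op s := by
  have h1 := S.op_add s t
  have h2 := S.op_add t s
  rw [add_comm] at h2
  exact h1.symm.trans h2

lemma op_add_eq_mul (S : C0Semigroup X) (s t : ℝ≥0) : S.op (s + t) = S.op s * S.op t :=
  S.op_add s t

/-- The closed subspace of bounded operators commuting with a semigroup. -/
def commutant (S : C0Semigroup X) : Submodule ℂ (X →L[ℂ] X) where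
  carrier := {V | ∀ s, S.op s * V = V * S.op s}
  add_mem' := fun {V W} hV hW s => by rw [mul_add, add_mul, hV s, hW s]
  zero_mem' := fun s => by rw [mul_zero, zero_mul]
  smul_mem' := fun c V hV s => by rw [mul_smul_comm, smul_mul_assoc, hV s]

lemma isClosed_commutant (S : C0Semigroup X) : IsClosed (S.commutant : Set (X →L[ℂ] X)) := by
  have : (S.commutant : Set (X →L[ℂ] X)) = ⋂ s, {V | S.op s * V = V * S.op s} := by
    ext V; simp [commutant]
  rw [this]
  exact isClosed_iInter fun s => isClosed_eq (by fun_prop) (by fun_prop)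

lemma op_mem_commutant (S : C0Semigroup X) (t : ℝ≥0) : S.op t ∈ S.commutant :=
  fun s => S.op_commute s t

lemma one_mem_commutant (S : C0Semigroup X) : (1 : X →L[ℂ] X) ∈ S.commutant :=
  fun s => by rw [mul_one, one_mul]

lemma mul_mem_commutant {S : C0Semigroup X} {V W : X →L[ℂ] X} (hV : V ∈ S.commutant)
    (hW : W ∈ S.commutant) : V * W ∈ S.commutant := fun s => by
  rw [← mul_assoc, hV s, mul_assoc, hW s, mul_assoc]

namespace IsGeneratedByNeg

variable {S : C0Semigroup X} {A : X →ₗ.[ℂ] X}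

lemma map_mem_graph (hA : S.IsGeneratedByNeg A) {V : X →L[ℂ] X} (hV : V ∈ S.commutant) {x y : X}
    (h : (x, y) ∈ A.graph) : (V x, V y) ∈ A.graph := by
  rw [hA] at h ⊢
  refine ((V.continuous.tendsto y).comp h).congr fun s => ?_
  have e : S.op s (V x) = V (S.op s x) := congrArg (fun L : X →L[ℂ] X => L x) (hV s)
  simp [e]

lemma graph_unique {x y y' : X} (h : (x, y) ∈ A.graph)
    (h' : (x, y') ∈ A.graph) : y = y' := by
  rw [LinearPMap.mem_graph_iff] at h h'
  obtain ⟨u, hu, rfl⟩ := h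
  obtain ⟨v, hv, rfl⟩ := h'
  have : u = v := Subtype.ext (hu.trans hv.symm)
  rw [this]

end IsGeneratedByNeg

namespace IsBoundedAnalytic

variable {S : C0Semigroup X} {A : X →ₗ.[ℂ] X} {M C : ℝ} {Q : ℝ≥0 → X →L[ℂ] X}

/-- Norm continuity may fail at `0`, and a measure may charge that point, so it is split off. -/
lemma aestronglyMeasurable_op (h : S.IsBoundedAnalytic M C Q) (μ : Measure ℝ≥0) :
    AEStronglyMeasurable S.op μ := by
  have hu : (univ : Set ℝ≥0) = {0} ∪ Ioi 0 := by
    ext s; simp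
  rw [← Measure.restrict_univ (μ := μ), hu, aestronglyMeasurable_union_iff]
  refine ⟨?_, h.continuousOn_op.aestronglyMeasurable measurableSet_Ioi⟩
  refine (aestronglyMeasurable_const (b := S.op 0)).congr ?_
  filter_upwards [ae_restrict_mem (measurableSet_singleton 0)] with s hs
  rw [mem_singleton_iff.1 hs]

lemma integrable_op (h : S.IsBoundedAnalytic M C Q) (μ : Measure ℝ≥0) [IsFiniteMeasure μ] :
    Integrable S.op μ :=
  (integrable_const M).mono' (h.aestronglyMeasurable_op μ) (Eventually.of_forall h.norm_op_le)

lemma op_mul (h : S.IsBoundedAnalytic M C Q) (s : ℝ≥0) {t : ℝ≥0} (ht : 0 < t) :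
    S.op s * Q t = Q (s + t) := by
  refine tendsto_nhds_unique ((h.tendsto_slope t ht).const_mul (S.op s))
    ((h.tendsto_slope (s + t) (by positivity)).congr fun u => ?_)
  rw [mul_smul_comm, mul_sub, ← op_add_eq_mul, ← op_add_eq_mul, add_assoc]

lemma mul_op (h : S.IsBoundedAnalytic M C Q) (s : ℝ≥0) {t : ℝ≥0} (ht : 0 < t) :
    Q t * S.op s = Q (s + t) := by
  refine tendsto_nhds_unique ((h.tendsto_slope t ht).mul_const (S.op s))
    ((h.tendsto_slope (s + t) (by positivity)).congr fun u => ?_)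
  rw [smul_mul_assoc, sub_mul, ← op_add_eq_mul, ← op_add_eq_mul, add_comm s t,
    add_right_comm t s u]

lemma mem_commutant (h : S.IsBoundedAnalytic M C Q) {t : ℝ≥0} (ht : 0 < t) : Q t ∈ S.commutant :=
  fun s => by rw [h.op_mul s ht, h.mul_op s ht]

lemma mem_graph (h : S.IsBoundedAnalytic M C Q) (hA : S.IsGeneratedByNeg A) {t : ℝ≥0} (ht : 0 < t)
    (x : X) : (S.op t x, Q t x) ∈ A.graph := by
  rw [hA]
  have := ((ContinuousLinearMap.apply ℂ X x).continuous.tendsto _).comp (h.tendsto_slope t ht)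
  refine this.congr fun u => ?_
  simp only [Function.comp_apply]
  rw [add_comm t u, S.op_add]
  simp

/-- `A² e^(-2tA) = (A e^(-tA))²`; this is why the time is halved throughout when the corrected
approximant is treated. -/
lemma squareCompEq (h : S.IsBoundedAnalytic M C Q) (hA : S.IsGeneratedByNeg A) {t : ℝ≥0}
    (ht : 0 < t) : SquareCompEq A (S.op (t + t)) (Q t * Q t) := fun x => by
  refine ⟨S.op t (Q t x), ?_, h.mem_graph hA ht (Q t x)⟩
  have := hA.map_mem_graph (S.op_mem_commutant t) (h.mem_graph hA ht x)
  rw [S.op_add]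
  exact this

/-- A fixed vector of `e^(-A)` is fixed by every `e^(-nA)`. But `e^(-nA) → 0` strongly: on the range
of `A` because `‖A e^(-nA)‖ ≤ C/n`, and elsewhere by density and boundedness. -/
lemma injective_one_sub_op (h : S.IsBoundedAnalytic M C Q) (hA : S.IsGeneratedByNeg A)
    (hran : Dense {y : X | ∃ x : A.domain, A x = y}) :
    Function.Injective (1 - S.op 1 : X →L[ℂ] X) := by
  rw [injective_iff_map_eq_zero]
  intro x hx
  have hx1 : S.op 1 x = x := by
    have : x - S.op 1 x = 0 := by simpa using hx
    exact (sub_eq_zero.1 this).symm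
  have hxn : ∀ n : ℕ, S.op n x = x := fun n => by
    induction n with
    | zero => simp [S.op_zero]
    | succ n ih =>
      rw [Nat.cast_succ, S.op_add, ContinuousLinearMap.comp_apply, hx1, ih]
  have hzero : ∀ y : X, Tendsto (fun n : ℕ => S.op (n : ℝ≥0) y) atTop (𝓝 0) := by
    have hM0 : 0 ≤ M := (norm_nonneg _).trans (h.norm_op_le 0)
    intro y
    rw [Metric.tendsto_atTop]
    intro ε hε
    obtain ⟨_, ⟨z, rfl⟩, hz⟩ := Metric.mem_closure_iff.1 (hran y) (ε / (2 * (M + 1))) (by positivity)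
    have hQz : ∀ n : ℕ, 0 < n → S.op (n : ℝ≥0) (A z) = Q n z := fun n hn =>
      IsGeneratedByNeg.graph_unique (A := A)
        (hA.map_mem_graph (S.op_mem_commutant (n : ℝ≥0)) (A.mem_graph z))
        (h.mem_graph hA (by exact_mod_cast hn) _)
    have hlim : Tendsto (fun n : ℕ => C * ‖(z : X)‖ / (n : ℝ)) atTop (𝓝 0) :=
      tendsto_const_div_atTop_nhds_zero_nat _
    obtain ⟨N, hN⟩ := ((hlim.eventually_lt_const (half_pos hε)).and
      (eventually_gt_atTop 0)).exists_forall_of_atTop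
    refine ⟨N, fun n hn => ?_⟩
    obtain ⟨h1, h0⟩ := hN n hn
    rw [dist_zero_right]
    have e : S.op (n : ℝ≥0) y = S.op n (y - A z) + Q n z := by rw [map_sub, hQz n h0]; abel
    have b1 : ‖S.op (n : ℝ≥0) (y - A z)‖ ≤ ε / 2 := by
      refine (S.norm_op_apply_le h.norm_op_le _ _).trans ?_
      rw [dist_eq_norm] at hz
      calc M * ‖y - A z‖ ≤ (M + 1) * (ε / (2 * (M + 1))) := by gcongr; linarith
        _ = ε / 2 := by field_simp
    have b2 : ‖Q (n : ℝ≥0) z‖ < ε / 2 := by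
      refine lt_of_le_of_lt (((Q n).le_opNorm _).trans (mul_le_mul_of_nonneg_right
        (h.norm_le n (by exact_mod_cast h0)) (norm_nonneg _))) ?_
      rw [div_mul_eq_mul_div]
      simpa using h1
    rw [e]
    linarith [norm_add_le (S.op (n : ℝ≥0) (y - A z)) (Q n z)]
  have := hzero x
  simp only [hxn] at this
  exact tendsto_nhds_unique tendsto_const_nhds this

end IsBoundedAnalytic

/-! ### The ideal `(r - A) H` and the lower norm bound at points of the spectrum -/

/-- The operators `V = (r - A) H` with `V` and `H` in the commutant of the semigroup. -/
def resolventIdeal (S : C0Semigroup X) (A : X →ₗ.[ℂ] X) (r : ℂ) : Submodule ℂ (X →L[ℂ] X) where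
  carrier := {V | V ∈ S.commutant ∧ ∃ H ∈ S.commutant, ∀ x, (H x, r • H x - V x) ∈ A.graph}
  add_mem' := by
    rintro V W ⟨hV, H, hH, h⟩ ⟨hW, H', hH', h'⟩
    refine ⟨add_mem hV hW, H + H', add_mem hH hH', fun x => ?_⟩
    have := add_mem (h x) (h' x)
    rw [Prod.mk_add_mk, ← add_sub_add_comm, ← smul_add] at this
    exact this
  zero_mem' := ⟨zero_mem _, 0, zero_mem _, fun x => by simp⟩
  smul_mem' := by
    rintro c V ⟨hV, H, hH, h⟩
    refine ⟨Submodule.smul_mem _ c hV, c • H, Submodule.smul_mem _ c hH, fun x => ?_⟩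
    have := A.graph.smul_mem c (h x)
    rw [Prod.smul_mk, smul_sub, smul_comm c r] at this
    exact this

variable {S : C0Semigroup X} {A : X →ₗ.[ℂ] X} {r : ℂ}

lemma mul_mem_closure_resolventIdeal_left (hA : S.IsGeneratedByNeg A) {V W : X →L[ℂ] X}
    (hW : W ∈ S.commutant) (hV : V ∈ (S.resolventIdeal A r).topologicalClosure) :
    W * V ∈ (S.resolventIdeal A r).topologicalClosure := by
  refine map_mem_closure (f := fun V => W * V) (by fun_prop) hV ?_
  rintro V ⟨hV, H, hH, h⟩
  refine ⟨mul_mem_commutant hW hV, W * H, mul_mem_commutant hW hH, fun x => ?_⟩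
  have := hA.map_mem_graph hW (h x)
  simpa using this

lemma mul_mem_closure_resolventIdeal_right {V W : X →L[ℂ] X}
    (hW : W ∈ S.commutant) (hV : V ∈ (S.resolventIdeal A r).topologicalClosure) :
    V * W ∈ (S.resolventIdeal A r).topologicalClosure := by
  refine map_mem_closure (f := fun V => V * W) (by fun_prop) hV ?_
  rintro V ⟨hV, H, hH, h⟩
  exact ⟨mul_mem_commutant hV hW, H * W, mul_mem_commutant hH hW, fun x => h (W x)⟩

/-- If `‖1 - V‖ < 1`, then `V = (r - A)H` is invertible with inverse in the commutant, so `H V⁻¹` is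
a right inverse of `r - A`. Commuting with the semigroup, hence with `A`, makes it two-sided and
puts `r` in the resolvent set. -/
lemma one_le_norm_one_sub_of_mem_resolventIdeal (hA : S.IsGeneratedByNeg A)
    (hr : r ∈ unboundedSpectrum A) {V : X →L[ℂ] X} (hV : V ∈ S.resolventIdeal A r) :
    1 ≤ ‖1 - V‖ := by
  by_contra hlt
  push Not at hlt
  obtain ⟨hVc, H, hH, h⟩ := hV
  set U := Units.oneSub (1 - V) hlt with hU
  have hUV : (U : X →L[ℂ] X) = V := by rw [hU, Units.val_oneSub, sub_sub_cancel]
  have hinvV : V * (↑U⁻¹ : X →L[ℂ] X) = 1 := by rw [← hUV]; exact U.mul_inv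
  have hinv : (↑U⁻¹ : X →L[ℂ] X) ∈ S.commutant := fun s => by
    have : Commute (S.op s) (U : X →L[ℂ] X) := by rw [hUV]; exact hVc s
    exact (this.units_inv_right).eq
  have hR : H * ↑U⁻¹ ∈ S.commutant := mul_mem_commutant hH hinv
  have hgr : ∀ x : X, ((H * ↑U⁻¹) x, r • (H * ↑U⁻¹) x - x) ∈ A.graph := fun x => by
    have := h ((↑U⁻¹ : X →L[ℂ] X) x)
    have e : V ((↑U⁻¹ : X →L[ℂ] X) x) = x := congrArg (fun L : X →L[ℂ] X => L x) hinvV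
    rwa [e] at this
  refine hr ⟨H * ↑U⁻¹, hgr, fun x => ?_⟩
  have h1 := hA.map_mem_graph hR (A.mem_graph x)
  have h2 := IsGeneratedByNeg.graph_unique h1 (hgr x)
  rw [map_sub, h2, map_smul, sub_sub_cancel]

/-- If `V - v ∈ closure (r - A) H` with `r ∈ σ(A)`, then `|v| ≤ ‖V‖`. -/
theorem norm_le_of_sub_mem_closure_resolventIdeal (hA : S.IsGeneratedByNeg A)
    (hr : r ∈ unboundedSpectrum A) {V : X →L[ℂ] X} {v : ℂ}
    (hV : V - v • 1 ∈ (S.resolventIdeal A r).topologicalClosure) : ‖v‖ ≤ ‖V‖ := by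
  rcases eq_or_ne v 0 with rfl | hv
  · simp
  have hcl : ∀ W ∈ (S.resolventIdeal A r).topologicalClosure, 1 ≤ ‖1 - W‖ := by
    have hc : IsClosed {W : X →L[ℂ] X | 1 ≤ ‖1 - W‖} :=
      isClosed_le continuous_const (by fun_prop)
    exact fun W hW => closure_minimal
      (fun W hW => one_le_norm_one_sub_of_mem_resolventIdeal hA hr hW) hc hW
  -- The scaling is chosen so that `1 - W = v⁻¹ V` for `W = -v⁻¹ (V - v)` in the closed ideal.
  have h1 := hcl _ (Submodule.smul_mem _ (-v⁻¹) hV)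
  have e : (1 : X →L[ℂ] X) - (-v⁻¹) • (V - v • 1) = v⁻¹ • V := by
    rw [smul_sub, smul_smul, neg_mul, inv_mul_cancel₀ hv, neg_smul, neg_smul, one_smul]
    abel
  rw [e, norm_smul, norm_inv, inv_mul_eq_div, le_div_iff₀ (norm_pos_iff.2 hv), one_mul] at h1
  exact h1

end C0Semigroup

/-! ### Functions of `A` modulo the closed ideal, and integrals against densities -/

namespace C0Semigroup

namespace IsBoundedAnalytic

variable {X : Type*} [NormedAddCommGroup X] [NormedSpace ℂ X] [CompleteSpace X]
variable {S : C0Semigroup X} {A : X →ₗ.[ℂ] X} {M C : ℝ} {Q : ℝ≥0 → X →L[ℂ] X}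

lemma aestronglyMeasurable_op_toNNReal (h : S.IsBoundedAnalytic M C Q) (μ : Measure ℝ) :
    AEStronglyMeasurable (fun u : ℝ => S.op u.toNNReal) μ :=
  (h.aestronglyMeasurable_op (μ.map Real.toNNReal)).comp_measurable (by fun_prop)

lemma integrable_smul_op (h : S.IsBoundedAnalytic M C Q) {μ : Measure ℝ} {κ : ℝ → ℝ}
    (hκ : Integrable κ μ) : Integrable (fun u : ℝ => (κ u : ℂ) • S.op u.toNNReal) μ :=
  (hκ.norm.mul_const M).mono' ((Complex.measurable_ofReal.comp_aemeasurable
    hκ.aemeasurable).aestronglyMeasurable.smul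
    (h.aestronglyMeasurable_op_toNNReal μ)) (Eventually.of_forall fun u => by
      rw [norm_smul, Complex.norm_real]
      exact mul_le_mul_of_nonneg_left (h.norm_op_le _) (norm_nonneg _))

/-- Integrating `d/du (e^(ru) e^(-uA)) = (r - A) e^(ru) e^(-uA)` over `[0, s]` shows that the factor
is `H = e^(-rs) ∫₀ˢ e^(ru) e^(-uA) du`. -/
lemma op_sub_exp_mem_resolventIdeal (h : S.IsBoundedAnalytic M C Q) (hA : S.IsGeneratedByNeg A)
    (r : ℝ) (s : ℝ≥0) :
    S.op s - ((Real.exp (-(r * s)) : ℝ) : ℂ) • 1 ∈ S.resolventIdeal A (r : ℂ) := by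
  have hcomm : S.op s - ((Real.exp (-(r * s)) : ℝ) : ℂ) • 1 ∈ S.commutant :=
    sub_mem (S.op_mem_commutant s) (Submodule.smul_mem _ _ S.one_mem_commutant)
  have hsi : IntervalIntegrable (fun u : ℝ => ((Real.exp (r * u) : ℝ) : ℂ) • S.op u.toNNReal)
      volume 0 s := by
    rw [intervalIntegrable_iff]
    refine h.integrable_smul_op (κ := fun u => Real.exp (r * u)) ?_
    exact intervalIntegrable_iff.1 (Continuous.intervalIntegrable (by fun_prop) _ _)
  set G : X →L[ℂ] X := ∫ u in (0 : ℝ)..s, ((Real.exp (r * u) : ℝ) : ℂ) • S.op u.toNNReal with hG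
  have hGc : G ∈ S.commutant := by
    rw [hG, intervalIntegral.integral_of_le s.coe_nonneg]
    exact Submodule.integral_mem_of_isClosed S.isClosed_commutant
      fun u => Submodule.smul_mem _ _ (S.op_mem_commutant _)
  refine ⟨hcomm, ((Real.exp (-(r * s)) : ℝ) : ℂ) • G, Submodule.smul_mem _ _ hGc, fun x => ?_⟩
  set w : ℝ → X := fun u => ((Real.exp (r * u) : ℝ) : ℂ) • S.op u.toNNReal x with hw
  have hwc : Continuous w := by
    have h1 : Continuous fun u : ℝ => S.op u.toNNReal x :=
      (S.continuous_op x).comp continuous_real_toNNReal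
    have h2 : Continuous fun u : ℝ => ((Real.exp (r * u) : ℝ) : ℂ) := by fun_prop
    exact h2.smul h1
  have hGx : G x = ∫ u in (0 : ℝ)..s, w u := by
    rw [hG, ContinuousLinearMap.intervalIntegral_apply hsi]
    rfl
  set P : ℝ → X := fun v => ∫ u in (0 : ℝ)..v, w u with hP
  have hPd : ∀ v, HasDerivAt P (w v) v := fun v =>
    intervalIntegral.integral_hasDerivAt_right (hwc.intervalIntegrable _ _)
      hwc.stronglyMeasurable.stronglyMeasurableAtFilter hwc.continuousAt
  -- The semigroup shifts the window of integration, so applied to `G x` it is an explicit function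
  -- of `u` through a primitive `P`. Minus its derivative at `0` is `A G x`.
  have hSG : ∀ u : ℝ≥0, S.op u (G x)
      = Real.exp (-(r * u)) • (P (s + u) - P u) := by
    intro u
    have e1 : P (s + u) - P u = ∫ v in (0 : ℝ)..s, w (v + u) := by
      rw [intervalIntegral.integral_comp_add_right, zero_add, hP]
      exact (intervalIntegral.integral_interval_sub_left (hwc.intervalIntegrable _ _)
        (hwc.intervalIntegrable _ _))
    rw [e1, hGx, ← intervalIntegral.integral_smul,
      ← (S.op u).intervalIntegral_comp_comm (hwc.intervalIntegrable _ _)]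
    refine intervalIntegral.integral_congr fun v hv => ?_
    rw [uIcc_of_le s.coe_nonneg] at hv
    simp only [hw, map_smul]
    rw [Real.toNNReal_add hv.1 u.coe_nonneg, Real.toNNReal_coe, add_comm _ u, S.op_add, ← Complex.coe_smul,
      smul_smul, ← Complex.ofReal_mul, ← Real.exp_add]
    simp only [ContinuousLinearMap.comp_apply]
    congr 3
    ring
  have hφ : HasDerivAt (fun u : ℝ => Real.exp (-(r * u)) • (P (s + u) - P u))
      ((1 : ℝ) • (w s - w 0) + (-r) • P s) 0 := by
    have h1 : HasDerivAt (fun u : ℝ => Real.exp (-(r * u))) (-r) 0 := by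
      have := (((hasDerivAt_id (0 : ℝ)).const_mul r).neg).exp
      simpa using this
    have h2 : HasDerivAt (fun u : ℝ => P (s + u) - P u) (w s - w 0) 0 := by
      refine HasDerivAt.sub ?_ (hPd 0)
      have := (hPd (s + 0)).comp_const_add (s : ℝ) (0 : ℝ)
      rwa [add_zero] at this
    have := h1.smul h2
    have hP0 : P 0 = 0 := by simp [hP]
    refine this.congr_deriv ?_
    simp [hP0]
  rw [hA]
  have h3 := hasDerivAt_iff_tendsto_slope_zero.1 hφ
  have hco : Tendsto (fun h : ℝ≥0 => (h : ℝ)) (𝓝[>] 0) (𝓝[≠] 0) := by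
    refine tendsto_nhdsWithin_iff.2 ⟨?_, ?_⟩
    · simpa using (NNReal.continuous_coe.tendsto 0).mono_left nhdsWithin_le_nhds
    · filter_upwards [self_mem_nhdsWithin] with h hh
      have : (0 : ℝ) < h := by exact_mod_cast hh
      exact this.ne'
  have h4 := ((h3.comp hco).const_smul (-Real.exp (-(r * s))))
  have hlim : (-Real.exp (-(r * s))) • ((1 : ℝ) • (w s - w 0) + (-r) • P s)
      = (r : ℂ) • (((Real.exp (-(r * s)) : ℝ) : ℂ) • G) x
        - (S.op s - ((Real.exp (-(r * s)) : ℝ) : ℂ) • 1) x := by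
    have e1 : P s = G x := hGx.symm
    have e2 : Real.exp (-(r * s)) • w s = S.op s x := by
      simp only [hw]
      rw [Real.toNNReal_coe, Complex.coe_smul, smul_smul, ← Real.exp_add]
      simp
    have e3 : w 0 = x := by simp [hw, S.op_zero]
    rw [one_smul, e1, e3, smul_add, smul_sub, neg_smul, e2, smul_smul, neg_mul_neg]
    simp only [smul_apply, sub_apply, one_apply_eq_self, Complex.coe_smul]
    module
  rw [hlim] at h4
  refine h4.congr fun u => ?_
  simp only [Function.comp_apply, zero_add]
  have e0 : Real.exp (-(r * 0)) • (P (s + 0) - P 0) = G x := by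
    simp [hP, hGx]
  rw [e0, ← hSG u]
  rw [smul_apply, map_smul, ← Complex.ofReal_inv, ← Complex.coe_smul, ← Complex.coe_smul,
    Complex.ofReal_neg]
  module

lemma op_sub_exp_mem (h : S.IsBoundedAnalytic M C Q) (hA : S.IsGeneratedByNeg A)
    (r : ℝ) (s : ℝ≥0) : S.op s - ((Real.exp (-(r * s)) : ℝ) : ℂ) • 1
      ∈ (S.resolventIdeal A (r : ℂ)).topologicalClosure :=
  Submodule.le_topologicalClosure _ (h.op_sub_exp_mem_resolventIdeal hA r s)

/-- Modulo the ideal `A` acts as `r`: here `A e^(-tA) - r e^(-tA)` is `(r - A)` applied to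
`-e^(-tA)`. -/
lemma deriv_sub_mem (h : S.IsBoundedAnalytic M C Q) (hA : S.IsGeneratedByNeg A)
    (r : ℝ) {t : ℝ≥0} (ht : 0 < t) : Q t - ((r * Real.exp (-(r * t)) : ℝ) : ℂ) • 1
      ∈ (S.resolventIdeal A (r : ℂ)).topologicalClosure := by
  have h1 : Q t - (r : ℂ) • S.op t ∈ S.resolventIdeal A (r : ℂ) := by
    refine ⟨sub_mem (h.mem_commutant ht) (Submodule.smul_mem _ _ (S.op_mem_commutant t)),
      -S.op t, neg_mem (S.op_mem_commutant t), fun x => ?_⟩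
    have := neg_mem (h.mem_graph hA ht x)
    convert! this using 1
    ext
    · simp
    · simp
      abel
  have h2 := add_mem (Submodule.le_topologicalClosure _ h1)
    (Submodule.smul_mem _ (r : ℂ) (h.op_sub_exp_mem hA r t))
  convert! h2 using 1
  rw [smul_sub, smul_smul, Complex.ofReal_mul]
  abel

lemma sq_sub_mem (h : S.IsBoundedAnalytic M C Q) (hA : S.IsGeneratedByNeg A)
    (r : ℝ) {t : ℝ≥0} (ht : 0 < t) :
    Q t * Q t - ((r ^ 2 * Real.exp (-(r * (t + t : ℝ≥0))) : ℝ) : ℂ) • 1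
      ∈ (S.resolventIdeal A (r : ℂ)).topologicalClosure := by
  set q : ℂ := ((r * Real.exp (-(r * t)) : ℝ) : ℂ) with hq
  have h0 := h.deriv_sub_mem hA r ht
  have h1 := add_mem (mul_mem_closure_resolventIdeal_left hA (h.mem_commutant ht) h0)
    (Submodule.smul_mem _ q h0)
  convert! h1 using 1
  have e : ((r ^ 2 * Real.exp (-(r * (t + t : ℝ≥0))) : ℝ) : ℂ) = q * q := by
    rw [hq, ← Complex.ofReal_mul]
    congr 1
    rw [NNReal.coe_add, mul_add, neg_add, Real.exp_add]
    ring
  rw [e, mul_sub, mul_smul_comm, mul_one, smul_sub, smul_smul]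
  abel

/-- The calculus asks for a density against a finite positive measure, so `κ` is split into its sign
`κ / |κ|` (with `0 / 0 = 0`) and `|κ| du`. -/
lemma _root_.integral_map_toNNReal_withDensity_abs {κ : ℝ → ℝ} (hm : Measurable κ)
    (h0 : ∀ u ≤ 0, κ u = 0) {E : Type*} [NormedAddCommGroup E] [NormedSpace ℂ E] {f : ℝ≥0 → E}
    (hf : Continuous f) :
    ∫ s : ℝ≥0, ((κ s / |κ s| : ℝ) : ℂ) • f s
        ∂((volume.withDensity fun u => ENNReal.ofReal |κ u|).map Real.toNNReal)
      = ∫ u : ℝ, (κ u : ℂ) • f u.toNNReal := by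
  have hmeas : Measurable fun s : ℝ≥0 => ((κ s / |κ s| : ℝ) : ℂ) := by fun_prop
  have hms : StronglyMeasurable fun s : ℝ≥0 => ((κ s / |κ s| : ℝ) : ℂ) • f s :=
    hmeas.stronglyMeasurable.smul hf.stronglyMeasurable
  rw [integral_map (by fun_prop) hms.aestronglyMeasurable,
    integral_withDensity_eq_integral_toReal_smul (by fun_prop)
      (Eventually.of_forall fun _ => ENNReal.ofReal_lt_top)]
  refine integral_congr_ae (Eventually.of_forall fun u => ?_)
  simp only
  rw [ENNReal.toReal_ofReal (abs_nonneg _), ← Complex.coe_smul, smul_smul, ← Complex.ofReal_mul]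
  rcases le_total u 0 with hu | hu
  · simp [h0 u hu]
  · rw [Real.coe_toNNReal u hu]
    rcases eq_or_ne (κ u) 0 with hk | hk
    · simp [hk]
    · rw [mul_div_cancel₀ _ (abs_ne_zero.2 hk)]

/-- Integrals of the semigroup against densities are values of the Hille–Phillips calculus. -/
lemma isHPValue_integral (h : S.IsBoundedAnalytic M C Q) {κ : ℝ → ℝ} (hm : Measurable κ)
    (hκ : Integrable κ) (h0 : ∀ u ≤ 0, κ u = 0) :
    S.IsHPValue (fun z => ∫ u : ℝ, (κ u : ℂ) * Complex.exp (-((u : ℂ) * z)))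
      (∫ u : ℝ, (κ u : ℂ) • S.op u.toNNReal) := by
  set μ₀ : Measure ℝ := volume.withDensity fun u => ENNReal.ofReal |κ u| with hμ₀
  have hfin : IsFiniteMeasure μ₀ := isFiniteMeasure_withDensity_ofReal hκ.abs.2
  have hmeas : Measurable fun s : ℝ≥0 => ((κ s / |κ s| : ℝ) : ℂ) := by fun_prop
  have : IsFiniteMeasure (μ₀.map Real.toNNReal) := Measure.isFiniteMeasure_map _ _
  refine ⟨μ₀.map Real.toNNReal, fun s => ((κ s / |κ s| : ℝ) : ℂ), ⟨this, ?_, fun z _ => ?_⟩,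
    fun x => ?_⟩
  · refine (integrable_const (1 : ℝ)).mono' hmeas.aestronglyMeasurable
      (Eventually.of_forall fun s => ?_)
    rw [Complex.norm_real, Real.norm_eq_abs, abs_div, abs_abs]
    exact div_self_le_one _
  · have := integral_map_toNNReal_withDensity_abs hm h0
      (f := fun s : ℝ≥0 => Complex.exp (-(((s : ℝ) : ℂ) * z))) (by fun_prop)
    simp only [smul_eq_mul] at this
    rw [this]
    refine integral_congr_ae (Eventually.of_forall fun u => ?_)
    simp only
    rcases le_total u 0 with hu | hu
    · simp [h0 u hu]
    · rw [Real.coe_toNNReal u hu]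
  · rw [ContinuousLinearMap.integral_apply (h.integrable_smul_op hκ)]
    exact (integral_map_toNNReal_withDensity_abs hm h0 (S.continuous_op x)).symm

end IsBoundedAnalytic

end C0Semigroup

/-! ### The kernels of fractional integration -/

/-- The function `u ↦ u^{α-1}` on `(0,∞)`, extended by zero. -/
noncomputable def powKernel (α : ℝ) : ℝ → ℝ := (Ioi 0).indicator fun u => u ^ (α - 1)

/-- The difference of `powKernel α` and its translate by `s`. -/
noncomputable def diffKernel (α s u : ℝ) : ℝ := powKernel α u - powKernel α (u - s)

section Kernel

variable {α s u : ℝ}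

lemma powKernel_of_pos (hu : 0 < u) : powKernel α u = u ^ (α - 1) := indicator_of_mem hu _

lemma powKernel_of_nonpos (hu : u ≤ 0) : powKernel α u = 0 :=
  indicator_of_notMem (not_lt.2 hu) _

lemma powKernel_nonneg (α u : ℝ) : 0 ≤ powKernel α u :=
  indicator_nonneg (fun _ hu => Real.rpow_nonneg (le_of_lt hu) _) _

lemma measurable_powKernel (α : ℝ) : Measurable (powKernel α) :=
  (by fun_prop : Measurable fun u : ℝ => u ^ (α - 1)).indicator measurableSet_Ioi

lemma measurable_diffKernel (α s : ℝ) : Measurable (diffKernel α s) :=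
  (measurable_powKernel α).sub ((measurable_powKernel α).comp (measurable_id.sub_const s))

lemma diffKernel_of_nonpos (hs : 0 ≤ s) (hu : u ≤ 0) : diffKernel α s u = 0 := by
  rw [diffKernel, powKernel_of_nonpos hu, powKernel_of_nonpos (by linarith), sub_zero]

lemma diffKernel_add (α s t u : ℝ) :
    diffKernel α (s + t) u = diffKernel α s u + diffKernel α t (u - s) := by
  rw [diffKernel, diffKernel, diffKernel, sub_sub]
  ring

lemma intervalIntegrable_powKernel (hα : 0 < α) (a b : ℝ) :
    IntervalIntegrable (powKernel α) volume a b := by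
  rw [intervalIntegrable_iff]
  exact ((intervalIntegrable_iff.1 (intervalIntegral.intervalIntegrable_rpow'
    (by linarith : -1 < α - 1))).indicator measurableSet_Ioi)

lemma intervalIntegral_powKernel (hα : 0 < α) {a b : ℝ} (ha : a ≤ 0) (hb : 0 ≤ b) :
    ∫ u in a..b, powKernel α u = b ^ α / α := by
  rw [intervalIntegral.integral_of_le (ha.trans hb), setIntegral_eq_of_subset_of_forall_sdiff_eq_zero
    (s := Ioc 0 b) measurableSet_Ioc (Ioc_subset_Ioc_left ha) fun u hu => ?_,
    setIntegral_congr_fun measurableSet_Ioc fun u hu => powKernel_of_pos hu.1,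
    ← intervalIntegral.integral_of_le hb, integral_rpow (Or.inl (by linarith)), sub_add_cancel,
    Real.zero_rpow hα.ne', sub_zero]
  exact powKernel_of_nonpos (not_lt.1 fun h => hu.2 ⟨h, hu.1.2⟩)

lemma powKernel_anti (hα1 : α ≤ 1) (hs : 0 ≤ s) (hu : s < u) :
    powKernel α u ≤ powKernel α (u - s) := by
  rw [powKernel_of_pos (hs.trans_lt hu), powKernel_of_pos (sub_pos.2 hu)]
  exact Real.rpow_le_rpow_of_nonpos (sub_pos.2 hu) (by linarith) (by linarith)

/-- The kernel is nonnegative up to `s` and nonpositive afterwards, since `α - 1 ≤ 0`. Written this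
way its integral over `[0, R]` telescopes to at most `2 s^α / α` uniformly in `R`, although
`powKernel α` itself is not integrable. -/
lemma abs_diffKernel (hα1 : α ≤ 1) (hs : 0 ≤ s) (u : ℝ) : |diffKernel α s u|
    = powKernel α (u - s) - powKernel α u + 2 * (Iic s).indicator (powKernel α) u := by
  rcases le_or_gt u s with hu | hu
  · rw [indicator_of_mem (show u ∈ Iic s from hu), diffKernel,
      powKernel_of_nonpos (by linarith : u - s ≤ 0), sub_zero, abs_of_nonneg (powKernel_nonneg _ _)]
    ring
  · rw [indicator_of_notMem (show u ∉ Iic s from not_le.2 hu), diffKernel, abs_sub_comm,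
      abs_of_nonneg (sub_nonneg.2 (powKernel_anti hα1 hs hu))]
    ring

lemma intervalIntegral_abs_diffKernel (hα : 0 < α) (hα1 : α ≤ 1) (hs : 0 ≤ s) {R : ℝ} (hR : s ≤ R) :
    IntervalIntegrable (diffKernel α s) volume 0 R ∧
      ∫ u in (0 : ℝ)..R, |diffKernel α s u| ≤ 2 * s ^ α / α := by
  have h1 := intervalIntegrable_powKernel hα 0 R
  have h2 : IntervalIntegrable (fun u => powKernel α (u - s)) volume 0 R := by
    have := (intervalIntegrable_powKernel hα (0 - s) (R - s)).comp_sub_right s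
    simpa using this
  have h3 : IntervalIntegrable ((Iic s).indicator (powKernel α)) volume 0 R := by
    rw [intervalIntegrable_iff] at h1 ⊢
    exact h1.indicator measurableSet_Iic
  refine ⟨h1.sub h2, ?_⟩
  have e3 : ∫ u in (0 : ℝ)..R, (Iic s).indicator (powKernel α) u = s ^ α / α := by
    have := intervalIntegral.integral_indicator (f := powKernel α) (μ := volume) ⟨hs, hR⟩
    rw [show Iic s = {x | x ≤ s} from rfl, this, intervalIntegral_powKernel hα le_rfl hs]
  have e2 : ∫ u in (0 : ℝ)..R, powKernel α (u - s) = (R - s) ^ α / α := by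
    rw [intervalIntegral.integral_comp_sub_right,
      intervalIntegral_powKernel hα (by linarith) (by linarith)]
  simp only [abs_diffKernel hα1 hs]
  rw [intervalIntegral.integral_add (h2.sub h1) (h3.const_mul 2),
    intervalIntegral.integral_sub h2 h1, intervalIntegral.integral_const_mul, e2, e3,
    intervalIntegral_powKernel hα le_rfl (hs.trans hR)]
  have : (R - s) ^ α / α ≤ R ^ α / α := by
    have := Real.rpow_le_rpow (by linarith : 0 ≤ R - s) (by linarith : R - s ≤ R) hα.le
    gcongr
  rw [mul_div_assoc]
  linarith

lemma integrable_diffKernel (hα : 0 < α) (hα1 : α ≤ 1) (hs : 0 ≤ s) :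
    Integrable (diffKernel α s) := by
  have h1 : IntegrableOn (diffKernel α s) (Ioi 0) := by
    refine integrableOn_Ioi_of_intervalIntegral_norm_bounded (l := atTop)
      (b := fun R : ℝ => max s R) (2 * s ^ α / α) 0 (fun R => ?_)
      (tendsto_atTop_mono (fun R => le_max_right s R) tendsto_id) (Eventually.of_forall fun R => ?_)
    · exact (intervalIntegrable_iff_integrableOn_Ioc_of_le (hs.trans (le_max_left _ _))).1
        (intervalIntegral_abs_diffKernel hα hα1 hs (le_max_left _ _)).1
    · exact (intervalIntegral_abs_diffKernel hα hα1 hs (le_max_left _ _)).2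
  refine (integrableOn_iff_integrable_of_support_subset fun u hu => ?_).1 h1
  by_contra h
  exact hu (diffKernel_of_nonpos hs (not_lt.1 h))

lemma integral_abs_diffKernel_le (hα : 0 < α) (hα1 : α ≤ 1) (hs : 0 ≤ s) :
    ∫ u, |diffKernel α s u| ≤ 2 * s ^ α / α := by
  have h0 := (integrable_diffKernel hα hα1 hs).abs
  rw [← setIntegral_eq_integral_of_forall_compl_eq_zero (s := Ioi 0) fun u hu => by
    rw [diffKernel_of_nonpos hs (not_lt.1 hu), abs_zero]]
  refine le_of_tendsto (intervalIntegral_tendsto_integral_Ioi 0 h0.integrableOn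
    (tendsto_id (α := ℝ))) ?_
  filter_upwards [eventually_ge_atTop s] with R hR
  exact (intervalIntegral_abs_diffKernel hα hα1 hs hR).2

lemma integral_powKernel_mul_exp (hα : 0 < α) {r : ℝ} (hr : 0 < r) :
    Integrable (fun u => powKernel α u * Real.exp (-(r * u))) ∧
      ∫ u, powKernel α u * Real.exp (-(r * u)) = Real.Gamma α * r ^ (-α) := by
  have e : (fun u => powKernel α u * Real.exp (-(r * u)))
      = (Ioi 0).indicator fun u => u ^ (α - 1) * Real.exp (-(r * u)) := by
    ext u
    rw [indicator_mul_left, powKernel]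
  have e2 : ∫ u, powKernel α u * Real.exp (-(r * u)) = Real.Gamma α * r ^ (-α) := by
    rw [e, integral_indicator measurableSet_Ioi, Real.integral_rpow_mul_exp_neg_mul_Ioi hα hr,
      one_div, Real.inv_rpow hr.le, Real.rpow_neg hr.le, mul_comm]
  refine ⟨not_imp_comm.1 integral_undef ?_, e2⟩
  rw [e2]
  have := Real.Gamma_pos_of_pos hα
  positivity

lemma integrable_powKernel_mul_cexp (hα : 0 < α) {z : ℂ} (hz : 0 < z.re) :
    Integrable fun u : ℝ => (powKernel α u : ℂ) * Complex.exp (-((u : ℂ) * z)) := by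
  refine (integral_powKernel_mul_exp hα hz).1.mono' ?_ (Eventually.of_forall fun u => ?_)
  · exact ((Complex.measurable_ofReal.comp (measurable_powKernel α)).mul
      (by fun_prop)).aestronglyMeasurable
  · rw [norm_mul, Complex.norm_real, Real.norm_of_nonneg (powKernel_nonneg _ _), Complex.norm_exp]
    simp [mul_comm]

lemma differentiableOn_integral_powKernel_mul_cexp (hα : 0 < α) :
    DifferentiableOn ℂ (fun z : ℂ => ∫ u : ℝ, (powKernel α u : ℂ) * Complex.exp (-((u : ℂ) * z)))
      {z | 0 < z.re} := by
  set μ : Measure ℝ := volume.withDensity fun u => ENNReal.ofReal (powKernel α u) with hμ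
  have hm := measurable_powKernel α
  have h1 : Ioi (0 : ℝ) ⊆ interior (ProbabilityTheory.integrableExpSet (fun u : ℝ => -u) μ) := by
    refine interior_maximal (fun r hr => ?_) isOpen_Ioi
    rw [ProbabilityTheory.integrableExpSet, mem_ofPred_eq, hμ,
      integrable_withDensity_iff_integrable_smul' (by fun_prop)
        (Eventually.of_forall fun _ => ENNReal.ofReal_lt_top)]
    refine (integral_powKernel_mul_exp hα hr).1.congr (Eventually.of_forall fun u => ?_)
    simp only
    rw [ENNReal.toReal_ofReal (powKernel_nonneg _ _), smul_eq_mul, mul_neg]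
  refine (ProbabilityTheory.differentiableOn_complexMGF.mono fun z hz => h1 hz).congr fun z hz => ?_
  rw [ProbabilityTheory.complexMGF, hμ, integral_withDensity_eq_integral_toReal_smul (by fun_prop)
      (Eventually.of_forall fun _ => ENNReal.ofReal_lt_top)]
  refine integral_congr_ae (Eventually.of_forall fun u => ?_)
  simp only
  rw [ENNReal.toReal_ofReal (powKernel_nonneg _ _), Complex.real_smul]
  congr 2
  push_cast
  ring

/-- Both sides are holomorphic on the half-plane and agree on the positive axis by the Gamma
integral; points of the axis accumulating at `1` suffice for the identity theorem. -/
lemma integral_powKernel_mul_cexp (hα : 0 < α) {z : ℂ} (hz : 0 < z.re) :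
    ∫ u : ℝ, (powKernel α u : ℂ) * Complex.exp (-((u : ℂ) * z))
      = Real.Gamma α * z ^ ((-α : ℝ) : ℂ) := by
  have hopen : IsOpen {z : ℂ | 0 < z.re} := isOpen_lt continuous_const Complex.continuous_re
  have hconn : IsPreconnected {z : ℂ | 0 < z.re} := (convex_halfSpace_re_gt 0).isPreconnected
  have h1 := (differentiableOn_integral_powKernel_mul_cexp hα).analyticOnNhd hopen
  have h2 : AnalyticOnNhd ℂ (fun z : ℂ => (Real.Gamma α : ℂ) * z ^ ((-α : ℝ) : ℂ)) {z | 0 < z.re} := by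
    refine DifferentiableOn.analyticOnNhd (fun z hz => ?_) hopen
    exact ((DifferentiableAt.cpow_const differentiableAt_id (Or.inl hz)).const_mul
      _).differentiableWithinAt
  refine h1.eqOn_of_preconnected_of_frequently_eq h2 hconn (z₀ := 1) (by simp) ?_ hz
  have hseq : Tendsto (fun n : ℕ => ((1 + 1 / ((n : ℝ) + 1) : ℝ) : ℂ)) atTop (𝓝[≠] 1) := by
    refine tendsto_nhdsWithin_iff.2 ⟨?_, Eventually.of_forall fun n => ?_⟩
    · have := (Complex.continuous_ofReal.tendsto _).comp
        ((tendsto_one_div_add_atTop_nhds_zero_nat (𝕜 := ℝ)).const_add 1)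
      simpa [Function.comp_def] using this
    · have h3 : (0 : ℝ) < 1 / ((n : ℝ) + 1) := by positivity
      intro h
      have : (1 + 1 / ((n : ℝ) + 1) : ℝ) = 1 := Complex.ofReal_eq_one.1 h
      linarith
  refine hseq.frequently (Eventually.of_forall fun n => ?_).frequently
  have hr : (0 : ℝ) < 1 + 1 / ((n : ℝ) + 1) := by positivity
  set r : ℝ := 1 + 1 / ((n : ℝ) + 1)
  rw [← Complex.ofReal_cpow hr.le, ← Complex.ofReal_mul, ← (integral_powKernel_mul_exp hα hr).2,
    ← integral_complex_ofReal]
  refine integral_congr_ae (Eventually.of_forall fun u => ?_)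
  simp only
  push_cast
  rw [mul_comm (r : ℂ)]

/-- The Laplace transform of `diffKernel α s`. -/
lemma integral_diffKernel_mul_cexp (hα : 0 < α) {z : ℂ} (hz : 0 < z.re) (s : ℝ) :
    ∫ u : ℝ, (diffKernel α s u : ℂ) * Complex.exp (-((u : ℂ) * z))
      = (1 - Complex.exp (-((s : ℂ) * z))) * (Real.Gamma α * z ^ ((-α : ℝ) : ℂ)) := by
  have h1 := integrable_powKernel_mul_cexp hα hz
  have h2 := (h1.comp_sub_right s).mul_const (Complex.exp (-((s : ℂ) * z)))
  have e : ∀ u : ℝ, (diffKernel α s u : ℂ) * Complex.exp (-((u : ℂ) * z))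
      = (powKernel α u : ℂ) * Complex.exp (-((u : ℂ) * z))
        - (powKernel α (u - s) : ℂ) * Complex.exp (-(((u - s : ℝ) : ℂ) * z))
          * Complex.exp (-((s : ℂ) * z)) := by
    intro u
    rw [mul_assoc, ← Complex.exp_add, diffKernel]
    push_cast
    rw [show -(((u : ℂ) - s) * z) + -(s * z) = -(u * z) by ring]
    ring
  simp only [e]
  rw [integral_sub h1 h2, integral_mul_const,
    integral_sub_right_eq_self (fun u : ℝ => (powKernel α u : ℂ) * Complex.exp (-((u : ℂ) * z))) s,
    integral_powKernel_mul_cexp hα hz]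
  ring

end Kernel

/-! ### The operators `(1 - e^{-sA}) A^{-α}` -/

namespace C0Semigroup

variable {X : Type*} [NormedAddCommGroup X] [NormedSpace ℂ X] [CompleteSpace X]
variable {S : C0Semigroup X} {A : X →ₗ.[ℂ] X} {M C α : ℝ} {Q : ℝ≥0 → X →L[ℂ] X}

/-- The operators `W s` share the properties of `(1 - e^{-sA}) A^{-α}`. -/
structure IsFracDiff (S : C0Semigroup X) (A : X →ₗ.[ℂ] X) (α : ℝ) (Q : ℝ≥0 → X →L[ℂ] X)
    (W : ℝ≥0 → X →L[ℂ] X) : Prop where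
  isHPValue : S.IsHPValue (fun z => (1 - Complex.exp (-z)) * z ^ ((-α : ℝ) : ℂ)) (W 1)
  one_sub_mul : ∀ s, (1 - S.op 1) * W s = (1 - S.op s) * W 1
  mem_commutant : ∀ s, W s ∈ S.commutant
  aestronglyMeasurable : ∀ μ : Measure ℝ≥0, AEStronglyMeasurable W μ
  norm_le : ∃ c : ℝ, ∀ s, ‖W s‖ ≤ c * (1 + s)
  sub_mem : ∀ r : ℝ, 0 < r → W 1 - (((1 - Real.exp (-r)) * r ^ (-α) : ℝ) : ℂ) • 1
    ∈ (S.resolventIdeal A (r : ℂ)).topologicalClosure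
  exists_mul_sq : ∀ t : ℝ≥0, 0 < t →
    ∃ B ∈ S.commutant, W 1 * (Q t * Q t) = (1 - S.op 1) * B

lemma IsHPValue.congr {F F' : ℂ → ℂ} {T : X →L[ℂ] X} (h : S.IsHPValue F T)
    (hF : ∀ z : ℂ, 0 < z.re → F' z = F z) : S.IsHPValue F' T := by
  obtain ⟨μ, k, ⟨h1, h2, h3⟩, h4⟩ := h
  exact ⟨μ, k, ⟨h1, h2, fun z hz => (hF z hz).trans (h3 z hz)⟩, h4⟩

/-- The density of `(1 - e^{-sA}) A^{-α}` with respect to the semigroup. -/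
noncomputable def fracKernel (α s u : ℝ) : ℝ := (Real.Gamma α)⁻¹ * diffKernel α s u

/-- The operator `(1 - e^{-sA}) A^{-α}` for `0 < α ≤ 1`, as an integral of the semigroup. -/
noncomputable def fracDiff (S : C0Semigroup X) (α : ℝ) (s : ℝ≥0) : X →L[ℂ] X :=
  ∫ u : ℝ, (fracKernel α s u : ℂ) • S.op u.toNNReal

lemma integrable_fracKernel (h0 : 0 < α) (h1 : α ≤ 1) (s : ℝ≥0) : Integrable (fracKernel α s) :=
  (integrable_diffKernel h0 h1 s.coe_nonneg).const_mul _

lemma fracKernel_of_nonpos (s : ℝ≥0) {u : ℝ} (hu : u ≤ 0) : fracKernel α s u = 0 := by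
  rw [fracKernel, diffKernel_of_nonpos s.coe_nonneg hu, mul_zero]

lemma integral_fracKernel_mul_cexp (h0 : 0 < α) (s : ℝ≥0) {z : ℂ} (hz : 0 < z.re) :
    ∫ u : ℝ, (fracKernel α s u : ℂ) * Complex.exp (-((u : ℂ) * z))
      = (1 - Complex.exp (-(((s : ℝ) : ℂ) * z))) * z ^ ((-α : ℝ) : ℂ) := by
  have hΓ : (Real.Gamma α : ℂ) ≠ 0 := Complex.ofReal_ne_zero.2 (Real.Gamma_pos_of_pos h0).ne'
  simp only [fracKernel, Complex.ofReal_mul, Complex.ofReal_inv, mul_assoc]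
  rw [integral_const_mul, integral_diffKernel_mul_cexp h0 hz]
  field_simp

namespace IsBoundedAnalytic

lemma norm_fracDiff_le (h : S.IsBoundedAnalytic M C Q) (h0 : 0 < α) (h1 : α ≤ 1) (s : ℝ≥0) :
    ‖S.fracDiff α s‖ ≤ M * ((Real.Gamma α)⁻¹ * (2 * (s : ℝ) ^ α / α)) := by
  have hΓ := Real.Gamma_pos_of_pos h0
  have hM : 0 ≤ M := (norm_nonneg _).trans (h.norm_op_le 0)
  calc ‖S.fracDiff α s‖ ≤ ∫ u, M * |fracKernel α s u| := by
        refine norm_integral_le_of_norm_le ((integrable_fracKernel h0 h1 s).abs.const_mul M)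
          (Eventually.of_forall fun u => ?_)
        rw [norm_smul, Complex.norm_real, mul_comm, Real.norm_eq_abs]
        exact mul_le_mul_of_nonneg_right (h.norm_op_le _) (abs_nonneg _)
    _ = M * ((Real.Gamma α)⁻¹ * ∫ u, |diffKernel α s u|) := by
        simp only [fracKernel, abs_mul, abs_of_pos (inv_pos.2 hΓ)]
        rw [integral_const_mul, integral_const_mul]
    _ ≤ _ := by
        gcongr
        exact integral_abs_diffKernel_le h0 h1 s.coe_nonneg

/-- The operator form of `1 - e^(-(s+t)z) = (1 - e^(-sz)) + e^(-sz) (1 - e^(-tz))`. It yields norm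
continuity in `s`, and computing `W (s + 1)` in two ways yields `(1 - e^(-A)) W s = (1 - e^(-sA)) W
1`. -/
lemma fracDiff_add (h : S.IsBoundedAnalytic M C Q) (h0 : 0 < α) (h1 : α ≤ 1) (s t : ℝ≥0) :
    S.fracDiff α (s + t) = S.fracDiff α s + S.op s * S.fracDiff α t := by
  have hi := h.integrable_smul_op (integrable_fracKernel h0 h1 t)
  have e : ∀ u : ℝ, S.op s * ((fracKernel α t u : ℂ) • S.op u.toNNReal)
      = (fracKernel α t ((u + s) - s) : ℂ) • S.op (u + s).toNNReal := by
    intro u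
    rw [add_sub_cancel_right]
    rcases le_or_gt u 0 with hu | hu
    · rw [fracKernel_of_nonpos t hu]; simp
    · rw [Real.toNNReal_add hu.le s.coe_nonneg, Real.toNNReal_coe, add_comm, S.op_add_eq_mul,
        mul_smul_comm]
  have e1 : S.op s * S.fracDiff α t
      = ∫ u : ℝ, (fracKernel α t (u - s) : ℂ) • S.op u.toNNReal := by
    rw [fracDiff, ← integral_const_mul_of_integrable hi]
    simp only [e]
    exact integral_add_right_eq_self
      (fun u : ℝ => (fracKernel α t (u - s) : ℂ) • S.op u.toNNReal) (s : ℝ)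
  have hi2 : Integrable fun u : ℝ => (fracKernel α t (u - s) : ℂ) • S.op u.toNNReal :=
    h.integrable_smul_op ((integrable_fracKernel h0 h1 t).comp_sub_right (s : ℝ))
  rw [e1, fracDiff, fracDiff, ← integral_add (h.integrable_smul_op (integrable_fracKernel h0 h1 s)) hi2]
  refine integral_congr_ae (Eventually.of_forall fun u => ?_)
  simp only
  rw [← add_smul, ← Complex.ofReal_add, fracKernel, fracKernel, fracKernel, NNReal.coe_add,
    diffKernel_add, mul_add]

lemma fracDiff_mem_commutant (S : C0Semigroup X) (α : ℝ) (s : ℝ≥0) :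
    S.fracDiff α s ∈ S.commutant :=
  Submodule.integral_mem_of_isClosed S.isClosed_commutant
    fun _ => Submodule.smul_mem _ _ (S.op_mem_commutant _)

lemma continuous_fracDiff (h : S.IsBoundedAnalytic M C Q) (h0 : 0 < α) (h1 : α ≤ 1) :
    Continuous (S.fracDiff α) := by
  have hM : 0 ≤ M := (norm_nonneg _).trans (h.norm_op_le 0)
  set c : ℝ := M * (M * ((Real.Gamma α)⁻¹ * (2 / α)))
  have key : ∀ s t : ℝ≥0, s ≤ t →
      ‖S.fracDiff α t - S.fracDiff α s‖ ≤ c * |(t : ℝ) - s| ^ α := by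
    intro s t hst
    obtain ⟨d, rfl⟩ := exists_add_of_le hst
    rw [h.fracDiff_add h0 h1, add_sub_cancel_left, NNReal.coe_add, add_sub_cancel_left,
      abs_of_nonneg d.coe_nonneg]
    refine (norm_mul_le _ _).trans ((mul_le_mul (h.norm_op_le s) (h.norm_fracDiff_le h0 h1 d)
      (norm_nonneg _) hM).trans_eq ?_)
    simp only [c]
    ring
  refine continuous_iff_continuousAt.2 fun s => ?_
  rw [ContinuousAt, tendsto_iff_norm_sub_tendsto_zero]
  have hlim : Tendsto (fun t : ℝ≥0 => c * |(t : ℝ) - s| ^ α) (𝓝 s) (𝓝 0) := by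
    have : Continuous fun t : ℝ≥0 => c * |(t : ℝ) - s| ^ α :=
      continuous_const.mul ((by fun_prop : Continuous fun t : ℝ≥0 => |(t : ℝ) - s|).rpow_const
        fun _ => Or.inr h0.le)
    simpa [Real.zero_rpow h0.ne'] using this.tendsto s
  refine squeeze_zero (fun _ => norm_nonneg _) (fun t => ?_) hlim
  rcases le_total s t with hst | hst
  · exact key s t hst
  · rw [norm_sub_rev, abs_sub_comm]
    exact key t s hst

/-- The memberships of `e^(-uA) - e^(-ru)` are integrated against the kernel; the scalar part
integrates to its Laplace transform at `r`. -/
lemma fracDiff_one_sub_mem (h : S.IsBoundedAnalytic M C Q) (hA : S.IsGeneratedByNeg A)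
    (h0 : 0 < α) (h1 : α ≤ 1) {r : ℝ} (hr : 0 < r) :
    S.fracDiff α 1 - (((1 - Real.exp (-r)) * r ^ (-α) : ℝ) : ℂ) • 1
      ∈ (S.resolventIdeal A (r : ℂ)).topologicalClosure := by
  have hi := h.integrable_smul_op (integrable_fracKernel h0 h1 1)
  have hexp : ∀ u : ℝ, (fracKernel α (1 : ℝ≥0) u : ℂ)
      * ((Real.exp (-(r * (u.toNNReal : ℝ))) : ℝ) : ℂ)
      = (fracKernel α (1 : ℝ≥0) u : ℂ) * Complex.exp (-((u : ℂ) * (r : ℂ))) := by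
    intro u
    rcases le_or_gt u 0 with hu | hu
    · rw [fracKernel_of_nonpos 1 hu]; simp
    · rw [Real.coe_toNNReal u hu.le, mul_comm r]
      push_cast
      rfl
  have hi2 : Integrable fun u : ℝ => (fracKernel α (1 : ℝ≥0) u : ℂ)
      * ((Real.exp (-(r * (u.toNNReal : ℝ))) : ℝ) : ℂ) := by
    refine (integrable_fracKernel h0 h1 1).abs.mono' ?_ (Eventually.of_forall fun u => ?_)
    · exact (Complex.measurable_ofReal.comp_aemeasurable
        (integrable_fracKernel h0 h1 1).aemeasurable).aestronglyMeasurable.mul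
        (by fun_prop : Continuous fun u : ℝ =>
          ((Real.exp (-(r * (u.toNNReal : ℝ))) : ℝ) : ℂ)).aestronglyMeasurable
    · rw [norm_mul, Complex.norm_real, Complex.norm_real, Real.norm_eq_abs]
      refine mul_le_of_le_one_right (abs_nonneg _) ?_
      rw [Real.norm_of_nonneg (Real.exp_nonneg _), Real.exp_le_one_iff, neg_nonpos]
      positivity
  have e1 : (((1 - Real.exp (-r)) * r ^ (-α) : ℝ) : ℂ)
      = ∫ u : ℝ, (fracKernel α (1 : ℝ≥0) u : ℂ)
      * ((Real.exp (-(r * (u.toNNReal : ℝ))) : ℝ) : ℂ) := by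
    simp only [hexp]
    rw [integral_fracKernel_mul_cexp h0 1 (by simpa using hr), ← Complex.ofReal_cpow hr.le]
    push_cast
    rw [one_mul]
  have e2 : (∫ u : ℝ, (fracKernel α (1 : ℝ≥0) u : ℂ)
      * ((Real.exp (-(r * (u.toNNReal : ℝ))) : ℝ) : ℂ)) • (1 : X →L[ℂ] X)
      = ∫ u : ℝ, ((fracKernel α (1 : ℝ≥0) u : ℂ)
      * ((Real.exp (-(r * (u.toNNReal : ℝ))) : ℝ) : ℂ)) • (1 : X →L[ℂ] X) :=
    (integral_smul_const (𝕜 := ℂ) (E := X →L[ℂ] X) _ 1).symm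
  rw [e1, fracDiff, e2, ← integral_sub hi (hi2.smul_const _)]
  refine Submodule.integral_mem_of_isClosed (Submodule.isClosed_topologicalClosure _) fun u => ?_
  rw [mul_smul, ← smul_sub]
  exact Submodule.smul_mem _ _ (h.op_sub_exp_mem hA r _)

/-- Half of the time `u` goes to each factor: `e^(-uA) (Q t)² = (Q (u/2 + t))²`, of norm `O(u⁻²)` at
infinity and bounded near `0`. This beats `u^(α-1)` for `0 < α ≤ 1`. -/
lemma integrable_powKernel_smul_op_mul_sq (h : S.IsBoundedAnalytic M C Q) (h0 : 0 < α)
    (h1 : α ≤ 1) {t : ℝ≥0} (ht : 0 < t) :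
    Integrable fun u : ℝ => (powKernel α u : ℂ) • (S.op u.toNNReal * (Q t * Q t)) := by
  have hb : ∀ u : ℝ, ‖S.op u.toNNReal * (Q t * Q t)‖ ≤ (C / (u.toNNReal / 2 + t)) ^ 2 := by
    intro u
    have e : S.op u.toNNReal * (Q t * Q t)
        = Q (u.toNNReal / 2 + t) * Q (u.toNNReal / 2 + t) := by
      rw [← h.op_mul _ ht, ← add_halves u.toNNReal, S.op_add_eq_mul, add_halves]
      have : Commute (S.op (u.toNNReal / 2)) (Q t) := h.mem_commutant ht (u.toNNReal / 2)
      exact this.mul_mul_mul_comm _ _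
    have hp : 0 < u.toNNReal / 2 + t := by positivity
    have := h.norm_le _ hp
    push_cast at this
    rw [e, sq]
    exact (norm_mul_le _ _).trans (mul_le_mul this this (norm_nonneg _)
      ((norm_nonneg _).trans this))
  have hd : Integrable fun u : ℝ => (C / t) ^ 2 * (Ioc (0 : ℝ) 1).indicator (powKernel α) u
      + (2 * C) ^ 2 * (Ioi (1 : ℝ)).indicator (fun u => u ^ (-2 : ℝ)) u := by
    refine Integrable.add (Integrable.const_mul ?_ _) (Integrable.const_mul ?_ _)
    · rw [integrable_indicator_iff measurableSet_Ioc]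
      exact (intervalIntegrable_iff_integrableOn_Ioc_of_le zero_le_one).1
        (intervalIntegrable_powKernel h0 0 1)
    · rw [integrable_indicator_iff measurableSet_Ioi]
      exact integrableOn_Ioi_rpow_of_lt (by norm_num) one_pos
  refine hd.mono' ?_ (Eventually.of_forall fun u => ?_)
  · exact (Complex.measurable_ofReal.comp (measurable_powKernel α)).aestronglyMeasurable.smul
      ((h.aestronglyMeasurable_op_toNNReal _).mul_const _)
  · have htp : (0 : ℝ) < t := ht
    rw [norm_smul, Complex.norm_real, Real.norm_of_nonneg (powKernel_nonneg _ _)]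
    refine (mul_le_mul_of_nonneg_left (hb u) (powKernel_nonneg _ _)).trans ?_
    rcases le_or_gt u 0 with hu | hu
    · rw [powKernel_of_nonpos hu, indicator_of_notMem (fun h => absurd h.1 (not_lt.2 hu)),
        indicator_of_notMem (show u ∉ Ioi (1 : ℝ) from not_lt.2 (hu.trans zero_le_one))]
      simp
    rw [Real.coe_toNNReal u hu.le, div_pow, div_pow]
    rcases le_or_gt u 1 with hu1 | hu1
    · rw [indicator_of_mem (show u ∈ Ioc (0 : ℝ) 1 from ⟨hu, hu1⟩),
        indicator_of_notMem (show u ∉ Ioi (1 : ℝ) from not_lt.2 hu1), mul_zero, add_zero, mul_comm]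
      refine mul_le_mul_of_nonneg_right ?_ (powKernel_nonneg _ _)
      gcongr
      linarith
    · rw [indicator_of_notMem (fun h => absurd h.2 (not_le.2 hu1)),
        indicator_of_mem (show u ∈ Ioi (1 : ℝ) from hu1), mul_zero, zero_add,
        Real.rpow_neg hu.le, powKernel_of_pos hu]
      have hp1 : u ^ (α - 1) ≤ 1 := Real.rpow_le_one_of_one_le_of_nonpos hu1.le (by linarith)
      calc u ^ (α - 1) * (C ^ 2 / (u / 2 + t) ^ 2) ≤ 1 * (C ^ 2 / (u / 2) ^ 2) := by
            gcongr
            linarith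
        _ = (2 * C) ^ 2 * (u ^ (2 : ℝ))⁻¹ := by
            rw [Real.rpow_two]
            field_simp

/-- The witness is `A^(-α) A² e^(-2tA) = Γ(α)⁻¹ ∫ u^(α-1) e^(-uA) A² e^(-2tA) du`. Here the
undifferenced kernel converges, and multiplying by `1 - e^(-A)` turns it into the difference kernel.
-/
lemma exists_fracDiff_mul_sq (h : S.IsBoundedAnalytic M C Q) (h0 : 0 < α)
    (h1 : α ≤ 1) {t : ℝ≥0} (ht : 0 < t) :
    ∃ B ∈ S.commutant, S.fracDiff α 1 * (Q t * Q t) = (1 - S.op 1) * B := by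
  set D := Q t * Q t with hD
  have hDc : D ∈ S.commutant := mul_mem_commutant (h.mem_commutant ht) (h.mem_commutant ht)
  have hi := h.integrable_powKernel_smul_op_mul_sq h0 h1 ht
  set J : X →L[ℂ] X := ∫ u : ℝ, (powKernel α u : ℂ) • (S.op u.toNNReal * D) with hJ
  refine ⟨((Real.Gamma α)⁻¹ : ℂ) • J, Submodule.smul_mem _ _
    (Submodule.integral_mem_of_isClosed S.isClosed_commutant fun u => Submodule.smul_mem _ _
      (mul_mem_commutant (S.op_mem_commutant _) hDc)), ?_⟩
  have e : ∀ u : ℝ, S.op 1 * ((powKernel α u : ℂ) • (S.op u.toNNReal * D))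
      = (powKernel α ((u + 1) - 1) : ℂ) • (S.op (u + 1).toNNReal * D) := by
    intro u
    rw [add_sub_cancel_right]
    rcases le_or_gt u 0 with hu | hu
    · rw [powKernel_of_nonpos hu]; simp
    · rw [Real.toNNReal_add hu.le zero_le_one, Real.toNNReal_one, add_comm, S.op_add_eq_mul,
        mul_smul_comm, mul_assoc]
  have hi2 : Integrable fun u : ℝ => (powKernel α (u - 1) : ℂ) • (S.op u.toNNReal * D) := by
    have := hi.const_mul (S.op 1)
    rw [funext e] at this
    simpa using this.comp_sub_right 1
  have e1 : S.op 1 * J = ∫ u : ℝ, (powKernel α (u - 1) : ℂ) • (S.op u.toNNReal * D) := by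
    rw [hJ, ← integral_const_mul_of_integrable hi, funext e]
    exact integral_add_right_eq_self
      (fun u : ℝ => (powKernel α (u - 1) : ℂ) • (S.op u.toNNReal * D)) (1 : ℝ)
  have hik := h.integrable_smul_op (integrable_fracKernel h0 h1 1)
  rw [mul_smul_comm, sub_mul, one_mul, e1, hJ, ← integral_sub hi hi2, ← integral_smul, fracDiff,
    ← integral_mul_const_of_integrable hik]
  refine integral_congr_ae (Eventually.of_forall fun u => ?_)
  simp only
  rw [← sub_smul, smul_smul, smul_mul_assoc, fracKernel, diffKernel]
  push_cast
  rfl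

theorem exists_isFracDiff (h : S.IsBoundedAnalytic M C Q) (hA : S.IsGeneratedByNeg A)
    (h0 : 0 ≤ α) (h1 : α ≤ 1) : ∃ W, S.IsFracDiff A α Q W := by
  have hM : 0 ≤ M := (norm_nonneg _).trans (h.norm_op_le 0)
  -- The integral formula degenerates at `α = 0`, where `W s = 1 - e^(-sA)` is used directly.
  -- `IsFracDiff` records what both cases share.
  rcases h0.eq_or_lt with rfl | h0
  · refine ⟨fun s => 1 - S.op s, ⟨?_, fun s => ?_, fun s => ?_, fun μ => ?_, ⟨1 + M, fun s => ?_⟩,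
      fun r hr => ?_, fun t ht => ?_⟩⟩
    · refine isHPValue_one_sub_op.congr fun z _ => ?_
      simp
    · simp only [mul_sub, sub_mul, one_mul, mul_one, S.op_commute 1 s]
      abel
    · exact sub_mem S.one_mem_commutant (S.op_mem_commutant s)
    · exact aestronglyMeasurable_const.sub (h.aestronglyMeasurable_op μ)
    · have h3 : ‖(1 : X →L[ℂ] X)‖ ≤ 1 := ContinuousLinearMap.norm_id_le
      have h4 : ‖1 - S.op s‖ ≤ 1 + M :=
        (norm_sub_le _ _).trans (add_le_add h3 (h.norm_op_le s))
      exact h4.trans (le_mul_of_one_le_right (by positivity) (by simp))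
    · have := neg_mem (h.op_sub_exp_mem hA r 1)
      convert! this using 1
      simp only [NNReal.coe_one, mul_one, neg_zero, Real.rpow_zero, Complex.ofReal_sub,
        Complex.ofReal_one]
      module
    · exact ⟨Q t * Q t, mul_mem_commutant (h.mem_commutant ht) (h.mem_commutant ht), rfl⟩
  · refine ⟨S.fracDiff α, ⟨?_, fun s => ?_, fun s => fracDiff_mem_commutant S α s,
      fun μ => (h.continuous_fracDiff h0 h1).aestronglyMeasurable,
      ⟨M * ((Real.Gamma α)⁻¹ * (2 / α)), fun s => ?_⟩,
      fun r hr => h.fracDiff_one_sub_mem hA h0 h1 hr,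
      fun t ht => h.exists_fracDiff_mul_sq h0 h1 ht⟩⟩
    · refine (h.isHPValue_integral ((measurable_diffKernel α (1 : ℝ≥0)).const_mul _)
        (integrable_fracKernel h0 h1 1) fun u hu => fracKernel_of_nonpos 1 hu).congr fun z hz => ?_
      have := integral_fracKernel_mul_cexp h0 1 hz
      rw [NNReal.coe_one, Complex.ofReal_one, one_mul] at this
      exact this.symm
    · have e := h.fracDiff_add h0 h1 s 1
      rw [add_comm s 1, h.fracDiff_add h0 h1 1 s] at e
      simp only [sub_mul, one_mul]
      rw [sub_eq_sub_iff_add_eq_add, ← e, add_comm]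
    · refine (h.norm_fracDiff_le h0 h1 s).trans ?_
      have hΓ := Real.Gamma_pos_of_pos h0
      have : (s : ℝ) ^ α ≤ 1 + s := by
        rcases le_total (s : ℝ) 1 with hs | hs
        · exact (Real.rpow_le_one s.coe_nonneg hs h0.le).trans (by simp)
        · exact (Real.rpow_le_rpow_of_exponent_le hs h1).trans (by simp)
      calc M * ((Real.Gamma α)⁻¹ * (2 * (s : ℝ) ^ α / α))
          = M * ((Real.Gamma α)⁻¹ * (2 / α)) * (s : ℝ) ^ α := by ring
        _ ≤ _ := by gcongr

end IsBoundedAnalytic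

end C0Semigroup

/-! ### The lower bound -/

namespace C0Semigroup

variable {X : Type*} [NormedAddCommGroup X] [NormedSpace ℂ X] [CompleteSpace X]
variable {S : C0Semigroup X} {A : X →ₗ.[ℂ] X} {M C α : ℝ} {Q W : ℝ≥0 → X →L[ℂ] X}

/-- If `T - v` and `K - k` lie in a closed ideal, `T` being `F(A)` for a function with value `v` at
the spectral point `r`, then so does `A^{-α} T - v r^{-α}`. -/
lemma norm_le_of_mul_eq (h : S.IsBoundedAnalytic M C Q) (hA : S.IsGeneratedByNeg A)
    (hW : S.IsFracDiff A α Q W) {r : ℝ} (hr : 0 < r) (hspec : (r : ℂ) ∈ unboundedSpectrum A)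
    {T B : X →L[ℂ] X} {v : ℝ} (hB : B ∈ S.commutant)
    (hT : T - (v : ℂ) • 1 ∈ (S.resolventIdeal A (r : ℂ)).topologicalClosure)
    (hTB : W 1 * T = (1 - S.op 1) * B) : |v| * r ^ (-α) ≤ ‖B‖ := by
  set p : ℝ := 1 - Real.exp (-r) with hp
  have hp0 : 0 < p := sub_pos.2 (Real.exp_lt_one_iff.2 (neg_lt_zero.2 hr))
  set k : ℝ := p * r ^ (-α) with hk
  have h1 : ((p : ℂ) • 1 - (1 - S.op 1) : X →L[ℂ] X)
      ∈ (S.resolventIdeal A (r : ℂ)).topologicalClosure := by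
    have := h.op_sub_exp_mem hA r 1
    convert! this using 1
    rw [hp, NNReal.coe_one, mul_one]
    push_cast
    module
  -- With `p = 1 - e^(-r)` and `k = p r^(-α)`, the three terms telescope to `p B - v k`; dividing by
  -- `p` leaves `B - v r^(-α)`.
  have h2 := add_mem (add_mem (mul_mem_closure_resolventIdeal_right hB h1)
    (mul_mem_closure_resolventIdeal_left hA (hW.mem_commutant 1) hT))
    (Submodule.smul_mem _ (v : ℂ) (hW.sub_mem r hr))
  have h3 : B - ((v * r ^ (-α) : ℝ) : ℂ) • 1
      ∈ (S.resolventIdeal A (r : ℂ)).topologicalClosure := by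
    have := Submodule.smul_mem _ ((p⁻¹ : ℝ) : ℂ) h2
    convert! this using 1
    rw [sub_mul, mul_sub, hTB, mul_smul_comm, smul_mul_assoc, one_mul, mul_one, smul_sub,
      smul_smul, ← Complex.ofReal_mul, ← hk]
    have e : (p : ℂ) • B - (1 - S.op 1) * B + ((1 - S.op 1) * B - (v : ℂ) • W 1)
        + ((v : ℂ) • W 1 - ((v * k : ℝ) : ℂ) • 1) = (p : ℂ) • B - ((v * k : ℝ) : ℂ) • 1 := by
      abel
    rw [e, smul_sub, smul_smul, smul_smul, ← Complex.ofReal_mul, ← Complex.ofReal_mul,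
      inv_mul_cancel₀ hp0.ne', Complex.ofReal_one, one_smul]
    congr 3
    rw [hk]
    field_simp
  have h4 := norm_le_of_sub_mem_closure_resolventIdeal hA hspec h3
  rwa [Complex.norm_real, Real.norm_eq_abs, abs_mul, abs_of_pos (Real.rpow_pos_of_pos hr _)] at h4

/-- Both halves of the theorem are instances, the first with `a = 0`. The final time is `t + t`
because `Q t * Q t` is `A² e^(-2tA)`. -/
lemma exists_fracPowCompEq_le_norm (h : S.IsBoundedAnalytic M C Q) (hA : S.IsGeneratedByNeg A)
    (hran : Dense {y : X | ∃ x : A.domain, A x = y})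
    (hspec : ∀ r : ℝ, 0 ≤ r → (r : ℂ) ∈ unboundedSpectrum A)
    (h0 : 0 ≤ α) (h1 : α ≤ 1) {ρ : Measure ℝ≥0} [IsProbabilityMeasure ρ]
    (hρ : Integrable (fun s : ℝ≥0 => (s : ℝ)) ρ) {t : ℝ≥0} (ht : 0 < t) (a : ℝ) :
    ∃ B : X →L[ℂ] X,
      S.FracPowCompEq (-α) ((∫ s, S.op s ∂ρ) - S.op (t + t) - (a : ℂ) • (Q t * Q t)) B ∧
      ∀ r : ℝ, 0 < r →
        |(∫ s : ℝ≥0, Real.exp (-(r * s)) ∂ρ) - Real.exp (-(r * (t + t : ℝ≥0)))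
          - a * (r ^ 2 * Real.exp (-(r * (t + t : ℝ≥0))))| * r ^ (-α) ≤ ‖B‖ := by
  obtain ⟨W, hW⟩ := h.exists_isFracDiff hA h0 h1
  obtain ⟨B₂, hB₂, hB₂'⟩ := hW.exists_mul_sq t ht
  have hi := h.integrable_op ρ
  have hWi : Integrable W ρ := by
    obtain ⟨c, hc⟩ := hW.norm_le
    exact (((integrable_const 1).add hρ).const_mul c).mono' (hW.aestronglyMeasurable ρ)
      (Eventually.of_forall hc)
  set V : X →L[ℂ] X := ∫ s, S.op s ∂ρ with hV
  -- Formally `A^(-α) (∫ e^(-sA) dρ - e^(-2tA))` is the difference of `(1 - e^(-2tA)) A^(-α)` and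
  -- the `ρ`-mean of `(1 - e^(-sA)) A^(-α)`. The first moment of `ρ` makes this mean converge, as
  -- `‖W s‖ ≤ c (1 + s)`.
  obtain ⟨B₁, hB₁⟩ : ∃ B₁, B₁ = W (t + t) - ∫ s, W s ∂ρ := ⟨_, rfl⟩
  have hB₁c : B₁ ∈ S.commutant := hB₁ ▸ sub_mem (hW.mem_commutant _)
    (Submodule.integral_mem_of_isClosed S.isClosed_commutant hW.mem_commutant)
  have hcomm : V * W 1 = W 1 * V := by
    rw [hV, ← integral_mul_const_of_integrable hi, ← integral_const_mul_of_integrable hi]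
    exact integral_congr_ae (Eventually.of_forall fun s => hW.mem_commutant 1 s)
  have hB₁' : W 1 * (V - S.op (t + t)) = (1 - S.op 1) * B₁ := by
    have hi1 : Integrable (fun s => 1 - S.op s) ρ := (integrable_const _).sub hi
    have e : ∫ s, (1 - S.op 1) * W s ∂ρ = (1 - V) * W 1 := by
      simp only [hW.one_sub_mul]
      rw [integral_mul_const_of_integrable hi1,
        integral_sub (integrable_const _) hi, integral_const, probReal_univ, one_smul]
    rw [hB₁, mul_sub (1 - S.op 1), hW.one_sub_mul, ← integral_const_mul_of_integrable hWi, e,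
      mul_sub, ← hcomm,
      ← hW.mem_commutant 1]
    simp only [sub_mul, one_mul]
    abel
  have hB : B₁ - (a : ℂ) • B₂ ∈ S.commutant := sub_mem hB₁c (Submodule.smul_mem _ _ hB₂)
  have hTB : W 1 * (V - S.op (t + t) - (a : ℂ) • (Q t * Q t))
      = (1 - S.op 1) * (B₁ - (a : ℂ) • B₂) := by
    rw [mul_sub, hB₁', mul_smul_comm, hB₂', mul_sub, mul_smul_comm]
  refine ⟨B₁ - (a : ℂ) • B₂, fracPowCompEq_neg_of_mul_eq h.norm_op_le hW.isHPValue
    (h.injective_one_sub_op hA hran) hTB, fun r hr => ?_⟩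
  refine norm_le_of_mul_eq h hA hW hr (hspec r hr.le) hB ?_ hTB
  have hie : Integrable (fun s : ℝ≥0 => ((Real.exp (-(r * s)) : ℝ) : ℂ)) ρ := by
    refine (integrable_const (1 : ℝ)).mono' (by fun_prop) (Eventually.of_forall fun s => ?_)
    rw [Complex.norm_real, Real.norm_of_nonneg (Real.exp_nonneg _), Real.exp_le_one_iff, neg_nonpos]
    positivity
  have hVm : V - ((∫ s : ℝ≥0, Real.exp (-(r * s)) ∂ρ : ℝ) : ℂ) • 1
      ∈ (S.resolventIdeal A (r : ℂ)).topologicalClosure := by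
    have e : (∫ s : ℝ≥0, ((Real.exp (-(r * s)) : ℝ) : ℂ) ∂ρ) • (1 : X →L[ℂ] X)
        = ∫ s : ℝ≥0, ((Real.exp (-(r * s)) : ℝ) : ℂ) • (1 : X →L[ℂ] X) ∂ρ :=
      (integral_smul_const (𝕜 := ℂ) (E := X →L[ℂ] X) _ 1).symm
    rw [← integral_complex_ofReal, e, hV, ← integral_sub hi (hie.smul_const _)]
    exact Submodule.integral_mem_of_isClosed (Submodule.isClosed_topologicalClosure _)
      fun s => h.op_sub_exp_mem hA r s
  have := sub_mem (sub_mem hVm (h.op_sub_exp_mem hA r (t + t)))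
    (Submodule.smul_mem _ (a : ℂ) (h.sq_sub_mem hA r ht))
  convert! this using 1
  push_cast
  module

/-! ### The approximants -/

/-- `ρ` is the law of `t/n` times a sum of `n` independent variables with law `ν`; independence
turns its Laplace transform into an n-th power. -/
lemma exists_measure_approximant_eq (h : S.IsBoundedAnalytic M C Q) {g : ℝ → ℝ}
    (hν : HasUnitMean (bernsteinMeasure g)) (t : ℝ≥0) (n : ℕ) :
    ∃ ρ : Measure ℝ≥0, IsProbabilityMeasure ρ ∧ Integrable (fun s : ℝ≥0 => (s : ℝ)) ρ ∧
      S.approximant g t n = ∫ s, S.op s ∂ρ ∧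
      ∀ r : ℝ, ∫ s : ℝ≥0, Real.exp (-(r * s)) ∂ρ
        = (∫ s : ℝ≥0, Real.exp (-(r * (t / n) * s)) ∂bernsteinMeasure g) ^ n := by
  set ν := bernsteinMeasure g with hν'
  have hprob := hν.prob
  set c : ℝ≥0 := t / n with hc
  set P : Measure (Fin n → ℝ≥0) := Measure.pi fun _ => ν with hP
  have hm : Measurable fun x : Fin n → ℝ≥0 => ∑ i, x i := by fun_prop
  have hmc : Measurable fun x : Fin n → ℝ≥0 => c * ∑ i, x i := by fun_prop
  have hp1 : IsProbabilityMeasure (P.map fun x => ∑ i, x i) :=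
    Measure.isProbabilityMeasure_map hm.aemeasurable
  have hp2 : IsProbabilityMeasure (P.map fun x => c * ∑ i, x i) :=
    Measure.isProbabilityMeasure_map hmc.aemeasurable
  refine ⟨P.map fun x => c * ∑ i, x i, hp2, ?_, ?_, fun r => ?_⟩
  · rw [integrable_map_measure (by fun_prop) hmc.aemeasurable]
    have : ∀ i : Fin n, Integrable (fun x : Fin n → ℝ≥0 => ((x i : ℝ≥0) : ℝ)) P := fun i =>
      (measurePreserving_eval (fun _ : Fin n => ν) i).integrable_comp_of_integrable hν.integrable_coe
    refine ((integrable_finsetSum Finset.univ fun i _ => this i).const_mul (c : ℝ)).congr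
      (Eventually.of_forall fun x => ?_)
    simp
  · refine IsHPValue.hp_eq (S := S.scale c) (M := M) (fun s => h.norm_op_le _)
      ⟨P.map fun x => ∑ i, x i, fun _ => 1, ⟨inferInstance, integrable_const _, fun z _ => ?_⟩,
        fun x => ?_⟩
    · simp only [one_mul]
      rw [integral_map hm.aemeasurable (by fun_prop)]
      have := integral_fintype_prod_eq_pow (ι := Fin n) (μ := ν)
        (fun s : ℝ≥0 => Complex.exp (-(((s : ℝ) : ℂ) * z)))
      rw [Fintype.card_fin] at this
      rw [laplaceExt, ← this]
      refine integral_congr_ae (Eventually.of_forall fun x => ?_)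
      simp only
      rw [← Complex.exp_sum]
      push_cast
      rw [Finset.sum_neg_distrib, Finset.sum_mul]
    · rw [ContinuousLinearMap.integral_apply (h.integrable_op _),
        integral_map hmc.aemeasurable (S.continuous_op x).aestronglyMeasurable]
      simp only [one_smul]
      rw [integral_map hm.aemeasurable ((S.scale c).continuous_op x).aestronglyMeasurable]
      rfl
  · rw [integral_map hmc.aemeasurable (by fun_prop)]
    have := integral_fintype_prod_eq_pow (ι := Fin n) (μ := ν)
      (fun s : ℝ≥0 => Real.exp (-(r * (t / n) * s)))
    rw [Fintype.card_fin] at this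
    rw [← this]
    refine integral_congr_ae (Eventually.of_forall fun x => ?_)
    simp only
    rw [← Real.exp_sum, Finset.sum_neg_distrib, hc]
    push_cast
    rw [Finset.mul_sum, Finset.mul_sum]
    simp only [mul_assoc]

end C0Semigroup

/-! ### The main theorem -/

theorem mainTheorem10 {X : Type*} [NormedAddCommGroup X] [NormedSpace ℂ X] [CompleteSpace X]
    (S : C0Semigroup X) (A : X →ₗ.[ℂ] X)
    (hA : S.IsGeneratedByNeg A) (hS : S.IsSectoriallyBoundedHolomorphic)
    (hran : Dense {y : X | ∃ x : A.domain, A x = y})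
    (hspec : ∀ r : ℝ, 0 ≤ r → (r : ℂ) ∈ unboundedSpectrum A)
    (g : ℝ → ℝ) (hg : ClassB4 g) (hne : ∃ z : ℝ, 0 < z ∧ g z ≠ Real.exp (-z)) :
    (∃ c : ℝ, 0 < c ∧ ∀ α : ℝ, 0 ≤ α → α ≤ 1 → ∀ t : ℝ≥0, 0 < t → ∀ n : ℕ, 1 ≤ n →
      ∃ B : X →L[ℂ] X,
        S.FracPowCompEq (-α) (S.approximant g t n - S.op t) B ∧
        c * ((t : ℝ) ^ α / (n : ℝ)) ≤ ‖B‖) ∧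
    (functionalB g ≠ 0 →
      ∃ c : ℝ, 0 < c ∧ ∀ α : ℝ, 0 ≤ α → α ≤ 1 → ∀ t : ℝ≥0, 0 < t → ∀ n : ℕ, 1 ≤ n →
        ∃ D B : X →L[ℂ] X,
          SquareCompEq A (S.op t) D ∧
          S.FracPowCompEq (-α)
            (S.approximant g t n - S.op t -
              ((functionalA g * (n : ℝ)⁻¹ * (t : ℝ) ^ 2 : ℝ) : ℂ) • D) B ∧
          c * ((t : ℝ) ^ α / (n : ℝ) ^ 2) ≤ ‖B‖) := by 
  obtain ⟨M, C, Q, h⟩ := hS.exists_isBoundedAnalytic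
  have hν := hg.hasUnitMean
  refine ⟨?_, fun hb => ?_⟩
  · have hne' : ∃ z : ℝ, 0 < z ∧
        ∫ s : ℝ≥0, Real.exp (-(z * (s : ℝ))) ∂bernsteinMeasure g ≠ Real.exp (-z) := by
      obtain ⟨z, hz, hgz⟩ := hne
      exact ⟨z, hz, by rwa [← (hg.isLaplaceTransformOf z hz).2]⟩
    obtain ⟨c, hc, hlow⟩ := hν.exists_first_order_lower_bound hne'
    refine ⟨c, hc, fun α h0 h1 t ht n hn => ?_⟩
    have ht' : (0 : ℝ) < t := ht
    have hn' : (0 : ℝ) < n := by exact_mod_cast hn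
    obtain ⟨ρ, hρ, hρi, hρa, hρe⟩ := C0Semigroup.exists_measure_approximant_eq h hν t n
    obtain ⟨B, hB, hBn⟩ :=
      C0Semigroup.exists_fracPowCompEq_le_norm h hA hran hspec h0 h1 hρi (half_pos ht) 0
    rw [add_halves, ← hρa, Complex.ofReal_zero, zero_smul, sub_zero] at hB
    -- At `r = 1/t` the factor `r^(-α)` is exactly `t^α` and the scalar part no longer depends on
    -- `t`, so the constant is uniform in `α` and `t`.
    refine ⟨B, hB, le_trans ?_ (hBn (1 / t) (by positivity))⟩
    have e1 : 1 / (t : ℝ) * (t / n) = 1 / n := by field_simp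
    have e2 : 1 / (t : ℝ) * t = 1 := by field_simp
    have e3 : (1 / (t : ℝ)) ^ (-α) = (t : ℝ) ^ α := by
      rw [one_div, Real.inv_rpow ht'.le, Real.rpow_neg ht'.le, inv_inv]
    rw [hρe, add_halves, e1, e2, e3, zero_mul, sub_zero]
    calc c * ((t : ℝ) ^ α / n) = c / n * (t : ℝ) ^ α := by ring
      _ ≤ _ := by
        gcongr
        exact (hlow n hn).trans (le_abs_self _)
  · obtain ⟨s, hs, c, hc, hlow⟩ :=
      hν.exists_second_order_lower_bound hg.functionalA_eq hg.functionalB_eq hb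
    refine ⟨c * min 1 s⁻¹, by positivity, fun α h0 h1 t ht n hn => ?_⟩
    have ht' : (0 : ℝ) < t := ht
    have hn' : (0 : ℝ) < n := by exact_mod_cast hn
    obtain ⟨ρ, hρ, hρi, hρa, hρe⟩ := C0Semigroup.exists_measure_approximant_eq h hν t n
    obtain ⟨B, hB, hBn⟩ := C0Semigroup.exists_fracPowCompEq_le_norm h hA hran hspec h0 h1 hρi
      (half_pos ht) (functionalA g * (n : ℝ)⁻¹ * (t : ℝ) ^ 2)
    rw [add_halves, ← hρa] at hB
    have hD := h.squareCompEq hA (half_pos ht)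
    rw [add_halves] at hD
    refine ⟨Q (t / 2) * Q (t / 2), B, hD, hB, le_trans ?_ (hBn (s / t) (by positivity))⟩
    have e1 : s / (t : ℝ) * (t / n) = s / n := by field_simp
    have e2 : s / (t : ℝ) * t = s := by field_simp
    have e3 : (s / (t : ℝ)) ^ (-α) = s ^ (-α) * (t : ℝ) ^ α := by
      rw [Real.div_rpow hs.le ht'.le, Real.rpow_neg ht'.le, div_inv_eq_mul]
    have e4 : functionalA g * (n : ℝ)⁻¹ * (t : ℝ) ^ 2 * ((s / t) ^ 2 * Real.exp (-s))
        = functionalA g * (n : ℝ)⁻¹ * (s ^ 2 * Real.exp (-s)) := by field_simp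
    -- At `r = s/t` an extra `s^(-α)` appears; it lies between `1` and `s⁻¹`, so their minimum
    -- serves for all `α` in `[0,1]`.
    have e5 : min 1 s⁻¹ ≤ s ^ (-α) := by
      rcases le_total s 1 with hs1 | hs1
      · exact (min_le_left _ _).trans
          (Real.one_le_rpow_of_pos_of_le_one_of_nonpos hs hs1 (by linarith))
      · refine (min_le_right _ _).trans ?_
        rw [← Real.rpow_neg_one]
        exact Real.rpow_le_rpow_of_exponent_le hs1 (by linarith)
    rw [hρe, add_halves, e1, e2, e3, e4]
    calc c * min 1 s⁻¹ * ((t : ℝ) ^ α / n ^ 2)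
        = c / n ^ 2 * (min 1 s⁻¹ * (t : ℝ) ^ α) := by ring
      _ ≤ _ := by
        gcongr
        exact hlow n hn
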